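/- **Setting.** Let $g\in\mathbb R\setminus\{0\}$, $\mathfrak b=\frac12\frac{g^2}{8\pi+g^2}$, $\hat{\mathfrak b}=\frac12-\mathfrak b$, and let the Sinh-Gordon S-matrix be $$\mathrm S(\beta)=\frac{\sinh\beta-i\sin(2\pi\mathfrak b)}{\sinh\beta+i\sin(2\pi\mathfrak b)} .$$ With $G_{\rm B}$ the Barnes function and $\mathfrak z=i\beta/(2\pi)$, set $$\mathrm F(\beta)=\frac1{\Gamma(1+\mathfrak z)\Gamma(-\mathfrak z)}\,\frac{G_{\rm B}(1-\mathfrak b-\mathfrak z)\,G_{\rm B}(2-\mathfrak b+\mathfrak z)\,G_{\rm B}(1-\hat{\mathfrak b}-\mathfrak z)\,G_{\rm B}(2-\hat{\mathfrak b}+\mathfrak z)}{G_{\rm B}(\mathfrak b-\mathfrak z)\,G_{\rm B}(1+\mathfrak b+\mathfrak z)\,G_{\rm B}(\hat{\mathfrak b}-\mathfrak z)\,G_{\rm B}(1+\hat{\mathfrak b}+\mathfrak z)} .$$ A local operator $O$ is given by real numbers $\omega_O,\mathrm s_O,\mathfrak w_O$ and functions $p_n^{(O)}(\boldsymbol\beta_n\mid\boldsymbol\ell_n)$,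 $\boldsymbol\beta_n\in\mathbb C^n$, $\boldsymbol\ell_n\in\{0,1\}^n$, such that: (a) $p^{(O)}_n$ is entire and $2i\pi$-periodic in each $\beta_a$, and invariant under joint permutations of the $(\beta_a,\ell_a)$; (b) $p^{(O)}_n(\beta_2+i\pi,\beta_2,\dots,\beta_n\mid\boldsymbol\ell_n)=c(\ell_1,\ell_2)\,p^{(O)}_{n-2}(\beta_3,\dots,\beta_n\mid\ell_3,\dots,\ell_n)+h_n(\ell_1,\ell_2\mid\beta_2,\dots,\beta_n)$ for $n\ge2$, with $c(0,1)=c(1,0)=-1/(\sin(2\pi\mathfrak b)\,\mathrm F(i\pi))$; (c) $p^{(O)}_n(\beta_1+\theta,\dots,\beta_n+\theta\mid\boldsymbol\ell_n)=e^{\theta\mathrm s_O}p^{(O)}_n(\boldsymbol\beta_n\mid\boldsymbol\ell_n)$ for $\theta\in\mathbb R$; (d) $|p^{(O)}_n(\boldsymbol\beta_n\mid\boldsymbol\ell_n)|\le C_n\prod_a|\cosh(\Re\beta_a)|^{\mathfrak w_O}$. Its form factors are $$\mathcal F^{(O)}(\boldsymbol\beta_n)=\prod_{a<b}\mathrm F(\beta_a-\beta_b)\sum_{\boldsymbol\ell_n\in\{0,1\}^n}(-1)^{\ell_1+\dots+\ell_n}\prod_{a<b}\Big\{1-i\frac{(\ell_a-\ell_b)\sin(2\pi\mathfrak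 b)}{\sinh(\beta_a-\beta_b)}\Big\}\,p^{(O)}_n(\boldsymbol\beta_n\mid\boldsymbol\ell_n),$$ extended to coinciding real parts of arguments carrying the same imaginary shift by the value $0$. **Conventions.** Let $k\ge1$, $A^{(0)}=\emptyset$ and $A^{(s)}=\{\alpha_a^{(s)}\}_{a=1}^{r_s}$, $s=1,\dots,k$, be sets of real variables. For a set $C$ of variables, $\boldsymbol C$ is the vector of its elements ordered by increasing $(s,a)$, $\overleftarrow{\boldsymbol C}$ the reversed vector, $\overrightarrow{C}^{\,\sigma}$ the vector $\boldsymbol C$ permuted by $\sigma$. Between vectors, $\cup$ is concatenation; between sets it is disjoint union. $\boldsymbol U+i\pi\bar{\boldsymbol e}_\varepsilon$ means that $i\pi(1-\varepsilon/\pi)$ is added to each coordinate. $\Delta(\boldsymbol U\mid\boldsymbol V)=\prod_a2\pi\,\delta(U_a-V_a)$. For two orderings $\boldsymbol U,\boldsymbol V$ of one set, $\mathrm S(\boldsymbol U\mid\boldsymbol V)$ is the product of the $\mathrm S(x-y)$ over the pairs of variables $x,y$ such that $x$ precedes $y$ in $\boldsymbol U$ and $y$ precedes $x$ in $\boldsymbol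 V$. On $\mathbb R^{1,1}$, $\boldsymbol y\cdot\boldsymbol z=y_0z_0-y_1z_1$; $\bar{\boldsymbol p}(C)=\sum_{\alpha\in C}(m\cosh\alpha,m\sinh\alpha)$; $\boldsymbol x_{ba}=\boldsymbol x_b-\boldsymbol x_a$. For $A=A_1\cup A_2$ (disjoint), the doubly regularised kernel is $$\mathcal M^{(O)}(\boldsymbol A;\boldsymbol B)_{\varepsilon,\varepsilon'}=\sum e^{-2i\pi|A_1|\omega_O}\,\Delta(\boldsymbol C_1\cup\boldsymbol D_1\mid\boldsymbol B_1\cup\boldsymbol B_3)\,\mathrm S\big(\overleftarrow{\boldsymbol A}\mid\overleftarrow{\boldsymbol D_1}\cup\overleftarrow{\boldsymbol D_2}\cup\overleftarrow{\boldsymbol C_2}\cup\overleftarrow{\boldsymbol C_1}\big)\,\mathrm S(\boldsymbol B\mid\boldsymbol B_1\cup\boldsymbol B_2\cup\boldsymbol B_3)\,\mathcal F^{(O)}\big(\overleftarrow{\boldsymbol C_2}+i\pi\bar{\boldsymbol e}_\varepsilon,\boldsymbol B_2,\overleftarrow{\boldsymbol D_2}-i\pi\bar{\boldsymbol e}_{\varepsilon'}\big),$$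 summed over $A_1=C_1\cup C_2$, $A_2=D_1\cup D_2$, $B=B_1\cup B_2\cup B_3$ with $|B_1|=|C_1|$, $|B_3|=|D_1|$, and over all orderings of $\boldsymbol B_1$ and of $\boldsymbol B_3$ (the other vectors being index-ordered). Let $O_1,\dots,O_k$ be local operators, $\varepsilon_p,\varepsilon'_p>0$ regulators, $G$ a Schwartz function on $(\mathbb R^{1,1})^k$, $m\in\mathbb R$ the mass, and $A^{(s)}=A_1^{(s)}\cup A_2^{(s)}$, $s=1,\dots,k-1$, arbitrary fixed partitions. Set $$\mathcal G_{\rm tot}[G]=\prod_{p=1}^k\mathcal M^{(O_p)}(\boldsymbol A^{(p-1)};\boldsymbol A^{(p)})_{\varepsilon_p,\varepsilon'_p}\cdot\int\prod_{s=1}^kd\boldsymbol x_s\,G(\boldsymbol x_1,\dots,\boldsymbol x_k)\,e^{i\{\sum_{p=1}^{k-1}\bar{\boldsymbol p}(A^{(p)})\cdot\boldsymbol x_{p+1\,p}-\bar{\boldsymbol p}(A^{(k)})\cdot\boldsymbol x_k\}},$$ the kernels being subordinate to these partitions. **Statement.** Then $$\mathcal G_{\rm tot}[G]=\prod_{s=1}^{k-1}e^{-2i\pi\omega_{O_{s+1}}|A_1^{(s)}|}\sum\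 \prod_{a=1}^{2^{k-1}-1}\prod_{\epsilon=\pm}\Delta\big(\boldsymbol X^{(k-1)}_{a,\epsilon}\mid\boldsymbol E^{(k)}_{a,\epsilon}\big)\prod_{p=2}^{k-1}\prod_{a=1}^{2^{p-1}-1}\Big\{\Delta\big(\boldsymbol X^{(p-1)}_{a,+}\mid\overrightarrow{Y^{(p)}_a}^{\,\sigma_a^{(p-1)}}\big)\,\Delta\big(\boldsymbol X^{(p-1)}_{a,-}\mid\overrightarrow{Y^{(p)}_{a+2^{p-1}}}^{\,\sigma_{a+2^{p-1}}^{(p-1)}}\big)\Big\}$$ $$\times\ \mathscr S_{\rm tot}\ \prod_{p=1}^k\mathcal F^{(O_p)}\Big(\overleftarrow{\boldsymbol\gamma_+^{(p\,p-1)}}\cup\dots\cup\overleftarrow{\boldsymbol\gamma_+^{(p1)}}+i\pi\bar{\boldsymbol e}_{\varepsilon_p},\ \boldsymbol Z^{(p)},\ \overleftarrow{\boldsymbol\gamma_-^{(p\,p-1)}}\cup\dots\cup\overleftarrow{\boldsymbol\gamma_-^{(p1)}}-i\pi\bar{\boldsymbol e}_{\varepsilon_p'}\Big)\cdot\mathscr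 R_{\rm glob}[G],$$ where $Y^{(p)}_j=X_{j,+}^{(p)}\cup X_{j,-}^{(p)}\cup W_{j,+}^{(p)}\cup W_{j,-}^{(p)}$ and: * The sum runs over all partitions (with possibly empty parts) $A_1^{(p)}=\bigcup_{a=1}^{2^p-1}(W_{a,+}^{(p)}\cup X_{a,+}^{(p)})$, $A_2^{(p)}=\bigcup_{a=1}^{2^p-1}(W_{a,-}^{(p)}\cup X_{a,-}^{(p)})$, $1\le p\le k-1$, and $A^{(k)}=E_0^{(k)}\cup\bigcup_{\epsilon=\pm}\bigcup_{a=1}^{2^{k-1}-1}E_{a,\epsilon}^{(k)}$, such that $|X_{a,+}^{(p-1)}|=|Y_a^{(p)}|$ and $|X_{a,-}^{(p-1)}|=|Y_{a+2^{p-1}}^{(p)}|$ for $2\le p\le k-1$, $1\le a\le2^{p-1}-1$, and $|X_{a,\epsilon}^{(k-1)}|=|E_{a,\epsilon}^{(k)}|$ for $1\le a\le2^{k-1}-1$, $\epsilon=\pm$; over the permutations $\sigma_a^{(p-1)}\in\mathfrak S_{|X_{a,+}^{(p-1)}|}$, $\sigma_{a+2^{p-1}}^{(p-1)}\in\mathfrak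 S_{|X_{a,-}^{(p-1)}|}$, $2\le p\le k-1$, $1\le a\le2^{p-1}-1$; and over all orderings of the vectors $\boldsymbol E_{a,\epsilon}^{(k)}$ in the $\Delta$'s. * $\gamma_\epsilon^{(ba)}=\bigcup_{s=0}^{2^{b-a-1}-1}W_{2^{a-1}(2s+1),\epsilon}^{(b-1)}$ for $1\le a<b\le k$; $\Xi_\epsilon^{(p)}=\bigcup_{s=0}^{2^{k-p-1}-1}E_{2^{p-1}(2s+1),\epsilon}^{(k)}$ for $1\le p\le k-1$; $\Xi_+^{(k)}=E_0^{(k)}$, $\Xi_-^{(k)}=\emptyset$; and $\boldsymbol Z^{(p)}=\boldsymbol\Xi_+^{(p)}\cup\boldsymbol\Xi_-^{(p)}\cup\boldsymbol\gamma_+^{(kp)}\cup\boldsymbol\gamma_-^{(kp)}\cup\dots\cup\boldsymbol\gamma_+^{(p+1\,p)}\cup\boldsymbol\gamma_-^{(p+1\,p)}$. * The global regulator is $$\mathscr R_{\rm glob}[G]=\int\prod_{s=1}^kd\boldsymbol x_s\,G(\boldsymbol x_1,\dots,\boldsymbol x_k)\exp\Big(i\sum_{\epsilon=\pm}\Big\{\sum_{1\le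 a<b\le k}\bar{\boldsymbol p}(\gamma_\epsilon^{(ba)})\cdot\boldsymbol x_{ba}-\sum_{a=1}^k\bar{\boldsymbol p}(\Xi_\epsilon^{(a)})\cdot\boldsymbol x_a\Big\}\Big).$$ * The total S-matrix factor is $$\mathscr S_{\rm tot}=\mathrm S\big(\boldsymbol A^{(k)}\mid\boldsymbol C_1^{(k-1)}\cup\boldsymbol\Xi_+^{(k)}\cup\boldsymbol D_1^{(k-1)}\big)\prod_{p=1}^{k-1}\mathrm S\Big(\boldsymbol C_1^{(p)}\cup\boldsymbol\gamma_+^{(p+1\,1)}\cup\dots\cup\boldsymbol\gamma_+^{(p+1\,p)}\cup\boldsymbol\gamma_-^{(p+1\,1)}\cup\dots\cup\boldsymbol\gamma_-^{(p+1\,p)}\cup\boldsymbol D_1^{(p)}\ \Big|\ \boldsymbol C_1^{(p-1)}\cup\boldsymbol Z^{(p)}\cup\boldsymbol D_1^{(p-1)}\Big),$$ where $\boldsymbol C_1^{(0)},\boldsymbol D_1^{(0)}$ are absent and, for $1\le p\le k-1$, $\boldsymbol C_1^{(p)},\boldsymbol D_1^{(p)}$ are the sets below with **any** choice of ordering (which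 may depend on the partitions): for $1\le p\le k-2$, $$C_1^{(p)}=\bigcup_{\epsilon=\pm}\bigcup_{a=1}^{2^p-1}\Big\{\bigcup_{v=p+1}^{k-1}\bigcup_{s=0}^{2^{v-p-1}-1}W^{(v)}_{a+s2^{p+1},\epsilon}\ \cup\bigcup_{s=0}^{2^{k-p-2}-1}E^{(k)}_{a+s2^{p+1},\epsilon}\Big\},$$ $$D_1^{(p)}=\bigcup_{\epsilon=\pm}\bigcup_{a=1}^{2^p-1}\Big\{\bigcup_{v=p+1}^{k-1}\bigcup_{s=0}^{2^{v-p-1}-1}W^{(v)}_{a+(2s+1)2^p,\epsilon}\ \cup\bigcup_{s=0}^{2^{k-p-2}-1}E^{(k)}_{a+(2s+1)2^p,\epsilon}\Big\},$$ and $C_1^{(k-1)}=\bigcup_{a=1}^{2^{k-1}-1}E_{a,+}^{(k)}$, $D_1^{(k-1)}=\bigcup_{a=1}^{2^{k-1}-1}E_{a,-}^{(k)}$. Both sides are finite sums of functions of the real variables times products of Dirac masses. The equality means that, for each product of Dirac masses $\prod_{(v,w)}\delta(x_v-x_w)$, the coefficients on both sides agree at every point of the subspace $\{x_v=x_w\}$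 carrying it, and that both sides have the same integral against every continuous compactly supported function of all the variables. -/

import Mathlib

open scoped BigOperators

noncomputable section

namespace SinhGordon

/-! ### The S-matrix and the form factors -/

/-- The parameter `𝔟 = (1/2) g² / (8π + g²)` attached to the coupling constant `g`. -/
def bPar (g : ℝ) : ℝ := 1 / 2 * (g ^ 2 / (8 * Real.pi + g ^ 2))

/-- The dual parameter `1/2 - 𝔟`. -/
def bHat (g : ℝ) : ℝ := 1 / 2 - bPar g

/-- The two-particle S-matrix. -/
def Smat (g : ℝ) (β : ℂ) : ℂ :=
  (Complex.sinh β - Complex.I * Complex.sin (2 * Real.pi * bPar g)) /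
    (Complex.sinh β + Complex.I * Complex.sin (2 * Real.pi * bPar g))

/-- The Barnes `G` function, through its Weierstrass product
`G(1+w) = (2π)^{w/2} e^{-(w + w²(1+γ))/2} ∏_{n ≥ 1} (1 + w/n)^n e^{w²/(2n) - w}`. -/
def barnesG (z : ℂ) : ℂ :=
  ((2 * Real.pi : ℝ) : ℂ) ^ ((z - 1) / 2)
    * Complex.exp (-((z - 1) + (z - 1) ^ 2 * (1 + Real.eulerMascheroniConstant)) / 2)
    * ∏' n : ℕ, ((1 + (z - 1) / ((n : ℂ) + 1)) ^ (n + 1)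
        * Complex.exp ((z - 1) ^ 2 / (2 * ((n : ℂ) + 1)) - (z - 1)))

/-- The pole-free two-particle form factor, written with `𝔷 = iβ/(2π)`. -/
def minFF (g : ℝ) (β : ℂ) : ℂ :=
  let z : ℂ := Complex.I * β / (2 * Real.pi)
  let b : ℂ := (bPar g : ℂ)
  let b' : ℂ := (bHat g : ℂ)
  1 / (Complex.Gamma (1 + z) * Complex.Gamma (-z)) *
    ((barnesG (1 - b - z) * barnesG (2 - b + z) * barnesG (1 - b' - z) * barnesG (2 - b' + z)) /
      (barnesG (b - z) * barnesG (1 + b + z) * barnesG (b' - z) * barnesG (1 + b' + z)))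

/-- The data of a local operator of the model: a solution `p n (β | ℓ)` of the reduced bootstrap
equations, and the numbers `ω` (the mutual locality index is `e^{2iπω}`), `spin` and `growth`. -/
structure LocalOperator (g : ℝ) where
  p : (n : ℕ) → (Fin n → ℂ) → (Fin n → Fin 2) → ℂ
  ω : ℝ
  spin : ℝ
  growth : ℝ
  holomorphic : ∀ n ℓ, Differentiable ℂ (fun β => p n β ℓ)
  periodic : ∀ n β ℓ (a : Fin n),
    p n (Function.update β a (β a + 2 * Complex.I * Real.pi)) ℓ = p n β ℓ
  symmetric : ∀ n β ℓ (σ : Equiv.Perm (Fin n)), p n (β ∘ σ) (ℓ ∘ σ) = p n β ℓ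
  reduction : ∃ (c : Fin 2 → Fin 2 → ℂ) (h : (n : ℕ) → Fin 2 → Fin 2 → (Fin (n + 1) → ℂ) → ℂ),
    c 0 1 = -1 / (Complex.sin (2 * Real.pi * bPar g) * minFF g (Complex.I * Real.pi)) ∧
    c 1 0 = -1 / (Complex.sin (2 * Real.pi * bPar g) * minFF g (Complex.I * Real.pi)) ∧
    ∀ (n : ℕ) (β : Fin (n + 1) → ℂ) (ℓ : Fin (n + 2) → Fin 2),
      p (n + 2) (Fin.cons (β 0 + Complex.I * Real.pi) β) ℓ
        = c (ℓ 0) (ℓ 1) * p n (Fin.tail β) (Fin.tail (Fin.tail ℓ)) + h n (ℓ 0) (ℓ 1) β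
  boost : ∀ n β ℓ (θ : ℝ), p n (fun a => β a + θ) ℓ = Complex.exp (θ * spin) * p n β ℓ
  bound : ∀ n, ∃ C : ℝ, ∀ β ℓ, ‖p n β ℓ‖ ≤ C * ∏ a : Fin n, |Real.cosh (β a).re| ^ growth

/-- The `𝒦`-transform of a function of `n` complex and `n` binary variables. -/
def kTransform (g : ℝ) (n : ℕ) (p : (Fin n → ℂ) → (Fin n → Fin 2) → ℂ) (β : Fin n → ℂ) : ℂ :=
  ∑ ℓ : Fin n → Fin 2, (-1) ^ (∑ a, (ℓ a : ℕ)) *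
    (∏ e ∈ (Finset.univ : Finset (Fin n × Fin n)).filter (fun e => e.1 < e.2),
      (1 - Complex.I * ((((ℓ e.1 : ℕ) : ℂ) - ((ℓ e.2 : ℕ) : ℂ)) *
        Complex.sin (2 * Real.pi * bPar g)) / Complex.sinh (β e.1 - β e.2))) * p β ℓ

/-- The form factor of the operator `O`, evaluated at a vector of any number of variables. -/
def formFactor {g : ℝ} (O : LocalOperator g) (l : List ℂ) : ℂ :=
  (∏ e ∈ (Finset.univ : Finset (Fin l.length × Fin l.length)).filter (fun e => e.1 < e.2),
      minFF g (l.get e.1 - l.get e.2)) *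
    kTransform g l.length (O.p l.length) l.get

/-! ### The rapidity variables -/

/-- The labels `1, …, k`. -/
abbrev Lvl (k : ℕ) := ↥(Finset.Icc 1 k)

/-- The index set of the variables `α^{(s)}_a`, `1 ≤ s ≤ k`, `a` in a set with `r s` elements,
ordered by increasing `(s, a)`. -/
abbrev Var (k : ℕ) (r : ℕ → ℕ) := Σₗ (s : Lvl k), Fin (r s)

/-- The superscript `s` of the variable `α^{(s)}_a`. -/
def lvl {k : ℕ} {r : ℕ → ℕ} (v : Var k r) : ℕ := ((ofLex v).1 : ℕ)

/-- A value of all rapidities. -/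
abbrev Config (k : ℕ) (r : ℕ → ℕ) := Var k r → ℝ

/-- The set `A^{(s)}`, which is empty for `s = 0`. -/
def setA (k : ℕ) (r : ℕ → ℕ) (s : ℕ) : Finset (Var k r) :=
  Finset.univ.filter (fun v => lvl v = s)

section Words

variable {ι : Type*} [LinearOrder ι]

/-- The vector built from a set of variables, in increasing order of the indices. -/
def vec (C : Finset ι) : List ι := C.sort (· ≤ ·)

/-- The vector `(α_{j_{σ(1)}}, …, α_{j_{σ(n)}})` for the index ordered set `C = {α_{j_a}}`. -/
def vecPerm (C : Finset ι) (σ : Equiv.Perm (Fin C.card)) : List ι :=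
  List.ofFn (fun a => C.orderEmbOfFin rfl (σ a))

/-- `l` is the set `C` with some choice of ordering. -/
def IsOrdering (l : List ι) (C : Finset ι) : Prop := l.Nodup ∧ l.toFinset = C

/-- The S-matrix product `S(U ∣ V)` produced by reordering the coordinates of `U` into those of
`V` by exchanges `(…, x, y, …) ↪ S(x - y) (…, y, x, …)`: one factor for each pair whose order
is reversed. -/
def sProd (g : ℝ) (x : ι → ℝ) (U V : List ι) : ℂ :=
  ∏ e ∈ (U.toFinset ×ˢ U.toFinset).filter
      (fun e => U.idxOf e.1 < U.idxOf e.2 ∧ V.idxOf e.2 < V.idxOf e.1),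
    Smat g ((x e.1 : ℂ) - (x e.2 : ℂ))

/-- The form factor `ℱ^{(O)}(U + iπ ē_ε, V, Z - iπ ē_ε')` with
`ē_ε = (1 - ε/π) (1, …, 1)`. -/
def shiftedFF {g : ℝ} (O : LocalOperator g) (ε ε' : ℝ) (x : ι → ℝ) (U V Z : List ι) : ℂ :=
  formFactor O
    (U.map (fun v => (x v : ℂ) + Complex.I * Real.pi * (1 - ε / Real.pi))
      ++ V.map (fun v => (x v : ℂ))
      ++ Z.map (fun v => (x v : ℂ) - Complex.I * Real.pi * (1 - ε' / Real.pi)))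

/-! ### Generalised functions: finite sums of functions times products of Dirac masses -/

variable (ι) in
/-- Finite sums of (function of the variables `x_v`, `v ∈ ι`) × (product of Dirac masses); the
indeterminate `X (v, w)` stands for the Dirac mass `δ_{x_v ; x_w}`. The meaning as a generalised
function is given by `pairing`. -/
abbrev GenDensity := MvPolynomial (ι × ι) ((ι → ℝ) → ℂ)

/-- A function of the variables. -/
def fn (f : (ι → ℝ) → ℂ) : GenDensity ι := MvPolynomial.C f

/-- `Δ(U ∣ V) = ∏_a 2π δ_{U_a ; V_a}`. -/
def Delta (U V : List ι) : GenDensity ι :=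
  ((U.zip V).map (fun e => fn (fun _ => 2 * (Real.pi : ℂ)) * MvPolynomial.X e)).prod

/-- The linear subspace which carries a product of Dirac masses. -/
def carrier (d : (ι × ι) →₀ ℕ) : Set (ι → ℝ) := {x | ∀ e ∈ d.support, x e.1 = x e.2}

/-- The product of Dirac masses `∏_{(v,w)} δ(x_v - x_w)` as a measure, when the pairs `(v,w)` are
the edges of a forest: the variables in a connected component take a common value, and the
common values are integrated against the Lebesgue measure. -/
def diracMeasure [Finite ι] (d : (ι × ι) →₀ ℕ) : MeasureTheory.Measure (ι → ℝ) :=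
  letI : Fintype (Quot (fun v w : ι => (v, w) ∈ d.support)) := Fintype.ofFinite _
  MeasureTheory.Measure.map
    (fun (t : Quot (fun v w : ι => (v, w) ∈ d.support) → ℝ) (v : ι) => t (Quot.mk _ v))
    MeasureTheory.volume

/-- The action of a generalised function on a test function. -/
def pairing [Finite ι] (D : GenDensity ι) (φ : (ι → ℝ) → ℂ) : ℂ :=
  ∑ d ∈ D.support, ∫ x, MvPolynomial.coeff d D x * φ x ∂(diracMeasure d)

/-! ### The regularised kernel -/

/-- The doubly regularised kernel `ℳ^{(O)}(A ; B)_{ε,ε'}` subordinate to the partition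
`A = A₁ ∪ A₂`. The sum runs through `A₁ = C₁ ∪ C₂`, `A₂ = D₁ ∪ D₂`, `B = B₁ ∪ B₂ ∪ B₃` with
`|B₁| = |C₁|`, `|B₃| = |D₁|`, and through the orderings of `B₁` and `B₃`. -/
def kernel {g : ℝ} (O : LocalOperator g) (ε ε' : ℝ) (A₁ A₂ B : Finset ι) : GenDensity ι :=
  ∑ C₁ ∈ A₁.powerset, ∑ D₁ ∈ A₂.powerset,
  fn (fun _ => Complex.exp (-2 * Complex.I * Real.pi * A₁.card * O.ω)) *
  ∑ Q ∈ (B.powerset ×ˢ B.powerset).filter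
      (fun Q => Disjoint Q.1 Q.2 ∧ Q.1.card = C₁.card ∧ Q.2.card = D₁.card),
  ∑ τ₁ : Equiv.Perm (Fin Q.1.card), ∑ τ₃ : Equiv.Perm (Fin Q.2.card),
    Delta (vec C₁ ++ vec D₁) (vecPerm Q.1 τ₁ ++ vecPerm Q.2 τ₃) *
    fn (fun x =>
      sProd g x (vec (A₁ ∪ A₂)).reverse
          ((vec D₁).reverse ++ (vec (A₂ \ D₁)).reverse
            ++ (vec (A₁ \ C₁)).reverse ++ (vec C₁).reverse)
        * sProd g x (vec B) (vecPerm Q.1 τ₁ ++ vec (B \ (Q.1 ∪ Q.2)) ++ vecPerm Q.2 τ₃)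
        * shiftedFF O ε ε' x (vec (A₁ \ C₁)).reverse (vec (B \ (Q.1 ∪ Q.2)))
            (vec (A₂ \ D₁)).reverse)

end Words

/-! ### Momenta and smearing -/

/-- The Minkowski form on `ℝ^{1,1}`. -/
def mink (y z : ℝ × ℝ) : ℝ := y.1 * z.1 - y.2 * z.2

/-- The total momentum of the particles with rapidities in the set `C`. -/
def momentum {ι : Type*} (mass : ℝ) (x : ι → ℝ) (C : Finset ι) : ℝ × ℝ :=
  ∑ v ∈ C, (mass * Real.cosh (x v), mass * Real.sinh (x v))

/-- The space-time point `𝒙_p`, `1 ≤ p ≤ k`. -/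
def pt {k : ℕ} (y : Lvl k → ℝ × ℝ) (p : ℕ) : ℝ × ℝ :=
  if h : p ∈ Finset.Icc 1 k then y ⟨p, h⟩ else 0

/-- `∫ G(𝒙) e^{i Φ(𝒙)} d𝒙` over `(ℝ^{1,1})^k`. -/
def smear {k : ℕ} (G : SchwartzMap (Lvl k → ℝ × ℝ) ℂ) (Φ : (Lvl k → ℝ × ℝ) → ℝ) : ℂ :=
  ∫ y : Lvl k → ℝ × ℝ, G y * Complex.exp (Complex.I * (Φ y : ℂ))

/-- The phase `𝒫({A^{(s)}}_0^k ; {𝒙_a})`. -/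
def phaseA {k : ℕ} {r : ℕ → ℕ} (mass : ℝ) (x : Config k r) (y : Lvl k → ℝ × ℝ) : ℝ :=
  mink (momentum mass x (setA k r 0)) (pt y 1)
    + ∑ p ∈ Finset.Icc 1 (k - 1), mink (momentum mass x (setA k r p)) (pt y (p + 1) - pt y p)
    - mink (momentum mass x (setA k r k)) (pt y k)

/-! ### The regularised multi-point density -/

/-- `𝒢({A^{(s)}} ; ε, ε')`: the product of the regularised kernels, subordinate to the
partitions `A^{(s)} = A₁ s ∪ A₂ s`. -/
def gDensity {g : ℝ} {k : ℕ} {r : ℕ → ℕ} (O : ℕ → LocalOperator g) (ε ε' : ℕ → ℝ)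
    (A₁ A₂ : ℕ → Finset (Var k r)) : GenDensity (Var k r) :=
  ∏ p ∈ Finset.Icc 1 k, kernel (O p) (ε p) (ε' p) (A₁ (p - 1)) (A₂ (p - 1)) (setA k r p)

/-- `𝒢_tot[G]({A^{(s)}} ; ε, ε')`. -/
def gTot {g : ℝ} {k : ℕ} {r : ℕ → ℕ} (mass : ℝ) (O : ℕ → LocalOperator g) (ε ε' : ℕ → ℝ)
    (A₁ A₂ : ℕ → Finset (Var k r)) (G : SchwartzMap (Lvl k → ℝ × ℝ) ℂ) :
    GenDensity (Var k r) :=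
  gDensity O ε ε' A₁ A₂ * fn (fun x => smear G (phaseA mass x))

/-! ### The partitions summed over in the master representation

Signs are encoded by `Bool`, with `true` for `+` and `false` for `-`. -/

/-- A family of partitions, as a pair of labellings. For `1 ≤ p ≤ k-1`, the first one gives to
each element of `A^{(p)}` an index `a ∈ {1, …, 2^p - 1}` and tells if the element goes to a set
`X` (`true`) or `W` (`false`); the sign is `+` on `A₁^{(p)}` and `-` on `A₂^{(p)}`. The second
one sends each element of `A^{(k)}` to `E_0` (`none`) or to `E_{a,ϵ}` (`some (a, ϵ)`). -/
abbrev MPart (k : ℕ) (r : ℕ → ℕ) := (Var k r → ℕ × Bool) × (Var k r → Option (ℕ × Bool))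

namespace MPart

variable {k : ℕ} {r : ℕ → ℕ} (A₁ A₂ : ℕ → Finset (Var k r)) (P : MPart k r)

/-- `X_{a,ϵ}^{(p)}`. -/
def X (p a : ℕ) (ϵ : Bool) : Finset (Var k r) :=
  (if ϵ then A₁ p else A₂ p).filter (fun v => P.1 v = (a, true))

/-- `W_{a,ϵ}^{(p)}`. -/
def W (p a : ℕ) (ϵ : Bool) : Finset (Var k r) :=
  (if ϵ then A₁ p else A₂ p).filter (fun v => P.1 v = (a, false))

/-- `E_0^{(k)}`. -/
def E0 : Finset (Var k r) := (setA k r k).filter (fun v => P.2 v = none)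

/-- `E_{a,ϵ}^{(k)}`. -/
def E (a : ℕ) (ϵ : Bool) : Finset (Var k r) := (setA k r k).filter (fun v => P.2 v = some (a, ϵ))

/-- `X_{j,+}^{(p)} ∪ X_{j,-}^{(p)} ∪ W_{j,+}^{(p)} ∪ W_{j,-}^{(p)}`. -/
def XW (p j : ℕ) : Finset (Var k r) :=
  X A₁ A₂ P p j true ∪ X A₁ A₂ P p j false ∪ W A₁ A₂ P p j true ∪ W A₁ A₂ P p j false

/-- The index shift: `0` for the sign `+` and `2^{p-1}` for the sign `-`. -/
def tShift (p : ℕ) (ϵ : Bool) : ℕ := if ϵ then 0 else 2 ^ (p - 1)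

/-- The range `1 ≤ a ≤ 2^p - 1`, `ϵ = ±`. -/
def idx (p : ℕ) : Finset (ℕ × Bool) := Finset.Icc 1 (2 ^ p - 1) ×ˢ Finset.univ

/-- The range `2 ≤ p ≤ k-1`, `1 ≤ a ≤ 2^{p-1} - 1`, `ϵ = ±`. -/
def permIdx (k : ℕ) : Finset (Σ _ : ℕ, ℕ × Bool) :=
  (Finset.Icc 2 (k - 1)).sigma (fun p => idx (p - 1))

open Classical in
/-- The partitions, with their cardinality constraints. The labels of the variables which a
labelling does not concern are fixed. -/
def all : Finset (MPart k r) :=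
  ((Fintype.piFinset (fun v : Var k r => if lvl v < k then idx (lvl v) else {(0, false)})) ×ˢ
    (Fintype.piFinset (fun v : Var k r =>
      if lvl v = k then Finset.insertNone (idx (k - 1)) else {none}))).filter (fun P =>
    (∀ p ∈ Finset.Icc 2 (k - 1), ∀ e ∈ idx (p - 1),
      (X A₁ A₂ P (p - 1) e.1 e.2).card = (XW A₁ A₂ P p (e.1 + tShift p e.2)).card) ∧
    (∀ e ∈ idx (k - 1), (X A₁ A₂ P (k - 1) e.1 e.2).card = (E P e.1 e.2).card))

/-- `γ_ϵ^{(ba)} = ⋃_{s=0}^{2^{b-a-1}-1} W_{2^{a-1}(2s+1),ϵ}^{(b-1)}`, for `1 ≤ a < b ≤ k`. -/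
def γ (b a : ℕ) (ϵ : Bool) : Finset (Var k r) :=
  (Finset.range (2 ^ (b - a - 1))).biUnion
    (fun s => W A₁ A₂ P (b - 1) (2 ^ (a - 1) * (2 * s + 1)) ϵ)

/-- `Ξ_ϵ^{(p)} = ⋃_{s=0}^{2^{k-p-1}-1} E_{2^{p-1}(2s+1),ϵ}^{(k)}` for `1 ≤ p ≤ k-1`, while
`Ξ_+^{(k)} = E_0^{(k)}` and `Ξ_-^{(k)} = ∅`. -/
def Ξ (p : ℕ) (ϵ : Bool) : Finset (Var k r) :=
  if p = k then (if ϵ then E0 P else ∅)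
  else (Finset.range (2 ^ (k - p - 1))).biUnion (fun s => E P (2 ^ (p - 1) * (2 * s + 1)) ϵ)

/-- The set `C_1^{(p)}`, `1 ≤ p ≤ k-1`. -/
def C1 (p : ℕ) : Finset (Var k r) :=
  if p = k - 1 then (Finset.Icc 1 (2 ^ (k - 1) - 1)).biUnion (fun a => E P a true)
  else
    (Finset.univ : Finset Bool).biUnion (fun ϵ =>
      (Finset.Icc (p + 1) (k - 1)).biUnion (fun v =>
        (Finset.Icc 1 (2 ^ p - 1)).biUnion (fun a =>
          (Finset.range (2 ^ (v - p - 1))).biUnion (fun s =>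
            W A₁ A₂ P v (a + s * 2 ^ (p + 1)) ϵ)))) ∪
    (Finset.univ : Finset Bool).biUnion (fun ϵ =>
      (Finset.Icc 1 (2 ^ p - 1)).biUnion (fun a =>
        (Finset.range (2 ^ (k - p - 2))).biUnion (fun s => E P (a + s * 2 ^ (p + 1)) ϵ)))

/-- The set `D_1^{(p)}`, `1 ≤ p ≤ k-1`. -/
def D1 (p : ℕ) : Finset (Var k r) :=
  if p = k - 1 then (Finset.Icc 1 (2 ^ (k - 1) - 1)).biUnion (fun a => E P a false)
  else
    (Finset.univ : Finset Bool).biUnion (fun ϵ =>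
      (Finset.Icc (p + 1) (k - 1)).biUnion (fun v =>
        (Finset.Icc 1 (2 ^ p - 1)).biUnion (fun a =>
          (Finset.range (2 ^ (v - p - 1))).biUnion (fun s =>
            W A₁ A₂ P v (a + (2 * s + 1) * 2 ^ p) ϵ)))) ∪
    (Finset.univ : Finset Bool).biUnion (fun ϵ =>
      (Finset.Icc 1 (2 ^ p - 1)).biUnion (fun a =>
        (Finset.range (2 ^ (k - p - 2))).biUnion (fun s => E P (a + (2 * s + 1) * 2 ^ p) ϵ)))

/-- The vector `𝚵_+^{(p)} ∪ 𝚵_-^{(p)} ∪ 𝛄_+^{(kp)} ∪ 𝛄_-^{(kp)} ∪ ⋯ ∪ 𝛄_+^{(p+1 p)} ∪ 𝛄_-^{(p+1 p)}`. -/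
def centralVec (p : ℕ) : List (Var k r) :=
  vec (Ξ P p true) ++ vec (Ξ P p false) ++
    (List.range' (p + 1) (k - p)).reverse.flatMap
      (fun b => vec (γ A₁ A₂ P b p true) ++ vec (γ A₁ A₂ P b p false))

/-- The vector `𝛄_ϵ^{(b1)} ∪ ⋯ ∪ 𝛄_ϵ^{(b b-1)}`. -/
def γRow (b : ℕ) (ϵ : Bool) : List (Var k r) :=
  (List.range' 1 (b - 1)).flatMap (fun a => vec (γ A₁ A₂ P b a ϵ))

/-- The vector `𝛄_ϵ^{(b b-1)} ∪ ⋯ ∪ 𝛄_ϵ^{(b1)}` in which each `𝛄_ϵ^{(ba)}` is reversed. -/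
def γRowRev (b : ℕ) (ϵ : Bool) : List (Var k r) :=
  (List.range' 1 (b - 1)).reverse.flatMap (fun a => (vec (γ A₁ A₂ P b a ϵ)).reverse)

/-- The total S-matrix factor, with `c p` and `d p` the vectors chosen for `C_1^{(p)}` and
`D_1^{(p)}`; these are absent for `p = 0`. -/
def sTot (g : ℝ) (c d : ℕ → List (Var k r)) (x : Config k r) : ℂ :=
  let c' : ℕ → List (Var k r) := fun p => if p = 0 then [] else c p
  let d' : ℕ → List (Var k r) := fun p => if p = 0 then [] else d p
  sProd g x (vec (setA k r k)) (c' (k - 1) ++ vec (Ξ P k true) ++ d' (k - 1)) *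
    ∏ p ∈ Finset.Icc 1 (k - 1),
      sProd g x
        (c' p ++ γRow A₁ A₂ P (p + 1) true ++ γRow A₁ A₂ P (p + 1) false ++ d' p)
        (c' (p - 1) ++ centralVec A₁ A₂ P p ++ d' (p - 1))

/-- The global phase
`∑_ϵ { ∑_{b>a} p(γ_ϵ^{(ba)})·(𝒙_b - 𝒙_a) - ∑_a p(Ξ_ϵ^{(a)})·𝒙_a }`. -/
def phaseGlob (mass : ℝ) (x : Config k r) (y : Lvl k → ℝ × ℝ) : ℝ :=
  ∑ ϵ : Bool,
    ((∑ b ∈ Finset.Icc 1 k, ∑ a ∈ Finset.Ico 1 b,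
        mink (momentum mass x (γ A₁ A₂ P b a ϵ)) (pt y b - pt y a))
      - ∑ a ∈ Finset.Icc 1 k, mink (momentum mass x (Ξ P a ϵ)) (pt y a))

end MPart

open MPart in
/-- The right-hand side of the master representation. The vectors `c P p`, `d P p` are the
choices of ordering for `C_1^{(p)}` and `D_1^{(p)}`; `σ` collects the permutations attached to the
`X_{a,ϵ}^{(p-1)}`, and `τ` the orderings of the `E_{a,ϵ}^{(k)}`. -/
def masterSum {g : ℝ} {k : ℕ} {r : ℕ → ℕ} (mass : ℝ) (O : ℕ → LocalOperator g) (ε ε' : ℕ → ℝ)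
    (A₁ A₂ : ℕ → Finset (Var k r)) (G : SchwartzMap (Lvl k → ℝ × ℝ) ℂ)
    (c d : MPart k r → ℕ → List (Var k r)) : GenDensity (Var k r) :=
  fn (fun _ => ∏ s ∈ Finset.Icc 1 (k - 1),
      Complex.exp (-2 * Complex.I * Real.pi * (O (s + 1)).ω * (A₁ s).card)) *
  ∑ P ∈ MPart.all A₁ A₂,
  ∑ σ : (q : ↥(permIdx k)) →
      Equiv.Perm (Fin (XW A₁ A₂ P q.1.1 (q.1.2.1 + tShift q.1.1 q.1.2.2)).card),
  ∑ τ : (e : ↥(idx (k - 1))) → Equiv.Perm (Fin (E P e.1.1 e.1.2).card),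
    (∏ e : ↥(idx (k - 1)),
      Delta (vec (X A₁ A₂ P (k - 1) e.1.1 e.1.2)) (vecPerm (E P e.1.1 e.1.2) (τ e))) *
    (∏ q : ↥(permIdx k),
      Delta (vec (X A₁ A₂ P (q.1.1 - 1) q.1.2.1 q.1.2.2))
        (vecPerm (XW A₁ A₂ P q.1.1 (q.1.2.1 + tShift q.1.1 q.1.2.2)) (σ q))) *
    fn (fun x =>
      sTot A₁ A₂ P g (c P) (d P) x *
      (∏ p ∈ Finset.Icc 1 k,
        shiftedFF (O p) (ε p) (ε' p) x
          (γRowRev A₁ A₂ P p true) (centralVec A₁ A₂ P p) (γRowRev A₁ A₂ P p false)) *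
      smear G (phaseGlob A₁ A₂ P mass x))

end SinhGordon

end

open scoped BigOperators

namespace SinhGordon

set_option linter.unusedSectionVars false

section Barnes

open Filter Topology

/-! ### The Barnes function -/

/-! Both sides are finite sums over the same objects. In one kernel, a choice of subsets and
orderings is a partial injection of one level into the next. The product of kernels is therefore a
sum over `matchings k r` (`gDensity_eq_sum_matchings`). A matching cuts the variables into chains
running through consecutive levels.

Give each variable the integer whose lowest binary digit 1 sits at position s - 1, where s is the
level at which its chain starts. For n between s and the level below that of the variable, the digit
at position n is 1 exactly when the chain left level n from `A₂`. These integers (`lab`) are the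
indices of the sets X and W, while an element of the top level is indexed by the label and sign of
its predecessor. With this dictionary, partitions together with permutations are again matchings
(`exists_matching`, `masterSum_eq_sum_matchings`). The index families defining γ, Ξ, `C1`, `D1`
become congruences modulo powers of 2. γ^(ba) holds the ends of the chains running from level a to
level b - 1, and Ξ^(p) the ends of those running from p to k. `C1 p` and `D1 p` hold the ends of the
chains that leave level p through a link of sign + or -.

It remains to compare the coefficients, matching by matching, where x is constant along chains.
There each variable may be replaced by the end of its chain, and the phase telescopes
(`phaseA_eq_phaseGlob`). By unitarity every S-product is a ratio of `orderProd`s (`sProd_eq_div`),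
so the detours through index order cancel between consecutive kernels (`prod_kernelCoef`). The
vectors left over agree with those of the right-hand side up to order (`kernelLists_perm`).
Reordering them changes nothing: S-products compensate each other and the form factors, by Watson's
exchange equations (`shiftedFF_perm`, `ChainLists.prod_term_eq`). This is also why the orderings of
`C1` and `D1` are free.

The exchange equations combine the symmetry of the 𝒦-transform with F(β) = S(β) F(-β)
(`minFF_exchange`). The latter follows from the functional equation of the Barnes function
(`barnesG_add_one`) and Euler's reflection formula. -/

/-- The factors of the Weierstrass product of `barnesG`. -/
noncomputable def barnesFactor (w : ℂ) (n : ℕ) : ℂ :=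
  (1 + w / ((n : ℂ) + 1)) ^ (n + 1) * Complex.exp (w ^ 2 / (2 * ((n : ℂ) + 1)) - w)

theorem natCast_add_ne_zero {z : ℂ} (hz : 0 < z.re) (n : ℕ) : (n : ℂ) + z ≠ 0 := by
  intro h
  have := congrArg Complex.re h
  simp at this
  have hn : (0 : ℝ) ≤ n := n.cast_nonneg
  linarith

/-- With u = w/(n+1), the term is n+1 times the remainder of log(1+u) after its second-order Taylor
polynomial. This is (n+1)·O(u³) = O(1/n²). -/
theorem summable_barnes_log (w : ℂ) :
    Summable (fun n : ℕ => ((n : ℂ) + 1) * Complex.log (1 + w / ((n : ℂ) + 1))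
      + w ^ 2 / (2 * ((n : ℂ) + 1)) - w) := by
  have hu : Tendsto (fun n : ℕ => w / ((n : ℂ) + 1)) atTop (𝓝 0) := by
    have h1 : Tendsto (fun n : ℕ => 1 / ((n : ℂ) + 1)) atTop (𝓝 0) :=
      tendsto_one_div_add_atTop_nhds_zero_nat
    simpa [div_eq_mul_inv] using h1.const_mul w
  have hO := (Complex.log_sub_logTaylor_isBigO 2).comp_tendsto hu
  have hn : (fun n : ℕ => ((n : ℂ) + 1)) =O[atTop] (fun n : ℕ => ((n : ℂ) + 1)) :=
    Asymptotics.isBigO_refl _ _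
  have h := hn.mul hO
  have hs : Summable (fun n : ℕ => ‖((n : ℂ) + 1) * ((w / ((n : ℂ) + 1)) ^ 3)‖) := by
    have h2 : Summable (fun n : ℕ => ‖w‖ ^ 3 * (1 / ((n + 1 : ℕ) : ℝ) ^ 2)) :=
      ((summable_nat_add_iff 1).2
        (Real.summable_one_div_nat_pow.2 (by norm_num : 1 < 2))).mul_left _
    refine h2.congr fun n => ?_
    have : ‖(n : ℂ) + 1‖ = (n : ℝ) + 1 := by
      have := Complex.norm_natCast (n + 1)
      push_cast at this
      exact this
    rw [norm_mul, norm_pow, norm_div, this]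
    have hp : (n : ℝ) + 1 ≠ 0 := by positivity
    push_cast
    field_simp
  refine (summable_of_isBigO_nat hs.of_norm.norm (g := fun n : ℕ => ‖_‖) ?_)
  refine Asymptotics.IsBigO.norm_right ?_
  refine h.congr' ?_ (Eventually.of_forall fun n => rfl)
  refine Eventually.of_forall fun n => ?_
  have hp : (n : ℂ) + 1 ≠ 0 := Nat.cast_add_one_ne_zero n
  simp only [Function.comp, Complex.logTaylor_succ, Complex.logTaylor_zero, Pi.add_apply]
  push_cast
  field_simp
  ring

/-- Exponentiate the logarithmic series. For Re z > 0 no factor (n+z)/(n+1) vanishes, so exp inverts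
log. -/
theorem hasProd_barnesFactor {z : ℂ} (hz : 0 < z.re) :
    HasProd (barnesFactor (z - 1)) (∏' n, barnesFactor (z - 1) n) := by
  have h := (summable_barnes_log (z - 1)).hasSum.cexp
  have he : (Complex.exp ∘ fun n : ℕ => ((n : ℂ) + 1) * Complex.log (1 + (z - 1) / ((n : ℂ) + 1))
      + (z - 1) ^ 2 / (2 * ((n : ℂ) + 1)) - (z - 1)) = barnesFactor (z - 1) := by
    funext n
    have hp : (n : ℂ) + 1 ≠ 0 := Nat.cast_add_one_ne_zero n
    have h0 : 1 + (z - 1) / ((n : ℂ) + 1) ≠ 0 := by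
      have := natCast_add_ne_zero hz n
      intro hh
      apply this
      field_simp at hh
      linear_combination hh
    have h1 := Complex.exp_nat_mul (Complex.log (1 + (z - 1) / ((n : ℂ) + 1))) (n + 1)
    push_cast at h1
    simp only [Function.comp, barnesFactor]
    rw [add_sub_assoc, Complex.exp_add, h1, Complex.exp_log h0]
  rw [he] at h
  exact h.multipliable.hasProd

/-- A finite form of the functional equation: the powers ((n+1+z)/(n+z))^(n+1) telescope, and the
exponents add up to a harmonic sum. -/
theorem prod_barnesFactor_succ {z : ℂ} (hz : 0 < z.re) (N : ℕ) :
    ∏ n ∈ Finset.range N, barnesFactor z n =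
      (∏ n ∈ Finset.range N, barnesFactor (z - 1) n) *
        ((N + z) ^ N / (∏ j ∈ Finset.range N, (z + j)) *
          Complex.exp ((z - 1 / 2) * (harmonic N : ℚ) - N)) := by
  induction N with
  | zero => simp
  | succ n ih =>
    rw [Finset.prod_range_succ, Finset.prod_range_succ, Finset.prod_range_succ, ih, harmonic_succ]
    have h0 := natCast_add_ne_zero hz n
    have hp : (n : ℂ) + 1 ≠ 0 := Nat.cast_add_one_ne_zero n
    have hprod : ∏ j ∈ Finset.range n, (z + j) ≠ 0 :=
      Finset.prod_ne_zero_iff.2 fun j _ => by rw [add_comm]; exact natCast_add_ne_zero hz j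
    have e1 : 1 + z / ((n : ℂ) + 1) = (n + 1 + z) / (n + 1) := by field_simp
    have e2 : 1 + (z - 1) / ((n : ℂ) + 1) = (n + z) / (n + 1) := by field_simp; ring
    have e3 : Complex.exp ((z - 1 / 2) * ((harmonic n + (↑(n + 1))⁻¹ : ℚ) : ℂ) - (n + 1 : ℕ)) *
        Complex.exp ((z - 1) ^ 2 / (2 * ((n : ℂ) + 1)) - (z - 1)) =
        Complex.exp ((z - 1 / 2) * (harmonic n : ℚ) - n) *
          Complex.exp (z ^ 2 / (2 * ((n : ℂ) + 1)) - z) := by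
      rw [← Complex.exp_add, ← Complex.exp_add]
      congr 1
      push_cast
      field_simp
      ring
    generalize ∏ x ∈ Finset.range n, barnesFactor (z - 1) x = Q
    simp only [barnesFactor, e1, e2]
    rw [div_pow, div_pow]
    calc _ = Q *
          ((n + z) ^ n / ∏ j ∈ Finset.range n, (z + j)) * ((n + 1 + z) ^ (n + 1) / (n + 1) ^ (n + 1))
          * (Complex.exp ((z - 1 / 2) * (harmonic n : ℚ) - n) *
          Complex.exp (z ^ 2 / (2 * ((n : ℂ) + 1)) - z)) := by
            ring
      _ = _ := by
        rw [← e3]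
        have h0' : z + (n : ℂ) ≠ 0 := by rwa [add_comm]
        push_cast
        field_simp
        ring

/-- The ratio splits into (1+z/N)^N, Euler's sequence for Γ, the sequence defining the
Euler–Mascheroni constant, and Stirling's sequence. The extra factor 1+z/N repairs the one
additional denominator of `Complex.GammaSeq`. -/
theorem tendsto_barnes_ratio {z : ℂ} (hz : 0 < z.re) :
    Tendsto (fun N : ℕ => ((N : ℂ) + z) ^ N / (∏ j ∈ Finset.range N, (z + j)) *
          Complex.exp ((z - 1 / 2) * (harmonic N : ℚ) - N)) atTop
      (𝓝 (Complex.exp z * 1 * Complex.Gamma z *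
        (Complex.exp ((z - 1 / 2) * Real.eulerMascheroniConstant) *
          ((√Real.pi : ℂ) * (√2 : ℝ))⁻¹))) := by
  have t1 := Complex.tendsto_one_add_div_pow_exp z
  have t2 : Tendsto (fun N : ℕ => 1 + z / (N : ℂ)) atTop (𝓝 1) := by
    have := (tendsto_inv_atTop_nhds_zero_nat (𝕜 := ℂ)).const_mul z
    simpa [div_eq_mul_inv] using this.const_add 1
  have t3 := Complex.GammaSeq_tendsto_Gamma z
  have t4 : Tendsto (fun N : ℕ => Complex.exp ((z - 1 / 2) *
      (((harmonic N : ℚ) - Real.log N : ℝ) : ℂ))) atTop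
      (𝓝 (Complex.exp ((z - 1 / 2) * Real.eulerMascheroniConstant))) := by
    refine (Complex.continuous_exp.tendsto _).comp ?_
    refine Tendsto.const_mul _ ?_
    exact (Complex.continuous_ofReal.tendsto _).comp Real.tendsto_harmonic_sub_log
  have t5 : Tendsto (fun N : ℕ => ((Stirling.stirlingSeq N : ℂ) * (√2 : ℝ))⁻¹) atTop
      (𝓝 (((√Real.pi : ℂ) * (√2 : ℝ))⁻¹)) := by
    refine Tendsto.inv₀ ?_ ?_
    · exact ((Complex.continuous_ofReal.tendsto _).comp Stirling.tendsto_stirlingSeq_sqrt_pi).mul_const _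
    · have : (√Real.pi : ℝ) * √2 ≠ 0 := by positivity
      exact_mod_cast this
  refine (((t1.mul t2).mul t3).mul (t4.mul t5)).congr' ?_
  filter_upwards [eventually_gt_atTop 0] with N hN
  have hNr : (0 : ℝ) < N := by exact_mod_cast hN
  have hNc : (N : ℂ) ≠ 0 := by exact_mod_cast hN.ne'
  have hzN : z + (N : ℂ) ≠ 0 := by rw [add_comm]; exact natCast_add_ne_zero hz N
  have hprod : ∏ j ∈ Finset.range N, (z + j) ≠ 0 :=
    Finset.prod_ne_zero_iff.2 fun j _ => by rw [add_comm]; exact natCast_add_ne_zero hz j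
  have hlog : (N : ℂ) = Complex.exp (Real.log N) := by
    rw [← Complex.ofReal_exp, Real.exp_log hNr]; simp
  have hcpow : (N : ℂ) ^ z = Complex.exp (Real.log N * z) := by
    rw [Complex.cpow_def_of_ne_zero hNc, ← Complex.natCast_log]
  have hsqrt : ((√N : ℝ) : ℂ) = Complex.exp (Real.log N * (1 / 2)) := by
    rw [Real.sqrt_eq_rpow, Real.rpow_def_of_pos hNr]
    push_cast
    rfl
  have hst : (N.factorial : ℂ) = Stirling.stirlingSeq N * ((√2 : ℝ) * (√N : ℝ)) *
      ((N : ℂ) ^ N * Complex.exp (-N)) := by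
    have h1 : (N.factorial : ℝ) = Stirling.stirlingSeq N * (√2 * √N) * (N ^ N * Real.exp (-N)) := by
      have : Real.exp (N : ℝ) = Real.exp 1 ^ N := by rw [← Real.exp_nat_mul]; simp
      rw [Stirling.stirlingSeq, Real.sqrt_mul (by norm_num), Real.exp_neg, this, div_pow]
      have h2 : √(N : ℝ) ≠ 0 := by positivity
      field_simp
    have := congrArg (fun t : ℝ => (t : ℂ)) h1
    push_cast at this ⊢
    exact this
  have hsne : (Stirling.stirlingSeq N : ℂ) ≠ 0 := by
    have : Stirling.stirlingSeq N ≠ 0 := by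
      rw [Stirling.stirlingSeq]; positivity
    exact_mod_cast this
  have h2ne : ((√2 : ℝ) : ℂ) ≠ 0 := by
    have : √(2 : ℝ) ≠ 0 := by positivity
    exact_mod_cast this
  -- Replacing the harmonic number by its difference with log N costs N^(z-1/2). Euler's sequence
  -- supplies N^z, and the surplus √N goes to Stirling's formula.
  have key : Complex.exp ((z - 1 / 2) * (((harmonic N : ℚ) - Real.log N : ℝ) : ℂ)) *
      (N : ℂ) ^ z = Complex.exp ((z - 1 / 2) * (harmonic N : ℚ) - N) *
        (Complex.exp (N : ℂ) * (√N : ℝ)) := by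
    rw [hcpow, hsqrt, ← Complex.exp_add, ← Complex.exp_add, ← Complex.exp_add]
    congr 1
    push_cast
    ring
  have hee : Complex.exp (N : ℂ) * Complex.exp (-(N : ℂ)) = 1 := by
    rw [← Complex.exp_add]; simp
  have hss : ((√N : ℝ) : ℂ) * (√N : ℝ) = N := by
    rw [← Complex.ofReal_mul, Real.mul_self_sqrt hNr.le]; simp
  rw [Complex.GammaSeq, Finset.prod_range_succ, hst]
  have e1 : 1 + z / (N : ℂ) = (N + z) / N := by field_simp
  rw [e1, div_pow]
  have e2 : (N : ℂ) + z = z + N := add_comm _ _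
  rw [e2]
  have e3 : (z + (N : ℂ)) ^ N / (∏ j ∈ Finset.range N, (z + j)) *
          Complex.exp ((z - 1 / 2) * (harmonic N : ℚ) - N) =
      (z + (N : ℂ)) ^ N / (∏ j ∈ Finset.range N, (z + j)) * (Complex.exp ((z - 1 / 2) * (harmonic N : ℚ) - N) *
        (Complex.exp (N : ℂ) * (√N : ℝ))) * (Complex.exp (-(N : ℂ)) * (√N : ℝ)) / N := by
    calc _ = (z + (N : ℂ)) ^ N / (∏ j ∈ Finset.range N, (z + j)) *
          Complex.exp ((z - 1 / 2) * (harmonic N : ℚ) - N) *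
            (Complex.exp (N : ℂ) * Complex.exp (-(N : ℂ))) * (((√N : ℝ) : ℂ) * (√N : ℝ)) / N := by
            rw [hee, hss]; field_simp
      _ = _ := by ring
  rw [e3, ← key]
  have hNp : (N : ℂ) ^ N ≠ 0 := pow_ne_zero _ hNc
  field_simp

/-- The functional equation of the Barnes function. -/
theorem barnesG_add_one {z : ℂ} (hz : 0 < z.re) :
    barnesG (z + 1) = Complex.Gamma z * barnesG z := by
  have hz1 : 0 < (z + 1).re := by simp; linarith
  have h1 := (hasProd_barnesFactor hz1).tendsto_prod_nat
  have h0 := (hasProd_barnesFactor hz).tendsto_prod_nat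
  have hr := h0.mul (tendsto_barnes_ratio hz)
  simp only [add_sub_cancel_right] at h1
  have hu := tendsto_nhds_unique h1 (hr.congr fun N => (prod_barnesFactor_succ hz N).symm)
  have e1 : barnesG (z + 1) = ((2 * Real.pi : ℝ) : ℂ) ^ (z / 2) *
      Complex.exp (-(z + z ^ 2 * (1 + Real.eulerMascheroniConstant)) / 2) *
        ∏' n, barnesFactor z n := by
    simp only [barnesG, add_sub_cancel_right]; rfl
  have e0 : barnesG z = ((2 * Real.pi : ℝ) : ℂ) ^ ((z - 1) / 2) *
      Complex.exp (-((z - 1) + (z - 1) ^ 2 * (1 + Real.eulerMascheroniConstant)) / 2) *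
        ∏' n, barnesFactor (z - 1) n := rfl
  have hpi : ((2 * Real.pi : ℝ) : ℂ) ≠ 0 := by exact_mod_cast Real.two_pi_pos.ne'
  -- The additional half power of 2π in the prefactor cancels the Stirling constant √(2π).
  have e2 : ((2 * Real.pi : ℝ) : ℂ) ^ (z / 2) =
      ((2 * Real.pi : ℝ) : ℂ) ^ ((z - 1) / 2) * ((√Real.pi : ℂ) * (√2 : ℝ)) := by
    have h2 : ((√Real.pi : ℂ) * (√2 : ℝ)) = ((2 * Real.pi : ℝ) : ℂ) ^ ((1 / 2 : ℝ) : ℂ) := by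
      rw [← Complex.ofReal_cpow Real.two_pi_pos.le, ← Real.sqrt_eq_rpow,
        Real.sqrt_mul (by norm_num)]
      push_cast
      ring
    rw [h2, ← Complex.cpow_add _ _ hpi]
    congr 1
    push_cast
    ring
  have hs : ((√Real.pi : ℂ) * (√2 : ℝ)) ≠ 0 := by
    have : (√Real.pi : ℝ) * √2 ≠ 0 := by positivity
    exact_mod_cast this
  have e3 : Complex.exp (-(z + z ^ 2 * (1 + Real.eulerMascheroniConstant)) / 2) *
      (Complex.exp z * Complex.exp ((z - 1 / 2) * Real.eulerMascheroniConstant)) =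
      Complex.exp (-((z - 1) + (z - 1) ^ 2 * (1 + Real.eulerMascheroniConstant)) / 2) := by
    rw [← Complex.exp_add, ← Complex.exp_add]
    congr 1
    ring
  rw [e1, e0, hu, e2, ← e3]
  field_simp

/-! ### The S-matrix and the minimal form factor -/

theorem bPar_pos {g : ℝ} (hg : g ≠ 0) : 0 < bPar g := by
  have := Real.pi_pos
  unfold bPar
  positivity

theorem bPar_lt_half (g : ℝ) : bPar g < 1 / 2 := by
  have := Real.pi_pos
  have h : g ^ 2 / (8 * Real.pi + g ^ 2) < 1 := by
    rw [div_lt_one (by positivity)]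
    linarith
  unfold bPar
  linarith

/-- For real β the imaginary part is sin(2π𝔟), which is positive because 0 < 𝔟 < 1/2. -/
theorem Smat_denom_ne_zero {g : ℝ} (hg : g ≠ 0) (β : ℝ) :
    Complex.sinh β + Complex.I * Complex.sin (2 * Real.pi * bPar g) ≠ 0 := by
  have hs : 0 < Real.sin (2 * Real.pi * bPar g) := by
    apply Real.sin_pos_of_pos_of_lt_pi
    · have := bPar_pos hg
      have := Real.pi_pos
      positivity
    · have := bPar_lt_half g
      nlinarith [Real.pi_pos]
  intro h
  have h2 := congrArg Complex.im h
  have e : Complex.sin (2 * Real.pi * bPar g) = ((Real.sin (2 * Real.pi * bPar g) : ℝ) : ℂ) := by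
    push_cast; rfl
  rw [e, ← Complex.ofReal_sinh] at h2
  simp only [Complex.add_im, Complex.ofReal_im, Complex.mul_im, Complex.I_re, Complex.I_im,
    Complex.ofReal_re, Complex.zero_im] at h2
  linarith

/-- Unitarity: since sinh is odd, β ↦ -β swaps numerator and denominator up to sign. -/
theorem Smat_mul_neg {g : ℝ} (hg : g ≠ 0) (β : ℝ) : Smat g β * Smat g (-β) = 1 := by
  have h1 := Smat_denom_ne_zero hg β
  have h2 := Smat_denom_ne_zero hg (-β)
  unfold Smat
  push_cast at h2
  rw [div_mul_div_comm, div_eq_one_iff_eq (mul_ne_zero h1 h2), Complex.sinh_neg]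
  ring

/-- The exchange relation of the minimal form factor. -/
theorem minFF_exchange {g : ℝ} (hg : g ≠ 0) (β : ℝ) :
    minFF g β = Smat g β * minFF g (-β) := by
  rcases eq_or_ne β 0 with rfl | hβ
  -- At β = 0 both sides vanish: `Complex.Gamma 0 = 0` and division by zero give 0, which is the
  -- true value of 1/Γ there.
  · simp [minFF, Complex.Gamma_zero]
  have hb0 := bPar_pos hg
  have hb1 := bPar_lt_half g
  have hb'0 : 0 < bHat g := by unfold bHat; linarith
  have hb'1 : bHat g < 1 / 2 := by unfold bHat; linarith
  set z : ℂ := Complex.I * β / (2 * Real.pi) with hz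
  have hpi : (Real.pi : ℂ) ≠ 0 := by exact_mod_cast Real.pi_ne_zero
  have hz0 : z ≠ 0 := by
    rw [hz]
    have : (β : ℂ) ≠ 0 := by exact_mod_cast hβ
    simp [this, hpi]
  have hzre : z.re = 0 := by
    rw [hz, show Complex.I * β / (2 * Real.pi) = ((β / (2 * Real.pi) : ℝ) : ℂ) * Complex.I by
      push_cast; ring]
    rw [Complex.mul_I_re, Complex.ofReal_im, neg_zero]
  have hzn : Complex.I * (-(β : ℂ)) / (2 * Real.pi) = -z := by rw [hz]; ring
  have G1 : ∀ c : ℝ, 0 < c → ∀ w : ℂ, w.re = 0 →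
      barnesG (1 + c + w) = Complex.Gamma (c + w) * barnesG (c + w) := by
    intro c hc w hw
    rw [← barnesG_add_one (by simp [hw, hc])]
    congr 1
    ring
  have G2 : ∀ c : ℝ, c < 1 → ∀ w : ℂ, w.re = 0 →
      barnesG (2 - c + w) = Complex.Gamma (1 - c + w) * barnesG (1 - c + w) := by
    intro c hc w hw
    rw [← barnesG_add_one (by simp [hw, hc])]
    congr 1
    ring
  have hnzre : (-z).re = 0 := by simp [hzre]
  -- S as a ratio of sines. Since 𝔟 and its dual add up to 1/2, the dual sines are cosines. The
  -- addition formulas then produce sin(2π𝔟) and sin(2πz) = i sinh β.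
  have hS : Complex.sin (Real.pi * (bPar g + z)) * Complex.sin (Real.pi * (bHat g + z)) *
        (Complex.sinh β + Complex.I * Complex.sin (2 * Real.pi * bPar g)) =
      - (Complex.sinh β - Complex.I * Complex.sin (2 * Real.pi * bPar g)) *
       (Complex.sin (Real.pi * (bPar g - z)) * Complex.sin (Real.pi * (bHat g - z))) := by
    have a1 : Complex.sin (Real.pi * (bHat g + z)) = Complex.cos (Real.pi * (bPar g - z)) := by
      rw [← Complex.sin_pi_div_two_sub]
      congr 1
      unfold bHat
      push_cast
      ring
    have a2 : Complex.sin (Real.pi * (bHat g - z)) = Complex.cos (Real.pi * (bPar g + z)) := by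
      rw [← Complex.sin_pi_div_two_sub]
      congr 1
      unfold bHat
      push_cast
      ring
    have a3 : Complex.sin (2 * Real.pi * bPar g) =
        Complex.sin (Real.pi * (bPar g + z)) * Complex.cos (Real.pi * (bPar g - z)) +
        Complex.cos (Real.pi * (bPar g + z)) * Complex.sin (Real.pi * (bPar g - z)) := by
      rw [← Complex.sin_add]
      congr 1
      ring
    have a4 : Complex.sinh β * Complex.I =
        Complex.sin (Real.pi * (bPar g + z)) * Complex.cos (Real.pi * (bPar g - z)) -
        Complex.cos (Real.pi * (bPar g + z)) * Complex.sin (Real.pi * (bPar g - z)) := by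
      rw [← Complex.sin_sub, ← Complex.sin_mul_I]
      congr 1
      rw [hz]
      field_simp
      ring
    rw [a1, a2]
    have a5 : Complex.sinh β = -Complex.I *
        (Complex.sin (Real.pi * (bPar g + z)) * Complex.cos (Real.pi * (bPar g - z)) -
        Complex.cos (Real.pi * (bPar g + z)) * Complex.sin (Real.pi * (bPar g - z))) := by
      rw [← a4]
      linear_combination (Complex.sinh β) * Complex.I_sq
    rw [a5, a3]
    ring
  -- Reflection inside the strip 0 < Re < 1. The sine cannot vanish, since the two Gamma values on
  -- the other side do not.
  have hΓ : ∀ c : ℝ, 0 < c → c < 1 → ∀ w : ℂ, w.re = 0 →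
      Complex.Gamma (c + w) ≠ 0 ∧ Complex.Gamma (1 - c - w) ≠ 0 ∧
      Complex.sin (Real.pi * (c + w)) ≠ 0 ∧
      Complex.Gamma (c + w) * Complex.Gamma (1 - c - w) =
        Real.pi / Complex.sin (Real.pi * (c + w)) := by
    intro c hc hc1 w hw
    have h1 : Complex.Gamma (c + w) ≠ 0 := Complex.Gamma_ne_zero_of_re_pos (by simp [hw, hc])
    have h2 : Complex.Gamma (1 - c - w) ≠ 0 :=
      Complex.Gamma_ne_zero_of_re_pos (by simp [hw, hc1])
    have h3 := Complex.Gamma_mul_Gamma_one_sub ((c : ℂ) + w)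
    rw [← sub_sub] at h3
    refine ⟨h1, h2, ?_, h3⟩
    intro h0
    rw [h0, div_zero] at h3
    exact mul_ne_zero h1 h2 h3
  obtain ⟨p1, p2, p3, p4⟩ := hΓ (bPar g) hb0 (by linarith) z hzre
  obtain ⟨q1, q2, q3, q4⟩ := hΓ (bPar g) hb0 (by linarith) (-z) hnzre
  obtain ⟨r1, r2, r3, r4⟩ := hΓ (bHat g) hb'0 (by linarith) z hzre
  obtain ⟨s1, s2, s3, s4⟩ := hΓ (bHat g) hb'0 (by linarith) (-z) hnzre
  have hden := Smat_denom_ne_zero hg β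
  have g1 : Complex.Gamma (1 + z) = z * Complex.Gamma z := by
    rw [add_comm]; exact Complex.Gamma_add_one z hz0
  have g2 : Complex.Gamma (1 + -z) = -z * Complex.Gamma (-z) := by
    rw [add_comm]; exact Complex.Gamma_add_one (-z) (neg_ne_zero.2 hz0)
  -- This is all that remains after the functional equation brings every Barnes argument to the form
  -- c ± z or 1 - c ± z: the Barnes values then occur symmetrically in z and -z.
  have hratio : Complex.Gamma (1 - bPar g + z) * Complex.Gamma (1 - bHat g + z) *
        (Complex.Gamma (bPar g - z) * Complex.Gamma (bHat g - z)) *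
        (Complex.sinh β + Complex.I * Complex.sin (2 * Real.pi * bPar g)) =
      - (Complex.sinh β - Complex.I * Complex.sin (2 * Real.pi * bPar g)) *
      (Complex.Gamma (1 - bPar g - z) * Complex.Gamma (1 - bHat g - z) *
        (Complex.Gamma (bPar g + z) * Complex.Gamma (bHat g + z))) := by
    simp only [← sub_eq_add_neg, sub_neg_eq_add] at q1 q2 q3 q4 s1 s2 s3 s4
    calc _ = (Complex.Gamma (bPar g - z) * Complex.Gamma (1 - bPar g + z)) *
          (Complex.Gamma (bHat g - z) * Complex.Gamma (1 - bHat g + z)) *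
          (Complex.sinh β + Complex.I * Complex.sin (2 * Real.pi * bPar g)) := by ring
      _ = - (Complex.sinh β - Complex.I * Complex.sin (2 * Real.pi * bPar g)) *
          ((Complex.Gamma (bPar g + z) * Complex.Gamma (1 - bPar g - z)) *
            (Complex.Gamma (bHat g + z) * Complex.Gamma (1 - bHat g - z))) := by
          rw [p4, q4, r4, s4]
          generalize Complex.sin (2 * Real.pi * bPar g) = t at hS ⊢
          generalize Complex.sin (Real.pi * (bPar g + z)) = t1 at hS p3 ⊢
          generalize Complex.sin (Real.pi * (bPar g - z)) = t2 at hS q3 ⊢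
          generalize Complex.sin (Real.pi * (bHat g + z)) = t3 at hS r3 ⊢
          generalize Complex.sin (Real.pi * (bHat g - z)) = t4 at hS s3 ⊢
          field_simp
          linear_combination hS
      _ = _ := by ring
  have Geq : Smat g β = (Complex.sinh β - Complex.I * Complex.sin (2 * Real.pi * bPar g)) /
    (Complex.sinh β + Complex.I * Complex.sin (2 * Real.pi * bPar g)) := rfl
  simp only [minFF]
  rw [hzn, ← hz, g1, g2, neg_neg, sub_neg_eq_add, sub_neg_eq_add, sub_neg_eq_add, sub_neg_eq_add,
    G2 _ (by linarith) z hzre, G2 _ (by linarith) z hzre, G2 _ (by linarith) (-z) hnzre,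
    G2 _ (by linarith) (-z) hnzre, G1 _ hb0 z hzre, G1 _ hb'0 z hzre, G1 _ hb0 (-z) hnzre,
    G1 _ hb'0 (-z) hnzre]
  simp only [← sub_eq_add_neg] at q1 q2 s1 s2 ⊢
  -- By reflection, because sin(πz) = i sinh(β/2) is nonzero for β ≠ 0.
  have hgz : Complex.Gamma z * Complex.Gamma (-z) ≠ 0 := by
    have h3 := Complex.Gamma_mul_Gamma_one_sub z
    have : Complex.sin (Real.pi * z) ≠ 0 := by
      have hh : (Real.pi : ℂ) * z = (β / 2 : ℝ) * Complex.I := by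
        rw [hz]; push_cast; field_simp
      rw [hh, Complex.sin_mul_I, ← Complex.ofReal_sinh]
      have : Real.sinh (β / 2) ≠ 0 := by
        rw [Ne, Real.sinh_eq_zero]; simpa using hβ
      exact mul_ne_zero (by exact_mod_cast this) Complex.I_ne_zero
    have h4 : Complex.Gamma z * Complex.Gamma (1 - z) ≠ 0 := by
      rw [h3]; exact div_ne_zero hpi this
    rw [sub_eq_add_neg, g2] at h4
    intro h5
    apply h4
    linear_combination (-z) * h5
  obtain ⟨hgz1, hgz2⟩ := mul_ne_zero_iff.1 hgz
  rw [Geq]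
  set s := Complex.sinh β
  set t := Complex.sin (2 * Real.pi * bPar g)
  generalize barnesG (1 - bPar g - z) = a1
  generalize barnesG (1 - bPar g + z) = a2
  generalize barnesG (1 - bHat g - z) = a3
  generalize barnesG (1 - bHat g + z) = a4
  generalize barnesG (bPar g - z) = a5
  generalize barnesG (bPar g + z) = a6
  generalize barnesG (bHat g - z) = a7
  generalize barnesG (bHat g + z) = a8
  -- All four values occur in the denominators of both sides. Should one vanish, both sides are 0 by
  -- the division convention, so the zeros of the Barnes function need not be located.
  by_cases ha : a5 * a6 * a7 * a8 = 0
  · simp only [mul_eq_zero] at ha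
    rcases ha with ((rfl | rfl) | rfl) | rfl <;> simp
  have h5 : a5 ≠ 0 := by rintro rfl; simp at ha
  have h6 : a6 ≠ 0 := by rintro rfl; simp at ha
  have h7 : a7 ≠ 0 := by rintro rfl; simp at ha
  have h8 : a8 ≠ 0 := by rintro rfl; simp at ha
  field_simp
  linear_combination (a1 * a2 * a3 * a4) * hratio

end Barnes

/-! ### Products over the pairs of entries of a list -/

section PairProd

variable {α β : Type*}

/-- The product of `f a b` over the pairs of entries of a list such that `a` precedes `b`. -/
def pairProd (f : α → α → ℂ) : List α → ℂ
  | [] => 1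
  | a :: l => (l.map (f a)).prod * pairProd f l

/-- The product of `f a b` over the entries `a` of a list and `b` of another one. -/
def crossProd (f : α → α → ℂ) (U V : List α) : ℂ := (U.map (fun a => (V.map (f a)).prod)).prod

theorem pairProd_append (f : α → α → ℂ) (U V : List α) :
    pairProd f (U ++ V) = pairProd f U * pairProd f V * crossProd f U V := by
  induction U with
  | nil => simp [pairProd, crossProd]
  | cons a U ih =>
    simp only [crossProd] at ih
    simp only [List.cons_append, pairProd, ih, crossProd, List.map_append, List.prod_append,
      List.map_cons, List.prod_cons]
    ring

theorem crossProd_perm (f : α → α → ℂ) {U U' V V' : List α} (hU : U.Perm U') (hV : V.Perm V') :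
    crossProd f U V = crossProd f U' V' := by
  have : (fun a => (V.map (f a)).prod) = fun a => (V'.map (f a)).prod := by
    funext a
    exact (hV.map _).prod_eq
  unfold crossProd
  rw [this]
  exact (hU.map _).prod_eq

theorem pairProd_map (f : α → α → ℂ) (h : β → α) (l : List β) :
    pairProd f (l.map h) = pairProd (fun a b => f (h a) (h b)) l := by
  induction l with
  | nil => rfl
  | cons a l ih => simp [pairProd, ih, Function.comp_def]

theorem pairProd_mul (f h : α → α → ℂ) (l : List α) :
    pairProd (fun a b => f a b * h a b) l = pairProd f l * pairProd h l := by
  induction l with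
  | nil => simp [pairProd]
  | cons a l ih =>
    simp only [pairProd, ih, List.prod_map_mul]
    ring

theorem pairProd_perm {f : α → α → ℂ} (hf : ∀ a b, f a b = f b a) {U V : List α}
    (h : U.Perm V) : pairProd f U = pairProd f V := by
  induction h with
  | nil => rfl
  | cons a h ih => rw [pairProd, pairProd, ih, (h.map _).prod_eq]
  | swap a b l =>
    simp only [pairProd, List.map_cons, List.prod_cons, hf b a]
    ring
  | trans _ _ h1 h2 => exact h1.trans h2

theorem pairProd_reverse (f : α → α → ℂ) (l : List α) :
    pairProd f l.reverse = pairProd (fun a b => f b a) l := by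
  induction l with
  | nil => rfl
  | cons a l ih =>
    rw [List.reverse_cons, pairProd_append, ih,
      crossProd_perm f l.reverse_perm (List.Perm.refl _)]
    simp [pairProd, crossProd, mul_comm]

theorem pairProd_ne_zero {f : α → α → ℂ} (hf : ∀ a b, f a b ≠ 0) (l : List α) :
    pairProd f l ≠ 0 := by
  induction l with
  | nil => simp [pairProd]
  | cons a l ih =>
    refine mul_ne_zero ?_ ih
    rw [Ne, List.prod_eq_zero_iff]
    simp [hf]

/-- Passes from products over pairs of positions, as in `kTransform` and `formFactor`, to a
recursion on lists, where `pairProd_append` and `pairProd_perm` apply. -/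
theorem prod_lt_eq_pairProd_finRange {n : ℕ} (f : Fin n → Fin n → ℂ) :
    ∏ e ∈ (Finset.univ : Finset (Fin n × Fin n)).filter (fun e => e.1 < e.2), f e.1 e.2 =
      pairProd f (List.finRange n) := by
  induction n with
  | zero => simp [pairProd]
  | succ n ih =>
    rw [List.finRange_succ, pairProd, pairProd_map, ← ih, Finset.prod_filter, Finset.prod_filter,
      Fintype.prod_prod_type, Fintype.prod_prod_type, Fin.prod_univ_succ]
    congr 1
    · rw [Fin.prod_univ_succ]
      simp [Function.comp_def, Fin.prod_univ_def]
    · refine Finset.prod_congr rfl fun i _ => ?_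
      rw [Fin.prod_univ_succ]
      simp

theorem prod_lt_get_eq_pairProd (f : α → α → ℂ) (l : List α) :
    ∏ e ∈ (Finset.univ : Finset (Fin l.length × Fin l.length)).filter (fun e => e.1 < e.2),
      f (l.get e.1) (l.get e.2) = pairProd f l := by
  rw [prod_lt_eq_pairProd_finRange (fun i j => f (l.get i) (l.get j)),
    ← pairProd_map f l.get, ← List.ofFn_eq_map, List.ofFn_get]

/-- The same passage for the shape used by `sProd`; without repetitions an entry and its position
determine each other. -/
theorem pairProd_eq_prod_idxOf [DecidableEq α] (f : α → α → ℂ) {U : List α} (hU : U.Nodup) :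
    pairProd f U = ∏ e ∈ (U.toFinset ×ˢ U.toFinset).filter (fun e => U.idxOf e.1 < U.idxOf e.2),
      f e.1 e.2 := by
  rw [← prod_lt_get_eq_pairProd]
  have hidx : ∀ i : Fin U.length, U.idxOf (U.get i) = i := fun i => hU.idxOf_getElem i i.2
  refine Finset.prod_bij (fun e _ => (U.get e.1, U.get e.2)) ?_ ?_ ?_ ?_
  · intro e he
    simp only [Finset.mem_filter, Finset.mem_univ, true_and] at he
    simp only [Finset.mem_filter, Finset.mem_product, List.mem_toFinset, hidx]
    exact ⟨⟨U.get_mem _, U.get_mem _⟩, he⟩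
  · intro e _ e' _ h
    rw [Prod.mk.injEq] at h
    exact Prod.ext (List.nodup_iff_injective_get.1 hU h.1) (List.nodup_iff_injective_get.1 hU h.2)
  · intro b hb
    simp only [Finset.mem_filter, Finset.mem_product, List.mem_toFinset] at hb
    obtain ⟨⟨h1, h2⟩, h3⟩ := hb
    refine ⟨(⟨U.idxOf b.1, List.idxOf_lt_length_iff.2 h1⟩,
      ⟨U.idxOf b.2, List.idxOf_lt_length_iff.2 h2⟩), ?_, ?_⟩
    · simpa using h3
    · simp
  · intro e _
    rfl

end PairProd

/-! ### The S-matrix products -/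

section Words

variable {ι : Type*} [LinearOrder ι] {g : ℝ}

/-- The S-matrix factor of a pair which is not in reversed order. -/
noncomputable def orderFactor (g : ℝ) (x : ι → ℝ) (a b : ι) : ℂ :=
  if a < b then Smat g ((x a : ℂ) - (x b : ℂ)) else 1

/-- The product of the S-matrix factors of the pairs of a list in increasing order. -/
noncomputable def orderProd (g : ℝ) (x : ι → ℝ) (U : List ι) : ℂ := pairProd (orderFactor g x) U

theorem Smat_sub_mul {κ : Type*} (hg : g ≠ 0) (x : κ → ℝ) (a b : κ) :
    Smat g ((x a : ℂ) - (x b : ℂ)) * Smat g ((x b : ℂ) - (x a : ℂ)) = 1 := by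
  have := Smat_mul_neg hg (x a - x b)
  push_cast at this
  rwa [neg_sub] at this

theorem orderFactor_ne_zero (hg : g ≠ 0) (x : ι → ℝ) (a b : ι) : orderFactor g x a b ≠ 0 := by
  unfold orderFactor
  split_ifs
  · exact left_ne_zero_of_mul_eq_one (Smat_sub_mul hg x a b)
  · exact one_ne_zero

theorem orderProd_ne_zero (hg : g ≠ 0) (x : ι → ℝ) (U : List ι) : orderProd g x U ≠ 0 :=
  pairProd_ne_zero (orderFactor_ne_zero hg x) U

/-- One exchange of neighbours. Only one of the two orders carries a factor; when it is the order b,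
a, unitarity cancels it. -/
theorem Smat_mul_orderFactor (hg : g ≠ 0) (x : ι → ℝ) {a b : ι} (h : a ≠ b) :
    Smat g ((x a : ℂ) - (x b : ℂ)) * orderFactor g x b a = orderFactor g x a b := by
  unfold orderFactor
  rcases lt_or_gt_of_ne h with h | h
  · rw [if_pos h, if_neg h.not_gt, mul_one]
  · rw [if_pos h, if_neg h.not_gt, Smat_sub_mul hg]

/-- Pairs in the same order in `U` and `V` contribute equally to both sides. For each reversed pair,
the factor of `sProd` converts one order factor into the other. -/
theorem sProd_mul_orderProd (hg : g ≠ 0) (x : ι → ℝ) {U V : List ι} (hU : U.Nodup)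
    (h : U.Perm V) : sProd g x U V * orderProd g x V = orderProd g x U := by
  have hV : V.Nodup := h.nodup_iff.1 hU
  unfold orderProd
  rw [pairProd_eq_prod_idxOf _ hU, pairProd_eq_prod_idxOf _ hV, sProd,
    ← List.toFinset_eq_of_perm _ _ h]
  set T := U.toFinset ×ˢ U.toFinset with hT
  have hmemV : ∀ e ∈ T, e.1 ∈ V ∧ e.1 ∈ U := fun e he => by
    simp only [hT, Finset.mem_product, List.mem_toFinset] at he
    exact ⟨h.mem_iff.1 he.1, he.1⟩
  have hU' : ∀ e ∈ T, ¬ U.idxOf e.1 < U.idxOf e.2 → U.idxOf e.2 < U.idxOf e.1 ∨ e.1 = e.2 :=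
    fun e he hn => by
      rcases lt_or_eq_of_le (not_lt.1 hn) with h1 | h1
      · exact Or.inl h1
      · exact Or.inr ((List.idxOf_inj (hmemV e he).2).1 h1.symm)
  have hV' : ∀ e ∈ T, ¬ V.idxOf e.1 < V.idxOf e.2 → V.idxOf e.2 < V.idxOf e.1 ∨ e.1 = e.2 :=
    fun e he hn => by
      rcases lt_or_eq_of_le (not_lt.1 hn) with h1 | h1
      · exact Or.inl h1
      · exact Or.inr ((List.idxOf_inj (hmemV e he).1).1 h1.symm)
  have s1 := Finset.prod_filter_mul_prod_filter_not
    (T.filter (fun e => U.idxOf e.1 < U.idxOf e.2)) (fun e => V.idxOf e.1 < V.idxOf e.2)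
    (fun e => orderFactor g x e.1 e.2)
  have s2 := Finset.prod_filter_mul_prod_filter_not
    (T.filter (fun e => V.idxOf e.1 < V.idxOf e.2)) (fun e => U.idxOf e.1 < U.idxOf e.2)
    (fun e => orderFactor g x e.1 e.2)
  rw [Finset.filter_filter, Finset.filter_filter] at s1 s2
  have c1 : T.filter (fun e => U.idxOf e.1 < U.idxOf e.2 ∧ ¬ V.idxOf e.1 < V.idxOf e.2) =
      T.filter (fun e => U.idxOf e.1 < U.idxOf e.2 ∧ V.idxOf e.2 < V.idxOf e.1) := by
    refine Finset.filter_congr fun e he => ⟨fun h => ⟨h.1, ?_⟩, fun h => ⟨h.1, h.2.not_gt⟩⟩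
    rcases hV' e he h.2 with h1 | h1
    · exact h1
    · rw [h1] at h; exact absurd h.1 (lt_irrefl _)
  have c2 : T.filter (fun e => V.idxOf e.1 < V.idxOf e.2 ∧ ¬ U.idxOf e.1 < U.idxOf e.2) =
      T.filter (fun e => V.idxOf e.1 < V.idxOf e.2 ∧ U.idxOf e.2 < U.idxOf e.1) := by
    refine Finset.filter_congr fun e he => ⟨fun h => ⟨h.1, ?_⟩, fun h => ⟨h.1, h.2.not_gt⟩⟩
    rcases hU' e he h.2 with h1 | h1
    · exact h1
    · rw [h1] at h; exact absurd h.1 (lt_irrefl _)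
  have c3 : T.filter (fun e => V.idxOf e.1 < V.idxOf e.2 ∧ U.idxOf e.1 < U.idxOf e.2) =
      T.filter (fun e => U.idxOf e.1 < U.idxOf e.2 ∧ V.idxOf e.1 < V.idxOf e.2) :=
    Finset.filter_congr fun e _ => and_comm
  -- A pair inverted as seen from `V` is the swap of a pair inverted as seen from `U`.
  have c4 : ∏ e ∈ T.filter (fun e => V.idxOf e.1 < V.idxOf e.2 ∧ U.idxOf e.2 < U.idxOf e.1),
      orderFactor g x e.1 e.2 =
      ∏ e ∈ T.filter (fun e => U.idxOf e.1 < U.idxOf e.2 ∧ V.idxOf e.2 < V.idxOf e.1),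
      orderFactor g x e.2 e.1 := by
    refine Finset.prod_nbij' Prod.swap Prod.swap ?_ ?_ ?_ ?_ ?_
    · intro e he
      simp only [hT, Finset.mem_filter, Finset.mem_product, Prod.fst_swap, Prod.snd_swap] at he ⊢
      tauto
    · intro e he
      simp only [hT, Finset.mem_filter, Finset.mem_product, Prod.fst_swap, Prod.snd_swap] at he ⊢
      tauto
    · intro e _; simp
    · intro e _; simp
    · intro e _; simp
  rw [← s1, ← s2, c1, c2, c3, c4, mul_left_comm, ← Finset.prod_mul_distrib]
  congr 1
  refine Finset.prod_congr rfl fun e he => Smat_mul_orderFactor hg x ?_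
  rintro h
  simp only [Finset.mem_filter, h, lt_irrefl, and_false] at he

/-- S-products are coboundaries; every later cancellation between them is a telescoping of such
ratios. -/
theorem sProd_eq_div (hg : g ≠ 0) (x : ι → ℝ) {U V : List ι} (hU : U.Nodup)
    (h : U.Perm V) : sProd g x U V = orderProd g x U / orderProd g x V :=
  eq_div_of_mul_eq (orderProd_ne_zero hg x V) (sProd_mul_orderProd hg x hU h)

/-- A list and its reversal together give each unordered pair both of its factors, which is
symmetric in the pair. Hence reversing two words inverts their S-product, as used in
`sProd_reverse`. -/
theorem orderProd_mul_reverse_perm (g : ℝ) (x : ι → ℝ) {U V : List ι} (h : U.Perm V) :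
    orderProd g x U * orderProd g x U.reverse = orderProd g x V * orderProd g x V.reverse := by
  simp only [orderProd, pairProd_reverse, ← pairProd_mul]
  exact pairProd_perm (fun a b => mul_comm _ _) h

theorem sProd_reverse (hg : g ≠ 0) (x : ι → ℝ) {U V : List ι} (hU : U.Nodup)
    (h : U.Perm V) : sProd g x U.reverse V.reverse = orderProd g x V / orderProd g x U := by
  rw [sProd_eq_div hg x (List.nodup_reverse.2 hU)
    ((U.reverse_perm.trans h).trans V.reverse_perm.symm),
    div_eq_div_iff (orderProd_ne_zero hg x _) (orderProd_ne_zero hg x _), mul_comm,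
    orderProd_mul_reverse_perm g x h, mul_comm (orderProd g x V)]

theorem idxOf_map_of_injOn {κ : Type*} [DecidableEq κ] {e : ι → κ} {U : List ι} (a : ι)
    (h : ∀ b ∈ U, e b = e a → b = a) : (U.map e).idxOf (e a) = U.idxOf a := by
  induction U with
  | nil => rfl
  | cons b U ih =>
    have ih' := ih (fun c hc => h c (List.mem_cons_of_mem _ hc))
    by_cases hb : b = a
    · subst hb
      rw [List.map_cons, List.idxOf_cons_self, List.idxOf_cons_self]
    · have : e b ≠ e a := fun hh => hb (h b List.mem_cons_self hh)
      rw [List.map_cons, List.idxOf_cons_ne _ this, List.idxOf_cons_ne _ hb, ih']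

/-- The S-matrix products only depend on the values taken by the variables. -/
theorem sProd_map (g : ℝ) (x : ι → ℝ) (e : ι → ι) {U V : List ι} (h : U.Perm V)
    (hinj : ∀ a ∈ U, ∀ b ∈ U, e a = e b → a = b) (hx : ∀ a ∈ U, x (e a) = x a) :
    sProd g x (U.map e) (V.map e) = sProd g x U V := by
  have hi : ∀ a ∈ U, (U.map e).idxOf (e a) = U.idxOf a ∧ (V.map e).idxOf (e a) = V.idxOf a :=
    fun a ha => ⟨idxOf_map_of_injOn a fun b hb => hinj b hb a ha,
      idxOf_map_of_injOn a fun b hb => hinj b (h.mem_iff.2 hb) a ha⟩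
  symm
  refine Finset.prod_bij (fun p _ => (e p.1, e p.2)) ?_ ?_ ?_ ?_
  · intro p hp
    simp only [Finset.mem_filter, Finset.mem_product, List.mem_toFinset, List.mem_map] at hp ⊢
    obtain ⟨⟨h1, h2⟩, h3, h4⟩ := hp
    rw [(hi _ h1).1, (hi _ h1).2, (hi _ h2).1, (hi _ h2).2]
    exact ⟨⟨⟨_, h1, rfl⟩, ⟨_, h2, rfl⟩⟩, h3, h4⟩
  · intro p hp q hq hpq
    simp only [Finset.mem_filter, Finset.mem_product, List.mem_toFinset] at hp hq
    rw [Prod.mk.injEq] at hpq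
    exact Prod.ext (hinj _ hp.1.1 _ hq.1.1 hpq.1) (hinj _ hp.1.2 _ hq.1.2 hpq.2)
  · rintro ⟨a, b⟩ hp
    simp only [Finset.mem_filter, Finset.mem_product, List.mem_toFinset, List.mem_map] at hp
    obtain ⟨⟨⟨a, h1, rfl⟩, ⟨b, h2, rfl⟩⟩, h3, h4⟩ := hp
    rw [(hi _ h1).1, (hi _ h2).1] at h3
    rw [(hi _ h1).2, (hi _ h2).2] at h4
    refine ⟨(a, b), ?_, rfl⟩
    simp only [Finset.mem_filter, Finset.mem_product, List.mem_toFinset]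
    exact ⟨⟨h1, h2⟩, h3, h4⟩
  · intro p hp
    simp only [Finset.mem_filter, Finset.mem_product, List.mem_toFinset] at hp
    rw [hx _ hp.1.1, hx _ hp.1.2]

/-! ### Exchange relations of the form factors -/

/-- Relabel the summation variable ℓ and use the symmetry of `O.p`. The pair factors are symmetric
because ℓ_a - ℓ_b and sinh(β_a - β_b) both change sign under exchange. -/
theorem kTransform_equiv (O : LocalOperator g) {n n' : ℕ} (e : Fin n ≃ Fin n')
    (β : Fin n' → ℂ) :
    kTransform g n (O.p n) (β ∘ e) = kTransform g n' (O.p n') β := by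
  obtain rfl : n = n' := Fin.equiv_iff_eq.1 ⟨e⟩
  unfold kTransform
  refine Fintype.sum_equiv (Equiv.arrowCongr e (Equiv.refl _)) _ _ fun ℓ => ?_
  obtain ⟨ℓ', rfl⟩ : ∃ ℓ' : Fin n → Fin 2, ℓ = ℓ' ∘ e := ⟨ℓ ∘ e.symm, by ext; simp⟩
  have he : (Equiv.arrowCongr e (Equiv.refl (Fin 2))) (ℓ' ∘ e) = ℓ' := by ext; simp
  rw [he, O.symmetric n β ℓ' e]
  congr 2
  · congr 1
    exact Equiv.sum_comp e (fun a => (ℓ' a : ℕ))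
  · have h1 := prod_lt_eq_pairProd_finRange (fun a b : Fin n =>
      1 - Complex.I * ((((ℓ' a : ℕ) : ℂ) - ((ℓ' b : ℕ) : ℂ)) *
        Complex.sin (2 * Real.pi * bPar g)) / Complex.sinh (β a - β b))
    have h2 := prod_lt_eq_pairProd_finRange (fun a b : Fin n =>
      1 - Complex.I * ((((ℓ' (e a) : ℕ) : ℂ) - ((ℓ' (e b) : ℕ) : ℂ)) *
        Complex.sin (2 * Real.pi * bPar g)) / Complex.sinh (β (e a) - β (e b)))
    refine h2.trans (Eq.trans ?_ h1.symm)
    rw [← pairProd_map (fun a b : Fin n =>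
      1 - Complex.I * ((((ℓ' a : ℕ) : ℂ) - ((ℓ' b : ℕ) : ℂ)) *
        Complex.sin (2 * Real.pi * bPar g)) / Complex.sinh (β a - β b)) e]
    refine pairProd_perm (fun a b => ?_) (Equiv.Perm.map_finRange_perm e)
    rw [← neg_sub (β b) (β a), Complex.sinh_neg, ← neg_sub ((ℓ' b : ℕ) : ℂ), neg_mul, mul_neg,
      neg_div_neg_eq]

theorem kTransform_perm (O : LocalOperator g) {l l' : List ℂ} (h : l.Perm l') :
    kTransform g l.length (O.p l.length) l.get = kTransform g l'.length (O.p l'.length) l'.get := by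
  classical
  have hinj := h.subperm.idxInj_injective
  have hb : Function.Bijective (h.subperm.idxInj) :=
    (Fintype.bijective_iff_injective_and_card _).2 ⟨hinj, by simp [h.length_eq]⟩
  rw [← kTransform_equiv O (Equiv.ofBijective _ hb)]
  congr 1
  funext i
  exact (h.subperm.getElem_idxInj_eq_getElem (i := i)).symm

theorem formFactor_eq (O : LocalOperator g) (l : List ℂ) :
    formFactor O l = pairProd (fun a b => minFF g (a - b)) l *
      kTransform g l.length (O.p l.length) l.get := by
  rw [formFactor, prod_lt_get_eq_pairProd (fun a b => minFF g (a - b))]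

/-- A common shift drops out of the differences, which are therefore real. The exchange relation
then writes the product as `orderProd` times a function symmetric in each pair. -/
theorem pairProd_minFF_map_perm (hg : g ≠ 0) (x : ι → ℝ) (s : ℂ) {U V : List ι}
    (h : U.Perm V) :
    pairProd (fun a b => minFF g (a - b)) (U.map (fun v => (x v : ℂ) + s)) * orderProd g x V =
      pairProd (fun a b => minFF g (a - b)) (V.map (fun v => (x v : ℂ) + s)) * orderProd g x U := by
  have key : ∀ W : List ι,
      pairProd (fun a b => minFF g (a - b)) (W.map (fun v => (x v : ℂ) + s)) =
        orderProd g x W *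
          pairProd (fun a b => minFF g ((x (max a b) : ℂ) - (x (min a b) : ℂ))) W := by
    intro W
    rw [pairProd_map, orderProd, ← pairProd_mul]
    congr 1
    funext a b
    rw [add_sub_add_right_eq_sub]
    unfold orderFactor
    split_ifs with hab
    · rw [max_eq_right hab.le, min_eq_left hab.le]
      have := minFF_exchange hg (x a - x b)
      push_cast at this
      rwa [neg_sub] at this
    · rw [max_eq_left (not_lt.1 hab), min_eq_right (not_lt.1 hab), one_mul]
  rw [key, key, pairProd_perm (fun a b => by rw [max_comm, min_comm]) h]
  ring

theorem shiftedFF_eq {κ : Type*} (O : LocalOperator g) (ε ε' : ℝ) (x : κ → ℝ) (U V Z : List κ) :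
    shiftedFF O ε ε' x U V Z = formFactor O
      ((U.map (fun v => (x v : ℂ) + Complex.I * Real.pi * (1 - ε / Real.pi))
      ++ V.map (fun v => (x v : ℂ) + 0))
      ++ Z.map (fun v => (x v : ℂ) + -(Complex.I * Real.pi * (1 - ε' / Real.pi)))) := by
  simp only [shiftedFF, add_zero, sub_eq_add_neg]

/-- Watson's exchange equations for the reorderings inside the three groups of variables. -/
theorem shiftedFF_perm (hg : g ≠ 0) (O : LocalOperator g) (ε ε' : ℝ) (x : ι → ℝ)
    {U U' V V' Z Z' : List ι} (hU : U.Perm U') (hV : V.Perm V') (hZ : Z.Perm Z') :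
    shiftedFF O ε ε' x U V Z * (orderProd g x U' * orderProd g x V' * orderProd g x Z') =
      shiftedFF O ε ε' x U' V' Z' * (orderProd g x U * orderProd g x V * orderProd g x Z) := by
  rw [shiftedFF_eq, shiftedFF_eq]
  set s₁ := Complex.I * Real.pi * (1 - ε / Real.pi)
  set s₂ := -(Complex.I * Real.pi * (1 - ε' / Real.pi))
  have p1 : (U.map (fun v => (x v : ℂ) + s₁)).Perm (U'.map (fun v => (x v : ℂ) + s₁)) := hU.map _
  have p2 : (V.map (fun v => (x v : ℂ) + 0)).Perm (V'.map (fun v => (x v : ℂ) + 0)) := hV.map _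
  have p3 : (Z.map (fun v => (x v : ℂ) + s₂)).Perm (Z'.map (fun v => (x v : ℂ) + s₂)) := hZ.map _
  -- The 𝒦-transform and the products between different groups ignore the orderings; only the three
  -- inner products change.
  rw [formFactor_eq, formFactor_eq, pairProd_append, pairProd_append, pairProd_append,
    pairProd_append, kTransform_perm O ((p1.append p2).append p3), crossProd_perm _ p1 p2,
    crossProd_perm _ (p1.append p2) p3]
  have k1 := pairProd_minFF_map_perm hg x s₁ hU
  have k2 := pairProd_minFF_map_perm hg x 0 hV
  have k3 := pairProd_minFF_map_perm hg x s₂ hZ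
  linear_combination (exp := 1) crossProd (fun a b => minFF g (a - b))
      (U'.map (fun v => (x v : ℂ) + s₁)) (V'.map (fun v => (x v : ℂ) + 0)) *
    crossProd (fun a b => minFF g (a - b))
      (U'.map (fun v => (x v : ℂ) + s₁) ++ V'.map (fun v => (x v : ℂ) + 0))
      (Z'.map (fun v => (x v : ℂ) + s₂)) *
    kTransform g _ (O.p _) (U'.map (fun v => (x v : ℂ) + s₁) ++ V'.map (fun v => (x v : ℂ) + 0) ++
      Z'.map (fun v => (x v : ℂ) + s₂)).get *
    congrArg₂ (· * ·) (congrArg₂ (· * ·) k1 k2) k3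

theorem shiftedFF_congr {κ : Type*} (O : LocalOperator g) (ε ε' : ℝ) {x : κ → ℝ}
    {U U' V V' Z Z' : List κ}
    (hU : U.map x = U'.map x) (hV : V.map x = V'.map x) (hZ : Z.map x = Z'.map x) :
    shiftedFF O ε ε' x U V Z = shiftedFF O ε ε' x U' V' Z' := by
  have key : ∀ (W W' : List κ) (s : ℂ), W.map x = W'.map x →
      W.map (fun v => (x v : ℂ) + s) = W'.map (fun v => (x v : ℂ) + s) := fun W W' s h => by
    have h2 := congrArg (List.map (fun t : ℝ => (t : ℂ) + s)) h
    simpa [List.map_map, Function.comp_def] using h2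
  rw [shiftedFF_eq, shiftedFF_eq, key U U' _ hU, key V V' _ hV, key Z Z' _ hZ]

end Words

/-! ### Independence of the orderings of a chain of S-matrix products and form factors -/

section Chain

variable {ι : Type*} [LinearOrder ι] {g : ℝ}

/-- The factors between two blocks depend only on the contents of the blocks, so a reordering inside
the blocks changes only their own `orderProd`s. -/
theorem orderProd_append₃_perm (g : ℝ) (x : ι → ℝ) {a a' b b' c c' : List ι} (ha : a.Perm a')
    (hb : b.Perm b') (hc : c.Perm c') :
    orderProd g x (a ++ b ++ c) * (orderProd g x a' * orderProd g x b' * orderProd g x c') =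
      orderProd g x (a' ++ b' ++ c') * (orderProd g x a * orderProd g x b * orderProd g x c) := by
  simp only [orderProd, pairProd_append]
  rw [crossProd_perm _ ha hb, crossProd_perm _ (ha.append hb) hc]
  ring

theorem orderProd_append₄_perm (g : ℝ) (x : ι → ℝ) {a a' b b' c c' d d' : List ι}
    (ha : a.Perm a') (hb : b.Perm b') (hc : c.Perm c') (hd : d.Perm d') :
    orderProd g x (a ++ b ++ c ++ d) *
        (orderProd g x a' * orderProd g x b' * orderProd g x c' * orderProd g x d') =
      orderProd g x (a' ++ b' ++ c' ++ d') *
        (orderProd g x a * orderProd g x b * orderProd g x c * orderProd g x d) := by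
  simp only [orderProd, pairProd_append]
  rw [crossProd_perm _ ha hb, crossProd_perm _ (ha.append hb) hc,
    crossProd_perm _ ((ha.append hb).append hc) hd]
  ring

/-- Families of lists of variables: `c p`, `d p` are transmitted from the level `p` to the level
`p + 1`, `u p` and `w p` are absorbed by the operator `p + 1`, and `z p` is emitted by the
operator `p`. -/
structure ChainLists (ι : Type*) where
  c : ℕ → List ι
  u : ℕ → List ι
  w : ℕ → List ι
  d : ℕ → List ι
  z : ℕ → List ι

namespace ChainLists

variable (L : ChainLists ι)

/-- All the variables of the level `p`, sorted by what becomes of them at the level `p + 1`. -/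
def top (p : ℕ) : List ι := L.c p ++ L.u p ++ L.w p ++ L.d p

/-- All the variables of the level `p + 1`, sorted by their origin. -/
def bot (p : ℕ) : List ι := L.c p ++ L.z (p + 1) ++ L.d p

/-- The factor contributed by the operator `p + 1`. -/
noncomputable def term (O : ℕ → LocalOperator g) (ε ε' : ℕ → ℝ) (x : ι → ℝ) (p : ℕ) : ℂ :=
  sProd g x (L.top (p + 1)) (L.bot p) *
    shiftedFF (O (p + 1)) (ε (p + 1)) (ε' (p + 1)) x (L.u p).reverse (L.z (p + 1)) (L.w p).reverse

/-- Two families of lists differ by reorderings. -/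
structure Perm (L L' : ChainLists ι) (k : ℕ) : Prop where
  c : ∀ p ≤ k, (L.c p).Perm (L'.c p)
  u : ∀ p ≤ k, (L.u p).Perm (L'.u p)
  w : ∀ p ≤ k, (L.w p).Perm (L'.w p)
  d : ∀ p ≤ k, (L.d p).Perm (L'.d p)
  z : ∀ p, 1 ≤ p → p ≤ k → (L.z p).Perm (L'.z p)

theorem top_perm {L L' : ChainLists ι} {k : ℕ} (h : Perm L L' k) {p : ℕ} (hp : p ≤ k) :
    (L.top p).Perm (L'.top p) :=
  (((h.c p hp).append (h.u p hp)).append (h.w p hp)).append (h.d p hp)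

theorem bot_perm {L L' : ChainLists ι} {k : ℕ} (h : Perm L L' k) {p : ℕ} (hp : p < k) :
    (L.bot p).Perm (L'.bot p) :=
  ((h.c p hp.le).append (h.z (p + 1) (by omega) hp)).append (h.d p hp.le)

/-- Effect of a reordering on one operator: a ratio depending on level p + 1 divided by the same
ratio at level p. The order of `z` cancels between the S-product and the form factor. The reversals
of `u` and `w` in the form factor put their ratios into the denominator, next to those of `c` and
`d`. -/
theorem term_eq (hg : g ≠ 0) (O : ℕ → LocalOperator g) (ε ε' : ℕ → ℝ) (x : ι → ℝ)
    {L L' : ChainLists ι} {k : ℕ} (h : Perm L L' k) {p : ℕ} (hp : p < k)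
    (hn : (L.top (p + 1)).Nodup) (htb : (L.top (p + 1)).Perm (L.bot p)) :
    L'.term O ε ε' x p *
      ((orderProd g x (L'.c p) * orderProd g x (L'.u p) * orderProd g x (L'.w p) *
        orderProd g x (L'.d p)) /
      (orderProd g x (L.c p) * orderProd g x (L.u p) * orderProd g x (L.w p) *
        orderProd g x (L.d p))) =
    L.term O ε ε' x p *
      ((orderProd g x (L'.c (p + 1)) * orderProd g x (L'.u (p + 1)) * orderProd g x (L'.w (p + 1)) *
        orderProd g x (L'.d (p + 1))) /
      (orderProd g x (L.c (p + 1)) * orderProd g x (L.u (p + 1)) * orderProd g x (L.w (p + 1)) *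
        orderProd g x (L.d (p + 1)))) := by
  have hz := h.z (p + 1) (by omega) hp
  have hT := top_perm h (p := p + 1) hp
  have hB := bot_perm h hp
  have hp' : p ≤ k := hp.le
  have e1 := orderProd_append₄_perm g x (h.c (p + 1) hp) (h.u (p + 1) hp) (h.w (p + 1) hp)
    (h.d (p + 1) hp)
  have e2 := orderProd_append₃_perm g x (h.c p hp') hz (h.d p hp')
  have e3 := shiftedFF_perm hg (O (p + 1)) (ε (p + 1)) (ε' (p + 1)) x
    (((L.u p).reverse_perm.trans (h.u p hp')).trans (L'.u p).reverse_perm.symm) hz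
    (((L.w p).reverse_perm.trans (h.w p hp')).trans (L'.w p).reverse_perm.symm)
  have e4 := orderProd_mul_reverse_perm g x (h.u p hp')
  have e5 := orderProd_mul_reverse_perm g x (h.w p hp')
  unfold term
  rw [sProd_eq_div hg x (hT.nodup_iff.1 hn) ((hT.symm.trans htb).trans hB),
    sProd_eq_div hg x hn htb]
  change orderProd g x (L.top (p + 1)) * _ = orderProd g x (L'.top (p + 1)) * _ at e1
  change orderProd g x (L.bot p) * _ = orderProd g x (L'.bot p) * _ at e2
  have n := orderProd_ne_zero (ι := ι) hg x
  have n1 := n (L.c (p + 1))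
  have n2 := n (L.u (p + 1))
  have n3 := n (L.w (p + 1))
  have n4 := n (L.d (p + 1))
  have n5 := n (L.c p)
  have n6 := n (L.u p)
  have n7 := n (L.w p)
  have n8 := n (L.d p)
  have n9 := n (L.bot p)
  have n10 := n (L'.bot p)
  have m1 := n (L'.c (p + 1))
  have m2 := n (L'.u (p + 1))
  have m3 := n (L'.w (p + 1))
  have m4 := n (L'.d (p + 1))
  have m5 := n (L'.c p)
  have m6 := n (L'.u p)
  have m7 := n (L'.w p)
  have m8 := n (L'.d p)
  have q1 := n (L.z (p + 1))
  have q2 := n (L'.z (p + 1))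
  have q3 := n (L.u p).reverse
  have q4 := n (L.w p).reverse
  generalize shiftedFF (O (p + 1)) (ε (p + 1)) (ε' (p + 1)) x (L.u p).reverse (L.z (p + 1))
    (L.w p).reverse = F at *
  generalize shiftedFF (O (p + 1)) (ε (p + 1)) (ε' (p + 1)) x (L'.u p).reverse (L'.z (p + 1))
    (L'.w p).reverse = F' at *
  generalize orderProd g x (L.c (p + 1)) = a1 at *
  generalize orderProd g x (L.u (p + 1)) = a2 at *
  generalize orderProd g x (L.w (p + 1)) = a3 at *
  generalize orderProd g x (L.d (p + 1)) = a4 at *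
  generalize orderProd g x (L.c p) = a5 at *
  generalize orderProd g x (L.u p) = a6 at *
  generalize orderProd g x (L.w p) = a7 at *
  generalize orderProd g x (L.d p) = a8 at *
  generalize orderProd g x (L'.c (p + 1)) = b1 at *
  generalize orderProd g x (L'.u (p + 1)) = b2 at *
  generalize orderProd g x (L'.w (p + 1)) = b3 at *
  generalize orderProd g x (L'.d (p + 1)) = b4 at *
  generalize orderProd g x (L'.c p) = b5 at *
  generalize orderProd g x (L'.u p) = b6 at *
  generalize orderProd g x (L'.w p) = b7 at *
  generalize orderProd g x (L'.d p) = b8 at *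
  generalize orderProd g x (L.top (p + 1)) = t at *
  generalize orderProd g x (L'.top (p + 1)) = t' at *
  generalize orderProd g x (L.bot p) = s at *
  generalize orderProd g x (L'.bot p) = s' at *
  generalize orderProd g x (L.z (p + 1)) = z at *
  generalize orderProd g x (L'.z (p + 1)) = z' at *
  generalize orderProd g x (L.u p).reverse = r at *
  generalize orderProd g x (L'.u p).reverse = r' at *
  generalize orderProd g x (L.w p).reverse = y at *
  generalize orderProd g x (L'.w p).reverse = y' at *
  have f1 : t' = t * (b1 * b2 * b3 * b4) / (a1 * a2 * a3 * a4) := by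
    field_simp; linear_combination -e1
  have f2 : s' = s * (b5 * z' * b8) / (a5 * z * a8) := by
    field_simp; linear_combination -e2
  have f4 : r' = a6 * r / b6 := by field_simp; linear_combination -e4
  have f5 : y' = a7 * y / b7 := by field_simp; linear_combination -e5
  have f3 : F' = F * (a6 * z' * a7) / (b6 * z * b7) := by
    rw [f4, f5] at e3
    field_simp at e3 ⊢
    linear_combination -e3
  rw [f1, f2, f3]
  field_simp

/-- The product of the factors of all operators does not depend on the orderings. -/
theorem prod_term_eq (hg : g ≠ 0) (O : ℕ → LocalOperator g) (ε ε' : ℕ → ℝ) (x : ι → ℝ)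
    {L L' : ChainLists ι} {k : ℕ} (h : Perm L L' k)
    (hn : ∀ p < k, (L.top (p + 1)).Nodup) (htb : ∀ p < k, (L.top (p + 1)).Perm (L.bot p))
    (h0 : L.c 0 = L'.c 0 ∧ L.u 0 = L'.u 0 ∧ L.w 0 = L'.w 0 ∧ L.d 0 = L'.d 0)
    (hk : L.c k = L'.c k ∧ L.u k = L'.u k ∧ L.w k = L'.w k ∧ L.d k = L'.d k) :
    ∏ p ∈ Finset.range k, L.term O ε ε' x p = ∏ p ∈ Finset.range k, L'.term O ε ε' x p := by
  set f : ℕ → ℂ := fun p =>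
      ((orderProd g x (L'.c p) * orderProd g x (L'.u p) * orderProd g x (L'.w p) *
        orderProd g x (L'.d p)) /
      (orderProd g x (L.c p) * orderProd g x (L.u p) * orderProd g x (L.w p) *
        orderProd g x (L.d p))) with hf
  have n := orderProd_ne_zero (ι := ι) hg x
  have hne : ∀ p, f p ≠ 0 := fun p => by
    simp only [hf]
    exact div_ne_zero (by simp [n]) (by simp [n])
  -- The two families coincide at both ends, so shifting the index leaves the product of the ratios
  -- unchanged.
  have f0 : f 0 = 1 := by
    simp only [hf]
    rw [h0.1, h0.2.1, h0.2.2.1, h0.2.2.2, div_self (by simp [n])]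
  have fk : f k = 1 := by
    simp only [hf]
    rw [hk.1, hk.2.1, hk.2.2.1, hk.2.2.2, div_self (by simp [n])]
  have key : (∏ p ∈ Finset.range k, L'.term O ε ε' x p) * ∏ p ∈ Finset.range k, f p =
      (∏ p ∈ Finset.range k, L.term O ε ε' x p) * ∏ p ∈ Finset.range k, f (p + 1) := by
    rw [← Finset.prod_mul_distrib, ← Finset.prod_mul_distrib]
    refine Finset.prod_congr rfl fun p hp => ?_
    have hp := Finset.mem_range.1 hp
    exact term_eq hg O ε ε' x h hp (hn p hp) (htb p hp)
  have hshift : ∏ p ∈ Finset.range k, f (p + 1) = ∏ p ∈ Finset.range k, f p := by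
    have h1 := Finset.prod_range_succ f k
    have h2 := Finset.prod_range_succ' f k
    rw [f0, mul_one] at h2
    rw [fk, mul_one] at h1
    rw [← h2, h1]
  rw [hshift] at key
  exact (mul_right_cancel₀ (Finset.prod_ne_zero_iff.2 fun p _ => hne p) key).symm

end ChainLists

end Chain

/-! ### Matchings -/

section Matching

variable {ι : Type*} [LinearOrder ι]

theorem mem_vec {C : Finset ι} {v : ι} : v ∈ vec C ↔ v ∈ C := Finset.mem_sort _

theorem vec_nodup (C : Finset ι) : (vec C).Nodup := Finset.sort_nodup _ _

theorem vec_toFinset (C : Finset ι) : (vec C).toFinset = C := Finset.sort_toFinset _ _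

theorem length_vec (C : Finset ι) : (vec C).length = C.card := Finset.length_sort _

theorem IsOrdering.length_eq {C : Finset ι} {l : List ι} (h : IsOrdering l C) :
    l.length = C.card := by
  rw [← h.2, List.toFinset_card_of_nodup h.1]

theorem IsOrdering.mem_iff {C : Finset ι} {l : List ι} (h : IsOrdering l C) {v : ι} :
    v ∈ l ↔ v ∈ C := by
  rw [← h.2, List.mem_toFinset]

/-- The set of the orderings of `C`. -/
def orderings (C : Finset ι) : Finset (List ι) := Finset.univ.image (vecPerm C)

theorem vecPerm_injective (C : Finset ι) : Function.Injective (vecPerm C) := by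
  intro σ τ h
  have := List.ofFn_injective h
  ext a
  exact congrArg Fin.val ((C.orderEmbOfFin rfl).injective (congrFun this a))

/-- Lets sums over permutations be indexed by the resulting lists. The permutation is recovered by
ranking each entry of the list within `C`. -/
theorem mem_orderings {C : Finset ι} {l : List ι} : l ∈ orderings C ↔ IsOrdering l C := by
  simp only [orderings, Finset.mem_image, Finset.mem_univ, true_and]
  constructor
  · rintro ⟨σ, rfl⟩
    refine ⟨List.nodup_ofFn.2 ((C.orderEmbOfFin rfl).injective.comp σ.injective), ?_⟩
    ext v
    rw [List.mem_toFinset, vecPerm, List.mem_ofFn']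
    have := Finset.range_orderEmbOfFin C rfl
    constructor
    · rintro ⟨a, rfl⟩
      exact Finset.orderEmbOfFin_mem C rfl _
    · intro hv
      have hv' : v ∈ Set.range (C.orderEmbOfFin rfl) := by rw [this]; exact hv
      obtain ⟨a, rfl⟩ := hv'
      exact ⟨σ.symm a, by simp⟩
  · intro h
    have hl := h.length_eq
    have hm : ∀ i : Fin C.card, l.get (i.cast hl.symm) ∈ C := fun i =>
      h.mem_iff.1 (l.get_mem _)
    set f : Fin C.card → Fin C.card := fun i => (C.orderIsoOfFin rfl).symm ⟨_, hm i⟩ with hf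
    have hinj : Function.Injective f := by
      intro i j hij
      have h1 := (C.orderIsoOfFin rfl).symm.injective hij
      have h2 := List.nodup_iff_injective_get.1 h.1 (Subtype.mk.inj h1)
      exact Fin.cast_injective _ h2
    refine ⟨Equiv.ofBijective f (Finite.injective_iff_bijective.1 hinj), ?_⟩
    apply List.ext_get
    · simp [vecPerm, hl]
    · intro n h1 h2
      simp only [vecPerm, List.get_ofFn]
      have h3 : C.orderEmbOfFin rfl (f ⟨n, by omega⟩) = l.get ⟨n, h2⟩ := by
        rw [← Finset.coe_orderIsoOfFin_apply, hf]
        simp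
      exact h3

theorem sum_vecPerm {M : Type*} [AddCommMonoid M] (C : Finset ι) (F : List ι → M) :
    ∑ σ, F (vecPerm C σ) = ∑ l ∈ orderings C, F l := by
  rw [orderings, Finset.sum_image (fun _ _ _ _ h => vecPerm_injective C h)]

/-- The partner of a variable, or the variable itself if it is unmatched. -/
def step {ι : Type*} (m : ι → Option ι) (v : ι) : ι := (m v).getD v

theorem eq_some_step {m : ι → Option ι} {v : ι} (h : (m v).isSome) : m v = some (step m v) := by
  obtain ⟨w, hw⟩ := Option.isSome_iff_exists.1 h
  simp [step, hw]

/-- The Dirac mass attached to a variable by a matching. -/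
noncomputable def diracTerm (m : ι → Option ι) (v : ι) : GenDensity ι :=
  (m v).elim 1 (fun w => fn (fun _ => 2 * (Real.pi : ℂ)) * MvPolynomial.X (v, w))

theorem Delta_map_step (m : ι → Option ι) {V : List ι} (h : ∀ v ∈ V, (m v).isSome) :
    Delta V (V.map (step m)) = (V.map (diracTerm m)).prod := by
  induction V with
  | nil => rfl
  | cons v V ih =>
    have ih := ih fun w hw => h w (List.mem_cons_of_mem _ hw)
    unfold Delta at ih ⊢
    have hv := eq_some_step (h v List.mem_cons_self)
    simp only [List.map_cons, List.zip_cons_cons, List.prod_cons, ih, diracTerm]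
    congr 1
    rw [hv]
    rfl

theorem Delta_append {U U' V V' : List ι} (h : U.length = V.length) :
    Delta (U ++ U') (V ++ V') = Delta U V * Delta U' V' := by
  unfold Delta
  rw [List.zip_append h, List.map_append, List.prod_append]

theorem prod_map_vec {M : Type*} [CommMonoid M] (C : Finset ι) (f : ι → M) :
    ((vec C).map f).prod = ∏ v ∈ C, f v := by
  rw [← List.prod_toFinset f (vec_nodup C), vec_toFinset]

theorem Delta_vec_map_step (m : ι → Option ι) {C : Finset ι} (h : ∀ v ∈ C, (m v).isSome) :
    Delta (vec C) ((vec C).map (step m)) = ∏ v ∈ C, diracTerm m v := by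
  rw [Delta_map_step m fun v hv => h v (mem_vec.1 hv), prod_map_vec]

/-- The matching which sends the entries of `V` to those of `L`. -/
def matchOf (V L : List ι) (v : ι) : Option ι := L[V.idxOf v]?

theorem matchOf_isSome {V L : List ι} (h : V.length = L.length) {v : ι} :
    (matchOf V L v).isSome ↔ v ∈ V := by
  rw [matchOf, ← List.idxOf_lt_length_iff]
  simp [h]

theorem mem_of_matchOf {V L : List ι} {v w : ι} (h : matchOf V L v = some w) : w ∈ L :=
  List.mem_of_getElem? h

theorem matchOf_injective {V L : List ι} (h : V.length = L.length) (hL : L.Nodup) {v v' w : ι}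
    (h1 : matchOf V L v = some w) (h2 : matchOf V L v' = some w) : v = v' := by
  have hv : v ∈ V := (matchOf_isSome h).1 (by simp [h1])
  rw [← List.idxOf_inj hv]
  unfold matchOf at h1 h2
  have hlt : V.idxOf v < L.length := h ▸ List.idxOf_lt_length_iff.2 hv
  exact (List.getElem?_inj hlt hL).1 (h1.trans h2.symm)

theorem map_step_matchOf {V L : List ι} (h : V.length = L.length) (hV : V.Nodup) :
    V.map (step (matchOf V L)) = L := by
  apply List.ext_getElem
  · simp [h]
  · intro n h1 h2
    rw [List.length_map] at h1
    simp only [List.getElem_map, step, matchOf, hV.idxOf_getElem n h1]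
    simp [h2]

theorem exists_matchOf_eq {V L : List ι} (h : V.length = L.length) {w : ι} (hw : w ∈ L)
    (hV : V.Nodup) : ∃ v ∈ V, matchOf V L v = some w := by
  obtain ⟨n, hn, rfl⟩ := List.getElem_of_mem hw
  refine ⟨V[n], List.getElem_mem _, ?_⟩
  simp [matchOf, hV.idxOf_getElem n (h ▸ hn), hn]

theorem map_step_isOrdering {m : ι → Option ι}
    (hm : ∀ v v' w, m v = some w → m v' = some w → v = v') {C : Finset ι}
    (hC : ∀ v ∈ C, (m v).isSome) : IsOrdering ((vec C).map (step m)) (C.image (step m)) := by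
  constructor
  · refine (vec_nodup C).map_on fun v hv w hw h => ?_
    have h1 := eq_some_step (hC v (mem_vec.1 hv))
    have h2 := eq_some_step (hC w (mem_vec.1 hw))
    rw [← h] at h2
    exact hm v w _ h1 h2
  · ext v
    simp [mem_vec]

end Matching

/-! ### The kernel as a sum over matchings -/

section Kernel

variable {ι : Type*} [LinearOrder ι]

open Classical in
/-- The matchings of a part of `A` with a part of `B`. -/
noncomputable def partialMatchings [Fintype ι] (A B : Finset ι) : Finset (ι → Option ι) :=
  Finset.univ.filter (fun m => (∀ v w, m v = some w → v ∈ A ∧ w ∈ B) ∧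
    ∀ v v' w, m v = some w → m v' = some w → v = v')

/-- The matched elements of `A`. -/
def matched (m : ι → Option ι) (A : Finset ι) : Finset ι := A.filter (fun v => (m v).isSome)

theorem mem_matched {m : ι → Option ι} {A : Finset ι} {v : ι} :
    v ∈ matched m A ↔ v ∈ A ∧ (m v).isSome := Finset.mem_filter

theorem matched_congr {m m' : ι → Option ι} {A : Finset ι} (h : ∀ v ∈ A, m v = m' v) :
    matched m A = matched m' A :=
  Finset.filter_congr fun v hv => by rw [h v hv]

/-- The partners of the elements of `A`, in the order of the elements of `A`. -/
noncomputable def partners (m : ι → Option ι) (A : Finset ι) : List ι :=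
  (vec (matched m A)).map (step m)

/-- The elements of `B` which are not partners of elements of `A₁`, `A₂`. -/
noncomputable def freePart (m : ι → Option ι) (A₁ A₂ B : Finset ι) : Finset ι :=
  B \ ((matched m A₁).image (step m) ∪ (matched m A₂).image (step m))

/-- The coefficient of the kernel on the Dirac masses of a matching. -/
noncomputable def kernelCoef {g : ℝ} (O : LocalOperator g) (ε ε' : ℝ) (A₁ A₂ B : Finset ι)
    (m : ι → Option ι) (x : ι → ℝ) : ℂ :=
  Complex.exp (-2 * Complex.I * Real.pi * A₁.card * O.ω) *
  (sProd g x (vec (A₁ ∪ A₂)).reverse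
      ((vec (matched m A₂)).reverse ++ (vec (A₂ \ matched m A₂)).reverse
        ++ (vec (A₁ \ matched m A₁)).reverse ++ (vec (matched m A₁)).reverse)
    * sProd g x (vec B) (partners m A₁ ++ vec (freePart m A₁ A₂ B) ++ partners m A₂)
    * shiftedFF O ε ε' x (vec (A₁ \ matched m A₁)).reverse (vec (freePart m A₁ A₂ B))
        (vec (A₂ \ matched m A₂)).reverse)

theorem map_step_congr {m m' : ι → Option ι} {C : Finset ι} (h : ∀ v ∈ C, m v = m' v) :
    (vec C).map (step m) = (vec C).map (step m') :=
  List.map_congr_left fun v hv => by rw [step, step, h v (mem_vec.1 hv)]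

theorem kernelCoef_congr {g : ℝ} (O : LocalOperator g) (ε ε' : ℝ) {A₁ A₂ B : Finset ι}
    {m m' : ι → Option ι} (h : ∀ v, v ∈ A₁ ∨ v ∈ A₂ → m v = m' v) :
    kernelCoef O ε ε' A₁ A₂ B m = kernelCoef O ε ε' A₁ A₂ B m' := by
  have h1 : ∀ v ∈ A₁, m v = m' v := fun v hv => h v (Or.inl hv)
  have h2 : ∀ v ∈ A₂, m v = m' v := fun v hv => h v (Or.inr hv)
  have h1' : ∀ v ∈ matched m' A₁, m v = m' v := fun v hv => h1 v (mem_matched.1 hv).1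
  have h2' : ∀ v ∈ matched m' A₂, m v = m' v := fun v hv => h2 v (mem_matched.1 hv).1
  have i1 : (matched m' A₁).image (step m) = (matched m' A₁).image (step m') :=
    Finset.image_congr fun v hv => by rw [step, step, h1' v hv]
  have i2 : (matched m' A₂).image (step m) = (matched m' A₂).image (step m') :=
    Finset.image_congr fun v hv => by rw [step, step, h2' v hv]
  funext x
  simp only [kernelCoef, partners, freePart, matched_congr h1, matched_congr h2,
    map_step_congr h1', map_step_congr h2', i1, i2]

theorem fn_mul (f h : (ι → ℝ) → ℂ) : fn f * fn h = fn (fun x => f x * h x) :=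
  (MvPolynomial.C_mul (a := f) (a' := h)).symm

theorem fn_prod {κ : Type*} (s : Finset κ) (f : κ → (ι → ℝ) → ℂ) :
    ∏ i ∈ s, fn (f i) = fn (fun x => ∏ i ∈ s, f i x) := by
  have : (fun x => ∏ i ∈ s, f i x) = ∏ i ∈ s, f i := by
    funext x
    rw [Finset.prod_apply]
  rw [this, fn, map_prod]
  rfl

/-- The Dirac masses of one summand pair `C₁` with an ordering of `B₁` and `D₁` with one of `B₃`.
This is a partial injection of A into B, and since `A₁`, `A₂` are disjoint the injection recovers
all the data. -/
theorem kernel_eq_sum_matchings [Fintype ι] {g : ℝ} (O : LocalOperator g) (ε ε' : ℝ)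
    {A A₁ A₂ : Finset ι} (B : Finset ι) (hA : Disjoint A₁ A₂)
    (hunion : ∀ v, v ∈ A ↔ v ∈ A₁ ∨ v ∈ A₂) :
    kernel O ε ε' A₁ A₂ B = ∑ m ∈ partialMatchings A B,
      (∏ v ∈ A, diracTerm m v) * fn (kernelCoef O ε ε' A₁ A₂ B m) := by
  obtain rfl : A = A₁ ∪ A₂ := by ext v; rw [hunion, Finset.mem_union]
  unfold kernel
  -- Permutations are traded for the ordered lists they produce, which can be compared directly with
  -- `partners`.
  have e1 : ∀ C₁ D₁ : Finset ι, ∀ Q : Finset ι × Finset ι,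
      ∑ τ₁ : Equiv.Perm (Fin Q.1.card), ∑ τ₃ : Equiv.Perm (Fin Q.2.card),
    Delta (vec C₁ ++ vec D₁) (vecPerm Q.1 τ₁ ++ vecPerm Q.2 τ₃) *
    fn (fun x =>
      sProd g x (vec (A₁ ∪ A₂)).reverse
          ((vec D₁).reverse ++ (vec (A₂ \ D₁)).reverse
            ++ (vec (A₁ \ C₁)).reverse ++ (vec C₁).reverse)
        * sProd g x (vec B) (vecPerm Q.1 τ₁ ++ vec (B \ (Q.1 ∪ Q.2)) ++ vecPerm Q.2 τ₃)
        * shiftedFF O ε ε' x (vec (A₁ \ C₁)).reverse (vec (B \ (Q.1 ∪ Q.2)))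
            (vec (A₂ \ D₁)).reverse) =
      ∑ l₁ ∈ orderings Q.1, ∑ l₃ ∈ orderings Q.2,
    Delta (vec C₁ ++ vec D₁) (l₁ ++ l₃) *
    fn (fun x =>
      sProd g x (vec (A₁ ∪ A₂)).reverse
          ((vec D₁).reverse ++ (vec (A₂ \ D₁)).reverse
            ++ (vec (A₁ \ C₁)).reverse ++ (vec C₁).reverse)
        * sProd g x (vec B) (l₁ ++ vec (B \ (Q.1 ∪ Q.2)) ++ l₃)
        * shiftedFF O ε ε' x (vec (A₁ \ C₁)).reverse (vec (B \ (Q.1 ∪ Q.2)))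
            (vec (A₂ \ D₁)).reverse) := by
    intro C₁ D₁ Q
    rw [← sum_vecPerm Q.1 (fun l₁ => ∑ l₃ ∈ orderings Q.2, _)]
    refine Finset.sum_congr rfl fun τ₁ _ => ?_
    rw [← sum_vecPerm Q.2 (fun l₃ => Delta (vec C₁ ++ vec D₁) (vecPerm Q.1 τ₁ ++ l₃) * _)]
  simp only [e1, Finset.mul_sum, Finset.sum_sigma']
  symm
  refine Finset.sum_bij (fun m _ => ⟨matched m A₁, matched m A₂,
    ((matched m A₁).image (step m), (matched m A₂).image (step m)), partners m A₁,
      partners m A₂⟩) ?_ ?_ ?_ ?_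
  · intro m hm
    simp only [partialMatchings, Finset.mem_filter, Finset.mem_univ, true_and] at hm
    obtain ⟨h1, h2⟩ := hm
    have hinj : ∀ C : Finset ι, (∀ v ∈ C, (m v).isSome) →
        Set.InjOn (step m) C := fun C hC v hv w hw h => by
      have e1 := eq_some_step (hC v hv)
      have e2 := eq_some_step (hC w hw)
      rw [← h] at e2
      exact h2 _ _ _ e1 e2
    have hs : ∀ A : Finset ι, ∀ v ∈ matched m A, (m v).isSome := fun A v hv =>
      (mem_matched.1 hv).2
    simp only [Finset.mem_sigma, Finset.mem_powerset, Finset.mem_filter, Finset.mem_product,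
      mem_orderings]
    refine ⟨Finset.filter_subset _ _, Finset.filter_subset _ _, ⟨⟨?_, ?_⟩, ?_, ?_, ?_⟩, ?_, ?_⟩
    · intro w hw
      obtain ⟨v, hv, rfl⟩ := Finset.mem_image.1 hw
      exact (h1 _ _ (eq_some_step (hs _ v hv))).2
    · intro w hw
      obtain ⟨v, hv, rfl⟩ := Finset.mem_image.1 hw
      exact (h1 _ _ (eq_some_step (hs _ v hv))).2
    · rw [Finset.disjoint_left]
      intro w hw hw'
      obtain ⟨v, hv, rfl⟩ := Finset.mem_image.1 hw
      obtain ⟨v', hv', he⟩ := Finset.mem_image.1 hw'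
      have e1 := eq_some_step (hs _ v hv)
      have e2 := eq_some_step (hs _ v' hv')
      rw [he] at e2
      have := h2 _ _ _ e1 e2
      subst this
      exact Finset.disjoint_left.1 hA (mem_matched.1 hv).1 (mem_matched.1 hv').1
    · exact Finset.card_image_of_injOn (hinj _ (hs _))
    · exact Finset.card_image_of_injOn (hinj _ (hs _))
    · exact map_step_isOrdering h2 (hs _)
    · exact map_step_isOrdering h2 (hs _)
  · intro m hm m' hm' h
    simp only [partialMatchings, Finset.mem_filter, Finset.mem_univ, true_and] at hm hm'
    simp only [Sigma.mk.injEq, heq_eq_eq, Prod.mk.injEq] at h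
    obtain ⟨h1, h2, -, h3, h4⟩ := h
    have key : ∀ A : Finset ι, matched m A = matched m' A → partners m A = partners m' A →
        ∀ v ∈ A, m v = m' v := by
      intro A hA hp v hv
      by_cases hs : (m v).isSome
      · have hv1 : v ∈ matched m A := mem_matched.2 ⟨hv, hs⟩
        have hv2 := hv1
        rw [hA] at hv2
        unfold partners at hp
        rw [← hA] at hp
        have := List.map_inj_left.1 hp v (mem_vec.2 hv1)
        rw [eq_some_step hs, eq_some_step (mem_matched.1 hv2).2, this]
      · have hs' : ¬ (m' v).isSome := fun h' => by
          have : v ∈ matched m' A := mem_matched.2 ⟨hv, h'⟩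
          rw [← hA] at this
          exact hs (mem_matched.1 this).2
        rw [Option.not_isSome_iff_eq_none] at hs hs'
        rw [hs, hs']
    funext v
    by_cases hv : v ∈ A₁ ∪ A₂
    · rcases Finset.mem_union.1 hv with hv | hv
      · exact key A₁ h1 h3 v hv
      · exact key A₂ h2 h4 v hv
    · have n1 : m v = none := by
        rw [Option.eq_none_iff_forall_ne_some]
        exact fun w hw => hv (hm.1 _ _ hw).1
      have n2 : m' v = none := by
        rw [Option.eq_none_iff_forall_ne_some]
        exact fun w hw => hv (hm'.1 _ _ hw).1
      rw [n1, n2]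
  · rintro ⟨C, D, Q, l₁, l₃⟩ h
    simp only [Finset.mem_sigma, Finset.mem_powerset, Finset.mem_filter, Finset.mem_product,
      mem_orderings] at h
    obtain ⟨hC, hD, ⟨⟨hQ1, hQ2⟩, hQ, hc1, hc2⟩, hl1, hl3⟩ := h
    have len1 : (vec C).length = l₁.length := by rw [length_vec, hl1.length_eq, hc1]
    have len2 : (vec D).length = l₃.length := by rw [length_vec, hl3.length_eq, hc2]
    have len : (vec C ++ vec D).length = (l₁ ++ l₃).length := by simp [len1, len2]
    have hCD : Disjoint C D := Finset.disjoint_of_subset_left hC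
      (Finset.disjoint_of_subset_right hD hA)
    have hV : (vec C ++ vec D).Nodup := List.nodup_append'.2 ⟨vec_nodup _, vec_nodup _,
      fun v h1 h2 => Finset.disjoint_left.1 hCD (mem_vec.1 h1) (mem_vec.1 h2)⟩
    have hL : (l₁ ++ l₃).Nodup := List.nodup_append'.2 ⟨hl1.1, hl3.1,
      fun v h1 h2 => Finset.disjoint_left.1 hQ (hl1.mem_iff.1 h1) (hl3.mem_iff.1 h2)⟩
    -- The inverse map: pair entries at equal positions.
    set m := matchOf (vec C ++ vec D) (l₁ ++ l₃) with hm
    have hsome : ∀ v, (m v).isSome ↔ v ∈ C ∨ v ∈ D := fun v => by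
      rw [hm, matchOf_isSome len, List.mem_append, mem_vec, mem_vec]
    have hmA : matched m A₁ = C := by
      ext v
      rw [mem_matched, hsome]
      refine ⟨?_, fun h => ⟨hC h, Or.inl h⟩⟩
      rintro ⟨h1, h2 | h2⟩
      · exact h2
      · exact absurd (hD h2) (Finset.disjoint_left.1 hA h1)
    have hmD : matched m A₂ = D := by
      ext v
      rw [mem_matched, hsome]
      refine ⟨?_, fun h => ⟨hD h, Or.inr h⟩⟩
      rintro ⟨h1, h2 | h2⟩
      · exact absurd h1 (Finset.disjoint_left.1 hA (hC h2))
      · exact h2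
    have hmap := map_step_matchOf len hV
    rw [← hm, List.map_append] at hmap
    obtain ⟨hp1, hp3⟩ := List.append_inj hmap (by simp [len1])
    have hpA : partners m A₁ = l₁ := by rw [partners, hmA, hp1]
    have hpD : partners m A₂ = l₃ := by rw [partners, hmD, hp3]
    have im : ∀ (E : Finset ι), E.image (step m) = ((vec E).map (step m)).toFinset := fun E => by
      ext v; simp [mem_vec]
    have hmem : m ∈ partialMatchings (A₁ ∪ A₂) B := by
      simp only [partialMatchings, Finset.mem_filter, Finset.mem_univ, true_and]
      refine ⟨fun v w hvw => ⟨?_, ?_⟩, fun v v' w h1 h2 => matchOf_injective len hL h1 h2⟩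
      · have := (hsome v).1 (by simp [hvw])
        exact this.elim (fun h => Finset.mem_union_left _ (hC h))
          (fun h => Finset.mem_union_right _ (hD h))
      · rcases List.mem_append.1 (mem_of_matchOf hvw) with h | h
        · exact hQ1 (hl1.mem_iff.1 h)
        · exact hQ2 (hl3.mem_iff.1 h)
    refine ⟨m, hmem, ?_⟩
    rw [hpA, hpD, hmA, hmD, im, im, hp1, hp3, hl1.2, hl3.2]
  · intro m hm
    have hs : ∀ A : Finset ι, ∀ v ∈ matched m A, (m v).isSome := fun A v hv =>
      (mem_matched.1 hv).2
    have hd : Disjoint (matched m A₁) (matched m A₂) :=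
      Finset.disjoint_of_subset_left (Finset.filter_subset _ _)
        (Finset.disjoint_of_subset_right (Finset.filter_subset _ _) hA)
    -- Unmatched variables contribute the factor 1, so the product may run over all of A.
    have hprod : ∏ v ∈ A₁ ∪ A₂, diracTerm m v =
        Delta (vec (matched m A₁) ++ vec (matched m A₂)) (partners m A₁ ++ partners m A₂) := by
      rw [Delta_append (by simp [partners]), partners, partners, Delta_vec_map_step m (hs _),
        Delta_vec_map_step m (hs _), ← Finset.prod_union hd]
      symm
      apply Finset.prod_subset
      · exact Finset.union_subset_union (Finset.filter_subset _ _) (Finset.filter_subset _ _)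
      · intro v hv hv'
        have : ¬ (m v).isSome := fun h => hv' <| by
          rcases Finset.mem_union.1 hv with h1 | h1
          · exact Finset.mem_union_left _ (mem_matched.2 ⟨h1, h⟩)
          · exact Finset.mem_union_right _ (mem_matched.2 ⟨h1, h⟩)
        rw [Option.not_isSome_iff_eq_none] at this
        rw [diracTerm, this]
        rfl
    rw [hprod, mul_left_comm, fn_mul]
    rfl

end Kernel

/-! ### The density as a sum over matchings -/

section Density

variable {g : ℝ} {k : ℕ} {r : ℕ → ℕ}

open Classical in
/-- The matchings of variables of consecutive levels. -/
noncomputable def matchings (k : ℕ) (r : ℕ → ℕ) : Finset (Var k r → Option (Var k r)) :=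
  Finset.univ.filter (fun m => (∀ v w, m v = some w → lvl w = lvl v + 1) ∧
    ∀ v v' w, m v = some w → m v' = some w → v = v')

theorem mem_matchings {m : Var k r → Option (Var k r)} :
    m ∈ matchings k r ↔ (∀ v w, m v = some w → lvl w = lvl v + 1) ∧
      ∀ v v' w, m v = some w → m v' = some w → v = v' := by
  simp [matchings]

theorem one_le_lvl (v : Var k r) : 1 ≤ lvl v := (Finset.mem_Icc.1 (ofLex v).1.2).1

theorem lvl_le (v : Var k r) : lvl v ≤ k := (Finset.mem_Icc.1 (ofLex v).1.2).2

theorem mem_setA {s : ℕ} {v : Var k r} : v ∈ setA k r s ↔ lvl v = s := by simp [setA]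

theorem lvl_of_eq_some {m : Var k r → Option (Var k r)} (hm : m ∈ matchings k r) {u v : Var k r} (h : m u = some v) :
    lvl v = lvl u + 1 := (mem_matchings.1 hm).1 u v h

theorem eq_none_of_lvl_eq {m : Var k r → Option (Var k r)} (hm : m ∈ matchings k r) {v : Var k r} (hv : lvl v = k) :
    m v = none := by
  rw [Option.eq_none_iff_forall_ne_some]
  intro w hw
  have h1 := lvl_of_eq_some hm hw
  have h2 := lvl_le w
  omega

theorem prod_diracTerm {m : Var k r → Option (Var k r)} (hm : m ∈ matchings k r) :
    ∏ v, diracTerm m v = ∏ p ∈ Finset.Icc 1 k, ∏ v ∈ setA k r (p - 1), diracTerm m v := by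
  rw [← Finset.prod_filter_mul_prod_filter_not Finset.univ (fun v : Var k r => lvl v < k)]
  have h1 : ∏ v ∈ Finset.univ.filter (fun v : Var k r => ¬ lvl v < k), diracTerm m v = 1 := by
    refine Finset.prod_eq_one fun v hv => ?_
    have hv : ¬ lvl v < k := (Finset.mem_filter.1 hv).2
    rw [diracTerm, eq_none_of_lvl_eq hm (by have := lvl_le v; omega)]
    rfl
  rw [h1, mul_one, ← Finset.prod_fiberwise_of_maps_to (g := fun v : Var k r => lvl v + 1)
    (t := Finset.Icc 1 k)]
  · refine Finset.prod_congr rfl fun p hp => Finset.prod_congr ?_ fun _ _ => rfl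
    ext v
    have := Finset.mem_Icc.1 hp
    simp only [Finset.mem_filter, Finset.mem_univ, true_and, mem_setA]
    omega
  · intro v hv
    have hv : lvl v < k := (Finset.mem_filter.1 hv).2
    rw [Finset.mem_Icc]; omega

/-- Expand the product of sums: one partial matching per pair of consecutive levels is the same as a
global matching. No injectivity conflict arises across levels, since the level of a target fixes
that of its source. -/
theorem gDensity_eq_sum_matchings (O : ℕ → LocalOperator g) (ε ε' : ℕ → ℝ)
    {A₁ A₂ : ℕ → Finset (Var k r)} (hdisj : ∀ s < k, Disjoint (A₁ s) (A₂ s))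
    (hunion : ∀ s < k, A₁ s ∪ A₂ s = setA k r s) :
    gDensity O ε ε' A₁ A₂ = ∑ m ∈ matchings k r, (∏ v, diracTerm m v) *
      fn (fun x => ∏ p ∈ Finset.Icc 1 k, kernelCoef (O p) (ε p) (ε' p) (A₁ (p - 1)) (A₂ (p - 1))
        (setA k r p) m x) := by
  classical
  have e1 : gDensity O ε ε' A₁ A₂ = ∏ p ∈ Finset.Icc 1 k,
      ∑ m ∈ partialMatchings (setA k r (p - 1)) (setA k r p),
      (∏ v ∈ setA k r (p - 1), diracTerm m v) *
        fn (kernelCoef (O p) (ε p) (ε' p) (A₁ (p - 1)) (A₂ (p - 1)) (setA k r p) m) := by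
    refine Finset.prod_congr rfl fun p hp => ?_
    have hp' : p - 1 < k := by have := Finset.mem_Icc.1 hp; omega
    exact kernel_eq_sum_matchings _ _ _ _ (hdisj _ hp')
      (fun v => by rw [← hunion _ hp', Finset.mem_union])
  rw [e1, Finset.prod_sum]
  symm
  refine Finset.sum_bij (fun m _ => fun p _ => fun v => if lvl v = p - 1 then m v else none)
    ?_ ?_ ?_ ?_
  · intro m hm
    obtain ⟨h1, h2⟩ := mem_matchings.1 hm
    rw [Finset.mem_pi]
    intro p hp
    simp only [partialMatchings, Finset.mem_filter, Finset.mem_univ, true_and, mem_setA]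
    have hp1 := (Finset.mem_Icc.1 hp).1
    refine ⟨fun v w h => ?_, fun v v' w h h' => ?_⟩
    · split_ifs at h with hv
      have := h1 v w h
      omega
    · split_ifs at h h'
      exact h2 v v' w h h'
  · intro m hm m' hm' h
    funext v
    rcases eq_or_ne (lvl v) k with hv | hv
    · rw [eq_none_of_lvl_eq hm hv, eq_none_of_lvl_eq hm' hv]
    · have hp : lvl v + 1 ∈ Finset.Icc 1 k := by
        have := lvl_le v
        rw [Finset.mem_Icc]; omega
      have := congrFun (congrFun (congrFun h (lvl v + 1)) hp) v
      simpa using this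
  · intro F hF
    rw [Finset.mem_pi] at hF
    simp only [partialMatchings, Finset.mem_filter, Finset.mem_univ, true_and, mem_setA] at hF
    have hk : ∀ v : Var k r, lvl v ≠ k → lvl v + 1 ∈ Finset.Icc 1 k := fun v hv => by
      have := lvl_le v
      rw [Finset.mem_Icc]; omega
    -- Gluing: on a variable of level s the component of index s + 1 decides.
    set m : Var k r → Option (Var k r) := fun v =>
      if h : lvl v + 1 ∈ Finset.Icc 1 k then F (lvl v + 1) h v else none with hm
    have hmF : ∀ p (hp : p ∈ Finset.Icc 1 k) v, lvl v = p - 1 → m v = F p hp v := by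
      intro p hp v hv
      have : p = lvl v + 1 := by have := (Finset.mem_Icc.1 hp).1; omega
      subst this
      simp only [hm, dif_pos hp]
    have hex : ∀ v w, m v = some w → ∃ h : lvl v + 1 ∈ Finset.Icc 1 k,
        F (lvl v + 1) h v = some w := by
      intro v w h
      simp only [hm] at h
      split_ifs at h with hp
      exact ⟨hp, h⟩
    refine ⟨m, mem_matchings.2 ⟨fun v w h => ?_, fun v v' w h h' => ?_⟩, ?_⟩
    · obtain ⟨hp, h⟩ := hex v w h
      exact ((hF _ hp).1 v w h).2
    · obtain ⟨hp, h⟩ := hex v w h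
      obtain ⟨hp', h'⟩ := hex v' w h'
      have e1 := ((hF _ hp).1 v w h).2
      have e2 := ((hF _ hp').1 v' w h').2
      have e : lvl v' = lvl v := by omega
      have h'' : F (lvl v + 1) hp v' = some w := by
        rw [← h']
        congr 1
        simp [e]
      exact (hF _ hp).2 v v' w h h''
    · funext p hp v
      split_ifs with hv
      · exact hmF p hp v hv
      · symm
        rw [Option.eq_none_iff_forall_ne_some]
        intro w hw
        exact hv ((hF p hp).1 v w hw).1
  · intro m hm
    rw [prod_diracTerm hm, ← fn_prod, ← Finset.prod_mul_distrib, ← Finset.prod_attach (Finset.Icc 1 k)]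
    refine Finset.prod_congr rfl fun p _ => ?_
    have hp := Finset.mem_Icc.1 p.2
    have hp' : p.1 - 1 < k := by omega
    congr 1
    · refine Finset.prod_congr rfl fun v hv => ?_
      simp only [diracTerm, if_pos (mem_setA.1 hv)]
    · congr 1
      refine kernelCoef_congr _ _ _ fun v hv => ?_
      rw [← Finset.mem_union, hunion _ hp', mem_setA] at hv
      exact (if_pos hv).symm

end Density

/-! ### The chains of a matching and their labels -/

section Labels

variable {k : ℕ} {r : ℕ → ℕ}

/-- The sign of a variable: `true` on `A₁`. -/
noncomputable def sgn (A₁ : ℕ → Finset (Var k r)) (v : Var k r) : Bool :=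
  open Classical in decide (v ∈ A₁ (lvl v))

open Classical in
/-- The variable of which `v` is the partner. -/
noncomputable def prev (m : Var k r → Option (Var k r)) (v : Var k r) : Option (Var k r) :=
  if h : ∃ u, m u = some v then some h.choose else none

/-- Recursive form of the label of a variable, by its level. -/
noncomputable def labAux (A₁ : ℕ → Finset (Var k r)) (m : Var k r → Option (Var k r)) :
    ℕ → Var k r → ℕ
  | 0, _ => 0
  | n + 1, v => (prev m v).elim (2 ^ n) fun u => labAux A₁ m n u + MPart.tShift (n + 1) (sgn A₁ u)

/-- The label of a variable: the binary code of the level at which its chain starts and of the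
signs met along the chain. -/
noncomputable def lab (A₁ : ℕ → Finset (Var k r)) (m : Var k r → Option (Var k r))
    (v : Var k r) : ℕ := labAux A₁ m (lvl v) v

/-- Recursive form of the level at which the chain of a variable starts. -/
noncomputable def startAux (m : Var k r → Option (Var k r)) : ℕ → Var k r → ℕ
  | 0, _ => 0
  | n + 1, v => (prev m v).elim (n + 1) fun u => startAux m n u

/-- The level at which the chain of a variable starts. -/
noncomputable def start (m : Var k r → Option (Var k r)) (v : Var k r) : ℕ := startAux m (lvl v) v

/-- Recursive form of the end of a chain, by the number of remaining levels. -/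
def chainEndAux (m : Var k r → Option (Var k r)) : ℕ → Var k r → Var k r
  | 0, v => v
  | n + 1, v => (m v).elim v (chainEndAux m n)

/-- The last variable of the chain of `v`. -/
def chainEnd (m : Var k r → Option (Var k r)) (v : Var k r) : Var k r :=
  chainEndAux m (k - lvl v) v

variable {A₁ : ℕ → Finset (Var k r)} {m : Var k r → Option (Var k r)}

theorem prev_eq_some (hm : m ∈ matchings k r) {u v : Var k r} :
    prev m v = some u ↔ m u = some v := by
  constructor
  · intro h
    unfold prev at h
    split_ifs at h with hex
    rw [← Option.some.inj h]
    exact hex.choose_spec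
  · intro h
    have hex : ∃ u, m u = some v := ⟨u, h⟩
    rw [prev, dif_pos hex, (mem_matchings.1 hm).2 _ _ _ hex.choose_spec h]

theorem prev_eq_none {v : Var k r} : prev m v = none ↔ ∀ u, m u ≠ some v := by
  unfold prev
  split_ifs with h
  · simp only [false_iff, not_forall, not_not]
    exact h
  · simp only [true_iff]
    exact fun u hu => h ⟨u, hu⟩

-- Induction along chains from their starts; it terminates because each link raises the level by
-- one. The counterpart below runs from the ends.
@[elab_as_elim]
theorem chain_induction (hm : m ∈ matchings k r) {motive : Var k r → Prop}
    (base : ∀ v, (∀ u, m u ≠ some v) → motive v)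
    (step : ∀ u v, m u = some v → motive u → motive v) (v : Var k r) : motive v := by
  induction hn : lvl v generalizing v with
  | zero => have := one_le_lvl v; omega
  | succ n ih =>
    by_cases h : ∃ u, m u = some v
    · obtain ⟨u, hu⟩ := h
      have := lvl_of_eq_some hm hu
      exact step u v hu (ih u (by omega))
    · exact base v fun u hu => h ⟨u, hu⟩

@[elab_as_elim]
theorem chain_induction_end (hm : m ∈ matchings k r) {motive : Var k r → Prop}
    (base : ∀ v, m v = none → motive v)
    (step : ∀ v w, m v = some w → motive w → motive v) (v : Var k r) : motive v := by
  induction hn : k - lvl v generalizing v with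
  | zero => exact base v (eq_none_of_lvl_eq hm (by have := lvl_le v; omega))
  | succ n ih =>
    rcases h : m v with _ | w
    · exact base v h
    · have := lvl_of_eq_some hm h
      exact step v w h (ih w (by omega))

theorem lab_of_start {v : Var k r} (h : ∀ u, m u ≠ some v) : lab A₁ m v = 2 ^ (lvl v - 1) := by
  obtain ⟨n, hn⟩ : ∃ n, lvl v = n + 1 := ⟨lvl v - 1, by have := one_le_lvl v; omega⟩
  rw [lab, hn, labAux, prev_eq_none.2 h]
  rfl

theorem start_of_start {v : Var k r} (h : ∀ u, m u ≠ some v) : start m v = lvl v := by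
  obtain ⟨n, hn⟩ : ∃ n, lvl v = n + 1 := ⟨lvl v - 1, by have := one_le_lvl v; omega⟩
  rw [start, hn, startAux, prev_eq_none.2 h]
  rfl

theorem lab_of_eq_some (hm : m ∈ matchings k r) {u v : Var k r} (h : m u = some v) :
    lab A₁ m v = lab A₁ m u + MPart.tShift (lvl v) (sgn A₁ u) := by
  have hl := lvl_of_eq_some hm h
  rw [lab, hl, labAux, (prev_eq_some hm).2 h]
  rfl

theorem start_of_eq_some (hm : m ∈ matchings k r) {u v : Var k r} (h : m u = some v) :
    start m v = start m u := by
  have hl := lvl_of_eq_some hm h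
  rw [start, hl, startAux, (prev_eq_some hm).2 h]
  rfl

theorem tShift_succ (n : ℕ) (ϵ : Bool) : MPart.tShift (n + 1) ϵ = if ϵ then 0 else 2 ^ n := rfl

theorem lab_pos_lt (hm : m ∈ matchings k r) (v : Var k r) :
    1 ≤ lab A₁ m v ∧ lab A₁ m v < 2 ^ lvl v := by
  refine chain_induction hm (fun v h => ?_) (fun u v h ih => ?_) v
  · rw [lab_of_start h]
    exact ⟨Nat.one_le_two_pow, Nat.pow_lt_pow_right (by norm_num) (by have := one_le_lvl v; omega)⟩
  · rw [lab_of_eq_some hm h, lvl_of_eq_some hm h, tShift_succ, pow_succ]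
    split_ifs <;> omega

/-- A link leaving level n can only change the binary digit at position n, so the lower digits
persist. -/
theorem lab_mod (hm : m ∈ matchings k r) {u v : Var k r} (h : m u = some v) {a : ℕ}
    (ha : a ≤ lvl u) : lab A₁ m v % 2 ^ a = lab A₁ m u % 2 ^ a := by
  rw [lab_of_eq_some hm h, lvl_of_eq_some hm h, tShift_succ]
  split_ifs
  · rw [add_zero]
  · obtain ⟨c, hc⟩ := pow_dvd_pow 2 ha
    rw [hc, Nat.add_mul_mod_self_left]

theorem start_bounds (hm : m ∈ matchings k r) (v : Var k r) :
    1 ≤ start m v ∧ start m v ≤ lvl v := by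
  refine chain_induction hm (fun v h => ?_) (fun u v h ih => ?_) v
  · rw [start_of_start h]
    exact ⟨one_le_lvl v, le_rfl⟩
  · rw [start_of_eq_some hm h, lvl_of_eq_some hm h]
    omega

theorem lab_mod_start (hm : m ∈ matchings k r) (v : Var k r) :
    lab A₁ m v % 2 ^ start m v = 2 ^ (start m v - 1) := by
  refine chain_induction hm (fun v h => ?_) (fun u v h ih => ?_) v
  · rw [start_of_start h, lab_of_start h]
    exact Nat.mod_eq_of_lt (Nat.pow_lt_pow_right (by norm_num) (by have := one_le_lvl v; omega))
  · rw [start_of_eq_some hm h, lab_mod hm h (start_bounds hm u).2, ih]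

/-- The position of the lowest nonzero binary digit is unique; it determines the starting level. -/
theorem mod_two_pow_unique {x a b : ℕ} (h1 : x % 2 ^ a = 2 ^ (a - 1))
    (h2 : x % 2 ^ b = 2 ^ (b - 1)) : ¬ a < b := by
  intro hab
  have h3 : x % 2 ^ b % 2 ^ a = x % 2 ^ a := Nat.mod_mod_of_dvd _ (pow_dvd_pow 2 hab.le)
  rw [h2, h1, Nat.mod_eq_zero_of_dvd (pow_dvd_pow 2 (by omega))] at h3
  exact absurd h3.symm (by positivity)

/-- Translates the arithmetic progressions of indices in the statement into prescribed lower binary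
digits. -/
theorem exists_lt_eq_add_mul {x q n a : ℕ} (hx : x < 2 ^ q) (hn : n ≤ q) (ha : a < 2 ^ n) :
    (∃ s < 2 ^ (q - n), x = a + s * 2 ^ n) ↔ x % 2 ^ n = a := by
  constructor
  · rintro ⟨s, -, rfl⟩
    rw [Nat.add_mul_mod_self_right, Nat.mod_eq_of_lt ha]
  · intro h
    refine ⟨x / 2 ^ n, ?_, ?_⟩
    · rw [Nat.div_lt_iff_lt_mul (by positivity), ← pow_add, Nat.sub_add_cancel hn]
      exact hx
    · rw [← h, mul_comm]
      exact (Nat.mod_add_div _ _).symm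

/-- The numbers 2^(a-1)(2s+1) are those with lowest nonzero digit at position a - 1. This decodes
the index sets of γ and Ξ. -/
theorem start_eq_iff (hm : m ∈ matchings k r) {v : Var k r} {a : ℕ} (ha : 1 ≤ a)
    (hav : a ≤ lvl v) :
    (∃ s < 2 ^ (lvl v - a), lab A₁ m v = 2 ^ (a - 1) * (2 * s + 1)) ↔ start m v = a := by
  have e : ∀ s, 2 ^ (a - 1) * (2 * s + 1) = 2 ^ (a - 1) + s * 2 ^ a := fun s => by
    obtain ⟨b, rfl⟩ : ∃ b, a = b + 1 := ⟨a - 1, by omega⟩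
    rw [Nat.add_sub_cancel, pow_succ]
    ring
  simp only [e]
  rw [exists_lt_eq_add_mul (lab_pos_lt hm v).2 hav
    (Nat.pow_lt_pow_right (by norm_num) (by omega))]
  constructor
  · intro h
    have h1 := lab_mod_start (A₁ := A₁) hm v
    have h2 := mod_two_pow_unique h h1
    have h3 := mod_two_pow_unique h1 h
    omega
  · rintro rfl
    exact lab_mod_start hm v

theorem chainEnd_of_none {v : Var k r} (h : m v = none) : chainEnd m v = v := by
  unfold chainEnd
  rcases k - lvl v with _ | n
  · rfl
  · rw [chainEndAux, h]
    rfl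

theorem chainEnd_of_eq_some (hm : m ∈ matchings k r) {v w : Var k r} (h : m v = some w) :
    chainEnd m v = chainEnd m w := by
  have h1 := lvl_of_eq_some hm h
  have h2 := lvl_le w
  have h3 : k - lvl v = (k - lvl w) + 1 := by omega
  rw [chainEnd, h3, chainEndAux, h]
  rfl

theorem eq_none_chainEnd (hm : m ∈ matchings k r) (v : Var k r) : m (chainEnd m v) = none := by
  refine chain_induction_end hm (fun v h => ?_) (fun v w h ih => ?_) v
  · rwa [chainEnd_of_none h]
  · rwa [chainEnd_of_eq_some hm h]

theorem lvl_le_lvl_chainEnd (hm : m ∈ matchings k r) (v : Var k r) :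
    lvl v ≤ lvl (chainEnd m v) := by
  refine chain_induction_end hm (fun v h => ?_) (fun v w h ih => ?_) v
  · rw [chainEnd_of_none h]
  · rw [chainEnd_of_eq_some hm h]
    have := lvl_of_eq_some hm h
    omega

theorem start_chainEnd (hm : m ∈ matchings k r) (v : Var k r) :
    start m (chainEnd m v) = start m v := by
  refine chain_induction_end hm (fun v h => ?_) (fun v w h ih => ?_) v
  · rw [chainEnd_of_none h]
  · rw [chainEnd_of_eq_some hm h, ih, start_of_eq_some hm h]

/-- A chain meets each level at most once, and distinct chains have distinct ends. Passing to ends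
therefore loses nothing within one level. -/
theorem chainEnd_injective (hm : m ∈ matchings k r) {v v' : Var k r} (hl : lvl v = lvl v')
    (h : chainEnd m v = chainEnd m v') : v = v' := by
  suffices H : ∀ v v' : Var k r, lvl v = lvl v' → chainEnd m v = chainEnd m v' → v = v' from
    H v v' hl h
  clear hl h v v'
  intro v
  refine chain_induction_end hm (fun v hv => ?_) (fun v w hv ih => ?_) v
  · intro v' hl h
    rw [chainEnd_of_none hv] at h
    rcases hv' : m v' with _ | w'
    · rw [chainEnd_of_none hv'] at h
      exact h
    · rw [chainEnd_of_eq_some hm hv'] at h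
      have h1 := lvl_le_lvl_chainEnd hm w'
      have h2 := lvl_of_eq_some hm hv'
      rw [← h] at h1
      omega
  · intro v' hl h
    rw [chainEnd_of_eq_some hm hv] at h
    have h3 := lvl_of_eq_some hm hv
    rcases hv' : m v' with _ | w'
    · rw [chainEnd_of_none hv'] at h
      have h1 := lvl_le_lvl_chainEnd hm w
      rw [h] at h1
      omega
    · rw [chainEnd_of_eq_some hm hv'] at h
      have h2 := lvl_of_eq_some hm hv'
      have := ih w' (by omega) h
      subst this
      exact (mem_matchings.1 hm).2 _ _ _ hv hv'

theorem apply_chainEnd (hm : m ∈ matchings k r) {x : Config k r}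
    (hx : ∀ v w, m v = some w → x v = x w) (v : Var k r) : x (chainEnd m v) = x v := by
  refine chain_induction_end hm (fun v h => ?_) (fun v w h ih => ?_) v
  · rw [chainEnd_of_none h]
  · rw [chainEnd_of_eq_some hm h, ih, hx v w h]

theorem lab_chainEnd_mod (hm : m ∈ matchings k r) {v : Var k r} {a : ℕ} (ha : a ≤ lvl v) :
    lab A₁ m (chainEnd m v) % 2 ^ a = lab A₁ m v % 2 ^ a := by
  revert ha
  refine chain_induction_end hm (fun v h => ?_) (fun v w h ih => ?_) v
  · rw [chainEnd_of_none h]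
    exact fun _ => rfl
  · intro ha
    have := lvl_of_eq_some hm h
    rw [chainEnd_of_eq_some hm h, ih (by omega), lab_mod hm h ha]

/-- A nonzero digit below position q means that the chain starts at level q or lower. It then passes
through level q, where the label is the truncation. -/
theorem exists_ancestor (hm : m ∈ matchings k r) {v : Var k r} {q : ℕ} (hq : q ≤ lvl v)
    (h0 : lab A₁ m v % 2 ^ q ≠ 0) :
    ∃ w, lvl w = q ∧ chainEnd m w = chainEnd m v ∧ lab A₁ m w = lab A₁ m v % 2 ^ q := by
  have base : ∀ v, q = lvl v →
      ∃ w, lvl w = q ∧ chainEnd m w = chainEnd m v ∧ lab A₁ m w = lab A₁ m v % 2 ^ q := by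
    rintro v rfl
    exact ⟨v, rfl, rfl, (Nat.mod_eq_of_lt (lab_pos_lt hm v).2).symm⟩
  revert hq h0
  refine chain_induction hm (fun v h => ?_) (fun u v h ih => ?_) v
  · intro hq h0
    rcases eq_or_lt_of_le hq with hq | hq
    · exact base v hq
    · refine absurd ?_ h0
      rw [lab_of_start h]
      exact Nat.mod_eq_zero_of_dvd (pow_dvd_pow 2 (by omega))
  · intro hq h0
    have hl := lvl_of_eq_some hm h
    rcases eq_or_lt_of_le hq with hq | hq
    · exact base v hq
    · have hu : q ≤ lvl u := by omega
      rw [lab_mod hm h hu] at h0 ⊢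
      obtain ⟨w, h1, h2, h3⟩ := ih hu h0
      exact ⟨w, h1, h2.trans (chainEnd_of_eq_some hm h), h3⟩

/-- The elements of the level `p + 1` whose label lies strictly on one side of `2 ^ p` are the
partners of the elements of the level `p` with the corresponding sign. -/
theorem exists_prev_of_lab (hm : m ∈ matchings k r) {w : Var k r} {p a : ℕ} {ϵ : Bool}
    (hw : lvl w = p + 1) (ha : 1 ≤ a) (hap : a < 2 ^ p)
    (h : lab A₁ m w = a + MPart.tShift (p + 1) ϵ) :
    ∃ u, m u = some w ∧ lvl u = p ∧ sgn A₁ u = ϵ ∧ lab A₁ m u = a := by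
  rw [tShift_succ] at h
  by_cases hex : ∃ u, m u = some w
  · obtain ⟨u, hu⟩ := hex
    have hl := lvl_of_eq_some hm hu
    have hlu : lvl u = p := by omega
    have hb := lab_pos_lt (A₁ := A₁) hm u
    have he := lab_of_eq_some (A₁ := A₁) hm hu
    rw [hw, tShift_succ] at he
    rw [hlu] at hb
    refine ⟨u, hu, hlu, ?_⟩
    rcases hs : sgn A₁ u <;> rcases ϵ <;> simp [hs] at he h ⊢ <;> omega
  · have he := lab_of_start (A₁ := A₁) (v := w) (fun u hu => hex ⟨u, hu⟩)
    rw [hw, Nat.add_sub_cancel] at he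
    rcases ϵ <;> simp at h <;> omega

end Labels

/-! ### The partitions attached to a matching -/

section Labelling

variable {k : ℕ} {r : ℕ → ℕ}

/-- The family of partitions attached to a matching. -/
noncomputable def labelling (A₁ : ℕ → Finset (Var k r)) (m : Var k r → Option (Var k r)) :
    MPart k r :=
  (fun v => if lvl v < k then (lab A₁ m v, (m v).isSome) else (0, false),
    fun v => if lvl v = k then (prev m v).map (fun u => (lab A₁ m u, sgn A₁ u)) else none)

/-- The sign of the last link of a chain, `true` if there is none. -/
noncomputable def linkSgn (A₁ : ℕ → Finset (Var k r)) (m : Var k r → Option (Var k r))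
    (v : Var k r) : Bool := (prev m v).elim true (sgn A₁)

variable {A₁ A₂ : ℕ → Finset (Var k r)} {m : Var k r → Option (Var k r)}

theorem labelling_fst (v : Var k r) : (labelling A₁ m).1 v =
    if lvl v < k then (lab A₁ m v, (m v).isSome) else (0, false) := rfl

theorem labelling_snd (v : Var k r) : (labelling A₁ m).2 v =
    if lvl v = k then (prev m v).map (fun u => (lab A₁ m u, sgn A₁ u)) else none := rfl

theorem mem_ite_iff (hdisj : ∀ s < k, Disjoint (A₁ s) (A₂ s))
    (hunion : ∀ s < k, A₁ s ∪ A₂ s = setA k r s) {p : ℕ} (hp : p < k) {ϵ : Bool} {v : Var k r} :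
    (v ∈ if ϵ then A₁ p else A₂ p) ↔ lvl v = p ∧ sgn A₁ v = ϵ := by
  have h1 : v ∈ A₁ p ∨ v ∈ A₂ p ↔ lvl v = p := by
    rw [← Finset.mem_union, hunion p hp, mem_setA]
  have h2 : v ∈ A₁ p → v ∉ A₂ p := fun h => Finset.disjoint_left.1 (hdisj p hp) h
  rcases ϵ with _ | _
  · simp only [Bool.false_eq_true, if_false, sgn, decide_eq_false_iff_not]
    constructor
    · intro h
      have hl := h1.1 (Or.inr h)
      exact ⟨hl, fun h' => h2 (hl ▸ h') h⟩
    · rintro ⟨hl, h⟩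
      exact (h1.2 hl).resolve_left (hl ▸ h)
  · simp only [if_true, sgn, decide_eq_true_eq]
    constructor
    · intro h
      have hl := h1.1 (Or.inl h)
      exact ⟨hl, hl ▸ h⟩
    · rintro ⟨hl, h⟩
      exact hl ▸ h

theorem mem_X_of (hdisj : ∀ s < k, Disjoint (A₁ s) (A₂ s))
    (hunion : ∀ s < k, A₁ s ∪ A₂ s = setA k r s) {P : MPart k r} {p : ℕ} (hp : p < k) {a : ℕ}
    {ϵ : Bool} {v : Var k r} :
    v ∈ MPart.X A₁ A₂ P p a ϵ ↔ (lvl v = p ∧ sgn A₁ v = ϵ) ∧ P.1 v = (a, true) := by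
  rw [MPart.X, Finset.mem_filter, mem_ite_iff hdisj hunion hp]

theorem mem_W_of (hdisj : ∀ s < k, Disjoint (A₁ s) (A₂ s))
    (hunion : ∀ s < k, A₁ s ∪ A₂ s = setA k r s) {P : MPart k r} {p : ℕ} (hp : p < k) {a : ℕ}
    {ϵ : Bool} {v : Var k r} :
    v ∈ MPart.W A₁ A₂ P p a ϵ ↔ (lvl v = p ∧ sgn A₁ v = ϵ) ∧ P.1 v = (a, false) := by
  rw [MPart.W, Finset.mem_filter, mem_ite_iff hdisj hunion hp]

theorem mem_XW_of (hdisj : ∀ s < k, Disjoint (A₁ s) (A₂ s))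
    (hunion : ∀ s < k, A₁ s ∪ A₂ s = setA k r s) {P : MPart k r} {p : ℕ} (hp : p < k) {j : ℕ}
    {v : Var k r} :
    v ∈ MPart.XW A₁ A₂ P p j ↔ lvl v = p ∧ (P.1 v).1 = j := by
  simp only [MPart.XW, Finset.mem_union, mem_X_of hdisj hunion hp, mem_W_of hdisj hunion hp,
    Prod.ext_iff]
  cases sgn A₁ v <;> cases (P.1 v).2 <;> simp

theorem mem_X (hdisj : ∀ s < k, Disjoint (A₁ s) (A₂ s))
    (hunion : ∀ s < k, A₁ s ∪ A₂ s = setA k r s) {p : ℕ} (hp : p < k) {a : ℕ}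
    {ϵ : Bool} {v : Var k r} :
    v ∈ MPart.X A₁ A₂ (labelling A₁ m) p a ϵ ↔
      lvl v = p ∧ sgn A₁ v = ϵ ∧ lab A₁ m v = a ∧ (m v).isSome := by
  rw [mem_X_of hdisj hunion hp, and_assoc]
  refine and_congr_right fun hl => ?_
  rw [labelling_fst, if_pos (hl ▸ hp), Prod.mk.injEq]

theorem mem_W (hdisj : ∀ s < k, Disjoint (A₁ s) (A₂ s))
    (hunion : ∀ s < k, A₁ s ∪ A₂ s = setA k r s) {p : ℕ} (hp : p < k) {a : ℕ}
    {ϵ : Bool} {v : Var k r} :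
    v ∈ MPart.W A₁ A₂ (labelling A₁ m) p a ϵ ↔
      lvl v = p ∧ sgn A₁ v = ϵ ∧ lab A₁ m v = a ∧ m v = none := by
  rw [mem_W_of hdisj hunion hp, and_assoc]
  refine and_congr_right fun hl => ?_
  rw [labelling_fst, if_pos (hl ▸ hp), Prod.mk.injEq, Option.isSome_eq_false_iff, Option.isNone_iff_eq_none]

theorem mem_XW (hdisj : ∀ s < k, Disjoint (A₁ s) (A₂ s))
    (hunion : ∀ s < k, A₁ s ∪ A₂ s = setA k r s) {p : ℕ} (hp : p < k) {j : ℕ} {v : Var k r} :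
    v ∈ MPart.XW A₁ A₂ (labelling A₁ m) p j ↔ lvl v = p ∧ lab A₁ m v = j := by
  rw [mem_XW_of hdisj hunion hp]
  refine and_congr_right fun hl => ?_
  rw [labelling_fst, if_pos (hl ▸ hp)]

theorem mem_E (hm : m ∈ matchings k r) {a : ℕ} {ϵ : Bool} {v : Var k r} :
    v ∈ MPart.E (labelling A₁ m) a ϵ ↔
      lvl v = k ∧ ∃ u, m u = some v ∧ lab A₁ m u = a ∧ sgn A₁ u = ϵ := by
  rw [MPart.E, Finset.mem_filter, mem_setA]
  refine and_congr_right fun hl => ?_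
  rw [labelling_snd, if_pos hl, Option.map_eq_some_iff]
  simp only [prev_eq_some hm, Prod.mk.injEq]

theorem mem_E0 {v : Var k r} :
    v ∈ MPart.E0 (labelling A₁ m) ↔ lvl v = k ∧ ∀ u, m u ≠ some v := by
  rw [MPart.E0, Finset.mem_filter, mem_setA]
  refine and_congr_right fun hl => ?_
  rw [labelling_snd, if_pos hl, Option.map_eq_none_iff, prev_eq_none]

/-- The set consists of the ends of the chains running from level a to level b - 1, sorted by the
sign of the end. -/
theorem mem_γ (hdisj : ∀ s < k, Disjoint (A₁ s) (A₂ s))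
    (hunion : ∀ s < k, A₁ s ∪ A₂ s = setA k r s) (hm : m ∈ matchings k r) {a b : ℕ} (ha : 1 ≤ a)
    (hab : a < b) (hb : b ≤ k) {ϵ : Bool} {v : Var k r} :
    v ∈ MPart.γ A₁ A₂ (labelling A₁ m) b a ϵ ↔
      lvl v = b - 1 ∧ sgn A₁ v = ϵ ∧ m v = none ∧ start m v = a := by
  simp only [MPart.γ, Finset.mem_biUnion, Finset.mem_range,
    mem_W hdisj hunion (show b - 1 < k by omega)]
  constructor
  · rintro ⟨s, hs, h1, h2, h3, h4⟩
    exact ⟨h1, h2, h4, (start_eq_iff hm ha (by omega)).1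
      ⟨s, by rwa [h1, show b - 1 - a = b - a - 1 by omega], h3⟩⟩
  · rintro ⟨h1, h2, h3, h4⟩
    obtain ⟨s, hs, h5⟩ := (start_eq_iff (A₁ := A₁) hm ha (by omega)).2 h4
    rw [h1, show b - 1 - a = b - a - 1 by omega] at hs
    exact ⟨s, hs, h1, h2, h5, h3⟩

theorem linkSgn_of_eq_some (hm : m ∈ matchings k r) {u v : Var k r} (h : m u = some v) :
    linkSgn A₁ m v = sgn A₁ u := by
  rw [linkSgn, (prev_eq_some hm).2 h]
  rfl

/-- An element of level k is indexed by its predecessor, whose starting level it shares. Without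
predecessor it starts at k itself and lies in E_0; the default sign `true` of `linkSgn` matches
Ξ_+^(k). -/
theorem mem_Ξ (hm : m ∈ matchings k r) {p : ℕ} (hp1 : 1 ≤ p) (hp : p ≤ k) {ϵ : Bool}
    {v : Var k r} :
    v ∈ MPart.Ξ (labelling A₁ m) p ϵ ↔ lvl v = k ∧ linkSgn A₁ m v = ϵ ∧ start m v = p := by
  unfold MPart.Ξ
  by_cases hex : ∃ u, m u = some v
  · obtain ⟨u, hu⟩ := hex
    have hl := lvl_of_eq_some hm hu
    have hb := start_bounds hm u
    rw [linkSgn_of_eq_some hm hu, start_of_eq_some hm hu]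
    split_ifs with h1 h2
    · rw [mem_E0]
      refine ⟨fun h => absurd hu (h.2 u), fun h => ?_⟩
      omega
    · simp only [Finset.notMem_empty, false_iff]
      intro h
      omega
    · simp only [Finset.mem_biUnion, Finset.mem_range, mem_E hm]
      constructor
      · rintro ⟨s, hs, hk, u', hu', h3, h4⟩
        obtain rfl := (mem_matchings.1 hm).2 _ _ _ hu hu'
        refine ⟨hk, h4, (start_eq_iff hm hp1 (by omega)).1
          ⟨s, by rwa [show lvl u - p = k - p - 1 by omega], h3⟩⟩
      · rintro ⟨hk, h3, h4⟩
        obtain ⟨s, hs, h5⟩ := (start_eq_iff (A₁ := A₁) hm hp1 (by omega)).2 h4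
        rw [show lvl u - p = k - p - 1 by omega] at hs
        exact ⟨s, hs, hk, u, hu, h5, h3⟩
  · have hex' : ∀ u, m u ≠ some v := fun u hu => hex ⟨u, hu⟩
    rw [start_of_start hex', linkSgn, prev_eq_none.2 hex', Option.elim_none]
    split_ifs with h1 h2
    · rw [mem_E0, h1, h2]
      exact ⟨fun h => ⟨h.1, rfl, h.1⟩, fun h => ⟨h.1, hex'⟩⟩
    · simp only [Finset.notMem_empty, false_iff]
      exact fun h => h2 h.2.1.symm
    · simp only [Finset.mem_biUnion, Finset.mem_range, mem_E hm]
      constructor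
      · rintro ⟨s, hs, hk, u', hu', -⟩
        exact absurd hu' (hex' u')
      · rintro ⟨hk, -, h4⟩
        omega

/-- The last label of a chain remembers its passage from level p to p + 1. A nonzero digit below
position p says that the chain was present at level p, and digit p is the sign with which it left.
-/
theorem chainEnd_mem_iff (hm : m ∈ matchings k r) {p : ℕ} {ϵ : Bool} {v : Var k r} :
    (m v = none ∧ p + 1 ≤ lvl v ∧ ∃ a ∈ Finset.Icc 1 (2 ^ p - 1),
      lab A₁ m v % 2 ^ (p + 1) = a + MPart.tShift (p + 1) ϵ) ↔
    ∃ u, lvl u = p ∧ sgn A₁ u = ϵ ∧ (m u).isSome ∧ chainEnd m u = v := by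
  constructor
  · rintro ⟨hv, hl, a, ha, h⟩
    rw [Finset.mem_Icc] at ha
    obtain ⟨w, h1, h2, h3⟩ := exists_ancestor (A₁ := A₁) hm hl (by omega)
    obtain ⟨u, h4, h5, h6, -⟩ := exists_prev_of_lab hm h1 ha.1 (by omega) (h3.trans h)
    exact ⟨u, h5, h6, by simp [h4], by
      rw [chainEnd_of_eq_some hm h4, h2, chainEnd_of_none hv]⟩
  · rintro ⟨u, h1, h2, h3, rfl⟩
    obtain ⟨w, hw⟩ := Option.isSome_iff_exists.1 h3
    have hl := lvl_of_eq_some hm hw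
    have hb := lab_pos_lt (A₁ := A₁) hm u
    rw [h1] at hb
    have hc := chainEnd_of_eq_some hm hw
    refine ⟨eq_none_chainEnd hm u, ?_, lab A₁ m u, ?_, ?_⟩
    · have := lvl_le_lvl_chainEnd hm w
      rw [hc]
      omega
    · rw [Finset.mem_Icc]
      omega
    · rw [hc, lab_chainEnd_mod hm (by omega), lab_of_eq_some hm hw, h2, hl, h1]
      apply Nat.mod_eq_of_lt
      rw [tShift_succ, pow_succ]
      split_ifs <;> omega

/-- The common form of the sets `C₁` and `D₁`. -/
theorem mem_transmitted (hdisj : ∀ s < k, Disjoint (A₁ s) (A₂ s))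
    (hunion : ∀ s < k, A₁ s ∪ A₂ s = setA k r s) (hm : m ∈ matchings k r) {p : ℕ}
    (hp : p < k - 1) {ϵ : Bool} {v : Var k r} :
    ((∃ ϵ', ∃ q, (p + 1 ≤ q ∧ q ≤ k - 1) ∧ ∃ a, (1 ≤ a ∧ a ≤ 2 ^ p - 1) ∧
        ∃ s < 2 ^ (q - p - 1), v ∈ MPart.W A₁ A₂ (labelling A₁ m) q
          (a + MPart.tShift (p + 1) ϵ + s * 2 ^ (p + 1)) ϵ') ∨
      (∃ ϵ', ∃ a, (1 ≤ a ∧ a ≤ 2 ^ p - 1) ∧ ∃ s < 2 ^ (k - p - 2),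
        v ∈ MPart.E (labelling A₁ m) (a + MPart.tShift (p + 1) ϵ + s * 2 ^ (p + 1)) ϵ')) ↔
    ∃ u, lvl u = p ∧ sgn A₁ u = ϵ ∧ (m u).isSome ∧ chainEnd m u = v := by
  rw [← chainEnd_mem_iff hm]
  have hlt : ∀ a, 1 ≤ a ∧ a ≤ 2 ^ p - 1 → a + MPart.tShift (p + 1) ϵ < 2 ^ (p + 1) := by
    intro a ha
    rw [tShift_succ, pow_succ]
    split_ifs <;> omega
  constructor
  · rintro (⟨ϵ', q, hq, a, ha, s, hs, hv⟩ | ⟨ϵ', a, ha, s, hs, hv⟩)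
    · rw [mem_W hdisj hunion (by omega)] at hv
      obtain ⟨h1, h2, h3, h4⟩ := hv
      refine ⟨h4, by omega, a, Finset.mem_Icc.2 ha, ?_⟩
      rw [h3, Nat.add_mul_mod_self_right, Nat.mod_eq_of_lt (hlt a ha)]
    · rw [mem_E hm] at hv
      obtain ⟨h1, u, h2, h3, h4⟩ := hv
      have hl := lvl_of_eq_some hm h2
      refine ⟨eq_none_of_lvl_eq hm h1, by omega, a, Finset.mem_Icc.2 ha, ?_⟩
      rw [lab_mod hm h2 (by omega), h3, Nat.add_mul_mod_self_right, Nat.mod_eq_of_lt (hlt a ha)]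
  · rintro ⟨h1, h2, a, ha, h3⟩
    rw [Finset.mem_Icc] at ha
    -- Chains stopping below level k end in some W; those reaching level k end in some E, indexed by
    -- the label of the predecessor.
    rcases (lvl_le v).lt_or_eq with hv | hv
    · left
      obtain ⟨s, hs, h4⟩ := (exists_lt_eq_add_mul (lab_pos_lt hm v).2 h2 (hlt a ha)).2 h3
      refine ⟨sgn A₁ v, lvl v, by omega, a, ha, s, by rwa [Nat.sub_sub], ?_⟩
      rw [mem_W hdisj hunion hv]
      exact ⟨rfl, rfl, h4, h1⟩
    · right
      by_cases hex : ∃ u, m u = some v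
      · obtain ⟨u, hu⟩ := hex
        have hl := lvl_of_eq_some hm hu
        rw [lab_mod hm hu (by omega)] at h3
        obtain ⟨s, hs, h4⟩ := (exists_lt_eq_add_mul (lab_pos_lt hm u).2 (by omega) (hlt a ha)).2 h3
        refine ⟨sgn A₁ u, a, ha, s, by rwa [show k - p - 2 = lvl u - (p + 1) by omega], ?_⟩
        rw [mem_E hm]
        exact ⟨hv, u, hu, h4, rfl⟩
      -- A chain starting at level k has label 2^(k-1), which vanishes modulo 2^(p+1).
      · exfalso
        rw [lab_of_start fun u hu => hex ⟨u, hu⟩,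
          Nat.mod_eq_zero_of_dvd (pow_dvd_pow 2 (by omega))] at h3
        omega

/-- For the last link the indices of E are exactly the label and sign of the source, so no
congruence is needed. -/
theorem mem_transmitted_last (hm : m ∈ matchings k r) (hk : 1 ≤ k) {ϵ : Bool} {v : Var k r} :
    (∃ a, (1 ≤ a ∧ a ≤ 2 ^ (k - 1) - 1) ∧ lvl v = k ∧ ∃ u, m u = some v ∧ lab A₁ m u = a ∧
      sgn A₁ u = ϵ) ↔
    ∃ u, lvl u = k - 1 ∧ sgn A₁ u = ϵ ∧ (m u).isSome ∧ chainEnd m u = v := by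
  constructor
  · rintro ⟨a, -, h1, u, h2, -, h4⟩
    have hl := lvl_of_eq_some hm h2
    exact ⟨u, by omega, h4, by simp [h2], by
      rw [chainEnd_of_eq_some hm h2, chainEnd_of_none (eq_none_of_lvl_eq hm h1)]⟩
  · rintro ⟨u, h1, h2, h3, rfl⟩
    obtain ⟨w, hw⟩ := Option.isSome_iff_exists.1 h3
    have hl := lvl_of_eq_some hm hw
    have hlw : lvl w = k := by omega
    have hb := lab_pos_lt (A₁ := A₁) hm u
    rw [h1] at hb
    rw [chainEnd_of_eq_some hm hw, chainEnd_of_none (eq_none_of_lvl_eq hm hlw)]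
    exact ⟨lab A₁ m u, by omega, hlw, u, hw, rfl, h2⟩

/-- Identifies this set with the matched part of `A₁ p`, each variable being represented by the end
of its chain. -/
theorem mem_C1 (hdisj : ∀ s < k, Disjoint (A₁ s) (A₂ s))
    (hunion : ∀ s < k, A₁ s ∪ A₂ s = setA k r s) (hm : m ∈ matchings k r) {p : ℕ}
    (hk : 1 ≤ k) (hp : p ≤ k - 1) {v : Var k r} :
    v ∈ MPart.C1 A₁ A₂ (labelling A₁ m) p ↔
    ∃ u, lvl u = p ∧ sgn A₁ u = true ∧ (m u).isSome ∧ chainEnd m u = v := by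
  rcases eq_or_lt_of_le hp with rfl | hp
  · rw [← mem_transmitted_last hm hk]
    simp only [MPart.C1, if_true, Finset.mem_biUnion, mem_E hm, Finset.mem_Icc]
  · rw [← mem_transmitted hdisj hunion hm hp]
    simp only [MPart.C1, if_neg hp.ne, Finset.mem_union, Finset.mem_biUnion, Finset.mem_univ,
      true_and, Finset.mem_Icc, Finset.mem_range, tShift_succ, if_true, add_zero]

theorem mem_D1 (hdisj : ∀ s < k, Disjoint (A₁ s) (A₂ s))
    (hunion : ∀ s < k, A₁ s ∪ A₂ s = setA k r s) (hm : m ∈ matchings k r) {p : ℕ}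
    (hk : 1 ≤ k) (hp : p ≤ k - 1) {v : Var k r} :
    v ∈ MPart.D1 A₁ A₂ (labelling A₁ m) p ↔
    ∃ u, lvl u = p ∧ sgn A₁ u = false ∧ (m u).isSome ∧ chainEnd m u = v := by
  rcases eq_or_lt_of_le hp with rfl | hp
  · rw [← mem_transmitted_last hm hk]
    simp only [MPart.D1, if_true, Finset.mem_biUnion, mem_E hm, Finset.mem_Icc]
  -- The odd multiples of 2^p are those whose digit at position p is 1, that is, sign -.
  · have e : ∀ a s, a + (2 * s + 1) * 2 ^ p = a + 2 ^ p + s * 2 ^ (p + 1) := fun a s => by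
      rw [pow_succ]
      ring
    rw [← mem_transmitted hdisj hunion hm hp]
    simp only [MPart.D1, if_neg hp.ne, Finset.mem_union, Finset.mem_biUnion, Finset.mem_univ,
      true_and, Finset.mem_Icc, Finset.mem_range, tShift_succ, Bool.false_eq_true, if_false, e]

end Labelling

/-! ### The master sum as a sum over matchings -/

section Master

variable {k : ℕ} {r : ℕ → ℕ} {A₁ A₂ : ℕ → Finset (Var k r)} {m : Var k r → Option (Var k r)}

theorem sum_vecPerm_pi {κ ι M : Type*} [Fintype κ] [DecidableEq κ] [LinearOrder ι]
    [AddCommMonoid M] (C : κ → Finset ι) (F : (κ → List ι) → M) :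
    ∑ σ : (q : κ) → Equiv.Perm (Fin (C q).card), F (fun q => vecPerm (C q) (σ q)) =
      ∑ L ∈ Fintype.piFinset (fun q => orderings (C q)), F L := by
  refine Finset.sum_bij (fun σ _ => fun q => vecPerm (C q) (σ q)) ?_ ?_ ?_ ?_
  · intro σ _
    rw [Fintype.mem_piFinset]
    exact fun q => Finset.mem_image_of_mem _ (Finset.mem_univ _)
  · intro σ _ τ _ h
    funext q
    exact vecPerm_injective _ (congrFun h q)
  · intro L hL
    rw [Fintype.mem_piFinset] at hL
    have : ∀ q, ∃ σ, vecPerm (C q) σ = L q := fun q => by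
      obtain ⟨σ, -, h⟩ := Finset.mem_image.1 (hL q)
      exact ⟨σ, h⟩
    choose σ hσ using this
    exact ⟨σ, Finset.mem_univ _, funext hσ⟩
  · intro σ _
    rfl

/-- The set of the partners of the elements of `X_{a,ϵ}^{(p)}`. -/
def target (A₁ A₂ : ℕ → Finset (Var k r)) (P : MPart k r) (p a : ℕ) (ϵ : Bool) :
    Finset (Var k r) :=
  if p = k - 1 then MPart.E P a ϵ else MPart.XW A₁ A₂ P (p + 1) (a + MPart.tShift (p + 1) ϵ)

theorem mem_idx {p a : ℕ} {ϵ : Bool} : (a, ϵ) ∈ MPart.idx p ↔ 1 ≤ a ∧ a ≤ 2 ^ p - 1 := by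
  simp [MPart.idx]

theorem mem_permIdx {p a : ℕ} {ϵ : Bool} :
    (⟨p, (a, ϵ)⟩ : Σ _ : ℕ, ℕ × Bool) ∈ MPart.permIdx k ↔
      (2 ≤ p ∧ p ≤ k - 1) ∧ 1 ≤ a ∧ a ≤ 2 ^ (p - 1) - 1 := by
  simp only [MPart.permIdx, Finset.mem_sigma, Finset.mem_Icc, mem_idx]

theorem one_le_of_mem_idx {p a : ℕ} {ϵ : Bool} (h : (a, ϵ) ∈ MPart.idx p) : 1 ≤ p := by
  rw [mem_idx] at h
  rcases p with _ | p
  · simp at h; omega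
  · omega

/-- Through `target`, the two families of cardinality constraints, at inner levels and at the top
one, take a single form. -/
theorem mem_all {P : MPart k r} : P ∈ MPart.all A₁ A₂ ↔
    ((∀ v, P.1 v ∈ if lvl v < k then MPart.idx (lvl v) else {(0, false)}) ∧
      ∀ v, P.2 v ∈ if lvl v = k then Finset.insertNone (MPart.idx (k - 1)) else {none}) ∧
    ∀ p < k, ∀ a ϵ, (a, ϵ) ∈ MPart.idx p →
      (MPart.X A₁ A₂ P p a ϵ).card = (target A₁ A₂ P p a ϵ).card := by
  unfold MPart.all
  simp only [Finset.mem_filter, Finset.mem_product, Fintype.mem_piFinset]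
  refine and_congr_right fun _ => ?_
  constructor
  · rintro ⟨h1, h2⟩ p hp a ϵ he
    unfold target
    split_ifs with hpk
    · subst hpk
      exact h2 (a, ϵ) he
    · have := one_le_of_mem_idx he
      exact h1 (p + 1) (Finset.mem_Icc.2 (by omega)) (a, ϵ) he
  · intro h
    refine ⟨fun p hp e he => ?_, fun e he => ?_⟩
    · rw [Finset.mem_Icc] at hp
      have := h (p - 1) (by omega) e.1 e.2 he
      rwa [target, if_neg (by omega), Nat.sub_add_cancel (by omega)] at this
    · have h1 := one_le_of_mem_idx he
      have := h (k - 1) (by omega) e.1 e.2 he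
      rwa [target, if_pos rfl] at this

/-- A link adds the sign shift to the label, so partners land in the target. Conversely, a label
with nonzero remainder modulo 2^p forces a predecessor (`exists_prev_of_lab`). -/
theorem image_step_X (hdisj : ∀ s < k, Disjoint (A₁ s) (A₂ s))
    (hunion : ∀ s < k, A₁ s ∪ A₂ s = setA k r s) (hm : m ∈ matchings k r) {p a : ℕ} (hp : p < k)
    {ϵ : Bool} (ha : (a, ϵ) ∈ MPart.idx p) :
    (MPart.X A₁ A₂ (labelling A₁ m) p a ϵ).image (step m) =
      target A₁ A₂ (labelling A₁ m) p a ϵ := by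
  have h1 := one_le_of_mem_idx ha
  rw [mem_idx] at ha
  have hl : ∀ u w, m u = some w → step m u = w := fun u w h => by simp [step, h]
  ext w
  rw [Finset.mem_image]
  unfold target
  split_ifs with hpk
  · rw [mem_E hm]
    constructor
    · rintro ⟨u, hu, rfl⟩
      obtain ⟨h2, h3, h4, h5⟩ := (mem_X hdisj hunion hp).1 hu
      have h6 := eq_some_step h5
      have := lvl_of_eq_some hm h6
      exact ⟨by omega, u, h6, h4, h3⟩
    · rintro ⟨h2, u, h3, h4, h5⟩
      have := lvl_of_eq_some hm h3
      exact ⟨u, (mem_X hdisj hunion hp).2 ⟨by omega, h5, h4, by simp [h3]⟩, hl u w h3⟩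
  · rw [mem_XW hdisj hunion (by omega)]
    constructor
    · rintro ⟨u, hu, rfl⟩
      obtain ⟨h2, h3, h4, h5⟩ := (mem_X hdisj hunion hp).1 hu
      have h6 := eq_some_step h5
      have h7 := lvl_of_eq_some hm h6
      refine ⟨by omega, ?_⟩
      rw [lab_of_eq_some hm h6, h4, h3, h7, h2]
    · rintro ⟨h2, h3⟩
      obtain ⟨u, h4, h5, h6, h7⟩ := exists_prev_of_lab hm h2 ha.1 (by omega) h3
      exact ⟨u, (mem_X hdisj hunion hp).2 ⟨h5, h6, h7, by simp [h4]⟩, hl u w h4⟩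

theorem map_step_X_isOrdering (hdisj : ∀ s < k, Disjoint (A₁ s) (A₂ s))
    (hunion : ∀ s < k, A₁ s ∪ A₂ s = setA k r s) (hm : m ∈ matchings k r) {p a : ℕ} (hp : p < k)
    {ϵ : Bool} (ha : (a, ϵ) ∈ MPart.idx p) :
    IsOrdering ((vec (MPart.X A₁ A₂ (labelling A₁ m) p a ϵ)).map (step m))
      (target A₁ A₂ (labelling A₁ m) p a ϵ) := by
  have h := map_step_isOrdering (mem_matchings.1 hm).2
    (C := MPart.X A₁ A₂ (labelling A₁ m) p a ϵ)
    (fun v hv => ((mem_X hdisj hunion hp).1 hv).2.2.2)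
  refine ⟨h.1, h.2.trans ?_⟩
  rw [← image_step_X hdisj hunion hm hp ha]
  ext v
  simp

theorem labelling_mem_all (hdisj : ∀ s < k, Disjoint (A₁ s) (A₂ s))
    (hunion : ∀ s < k, A₁ s ∪ A₂ s = setA k r s) (hm : m ∈ matchings k r) :
    labelling A₁ m ∈ MPart.all A₁ A₂ := by
  refine mem_all.2 ⟨⟨fun v => ?_, fun v => ?_⟩, fun p hp a ϵ ha => ?_⟩
  · rw [labelling_fst]
    split_ifs with h
    · rw [mem_idx]
      have := lab_pos_lt (A₁ := A₁) hm v
      omega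
    · simp
  · rw [labelling_snd]
    split_ifs with h
    · rw [Finset.mem_insertNone]
      rintro ⟨a, ϵ⟩ h1
      rw [Option.mem_def, Option.map_eq_some_iff] at h1
      obtain ⟨u, h2, h3⟩ := h1
      rw [prev_eq_some hm] at h2
      rw [Prod.mk.injEq] at h3
      have h4 := lvl_of_eq_some hm h2
      have h5 := lab_pos_lt (A₁ := A₁) hm u
      rw [show lvl u = k - 1 by omega] at h5
      rw [mem_idx]
      omega
    · simp
  · have h := map_step_X_isOrdering hdisj hunion hm hp ha
    rw [← h.length_eq, List.length_map, length_vec]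

/-- The partitions tell which variables are matched; the lists of partners tell with whom. -/
theorem labelling_injective (hdisj : ∀ s < k, Disjoint (A₁ s) (A₂ s))
    (hunion : ∀ s < k, A₁ s ∪ A₂ s = setA k r s) {m' : Var k r → Option (Var k r)}
    (hm : m ∈ matchings k r) (hm' : m' ∈ matchings k r) (h : labelling A₁ m = labelling A₁ m')
    (hL : ∀ p < k, ∀ a ϵ, (a, ϵ) ∈ MPart.idx p →
      (vec (MPart.X A₁ A₂ (labelling A₁ m) p a ϵ)).map (step m) =
        (vec (MPart.X A₁ A₂ (labelling A₁ m) p a ϵ)).map (step m')) : m = m' := by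
  funext v
  rcases (lvl_le v).lt_or_eq with hv | hv
  · have h1 := congrFun (congrArg Prod.fst h) v
    rw [labelling_fst, labelling_fst, if_pos hv, if_pos hv, Prod.mk.injEq] at h1
    by_cases hs : (m v).isSome
    · have hb := lab_pos_lt (A₁ := A₁) hm v
      have h2 := List.map_inj_left.1 (hL (lvl v) hv (lab A₁ m v) (sgn A₁ v)
        (mem_idx.2 (by omega))) v (mem_vec.2 ((mem_X hdisj hunion hv).2 ⟨rfl, rfl, rfl, hs⟩))
      have hs' : (m' v).isSome := by rw [← h1.2]; exact hs
      rw [eq_some_step hs, eq_some_step hs', h2]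
    · have hs' := hs
      rw [h1.2] at hs'
      rw [Option.not_isSome_iff_eq_none] at hs hs'
      rw [hs, hs']
  · rw [eq_none_of_lvl_eq hm hv, eq_none_of_lvl_eq hm' hv]

theorem lvl_of_mem_target (hdisj : ∀ s < k, Disjoint (A₁ s) (A₂ s))
    (hunion : ∀ s < k, A₁ s ∪ A₂ s = setA k r s) {P : MPart k r} {p a : ℕ} {ϵ : Bool}
    (hp : p < k) {w : Var k r} :
    w ∈ target A₁ A₂ P p a ϵ ↔ lvl w = p + 1 ∧
      (lvl w < k → (P.1 w).1 = a + MPart.tShift (p + 1) ϵ) ∧ (lvl w = k → P.2 w = some (a, ϵ)) := by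
  unfold target
  split_ifs with hpk
  · rw [MPart.E, Finset.mem_filter, mem_setA]
    constructor
    · rintro ⟨h1, h2⟩
      exact ⟨by omega, fun h => by omega, fun _ => h2⟩
    · rintro ⟨h1, h2, h3⟩
      have : lvl w = k := by omega
      exact ⟨this, h3 this⟩
  · rw [mem_XW_of hdisj hunion (by omega)]
    constructor
    · rintro ⟨h1, h2⟩
      exact ⟨h1, fun _ => h2, fun h => by omega⟩
    · rintro ⟨h1, h2, h3⟩
      exact ⟨h1, h2 (by omega)⟩

/-- Every family of partitions and orderings comes from a matching. -/
theorem exists_matching (hdisj : ∀ s < k, Disjoint (A₁ s) (A₂ s))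
    (hunion : ∀ s < k, A₁ s ∪ A₂ s = setA k r s) {P : MPart k r} (hP : P ∈ MPart.all A₁ A₂)
    (L : ℕ → ℕ → Bool → List (Var k r))
    (hL : ∀ p < k, ∀ a ϵ, (a, ϵ) ∈ MPart.idx p → IsOrdering (L p a ϵ) (target A₁ A₂ P p a ϵ)) :
    ∃ m ∈ matchings k r, labelling A₁ m = P ∧ ∀ p < k, ∀ a ϵ, (a, ϵ) ∈ MPart.idx p →
      (vec (MPart.X A₁ A₂ P p a ϵ)).map (step m) = L p a ϵ := by
  obtain ⟨⟨hP1, hP2⟩, hc⟩ := mem_all.1 hP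
  have hlen : ∀ p < k, ∀ a ϵ, (a, ϵ) ∈ MPart.idx p →
      (vec (MPart.X A₁ A₂ P p a ϵ)).length = (L p a ϵ).length := fun p hp a ϵ h => by
    rw [length_vec, (hL p hp a ϵ h).length_eq, hc p hp a ϵ h]
  have hidx : ∀ v ϵ, lvl v < k → ((P.1 v).1, ϵ) ∈ MPart.idx (lvl v) := fun v ϵ hv => by
    have := hP1 v
    rw [if_pos hv] at this
    exact mem_idx.2 (mem_idx (ϵ := (P.1 v).2).1 this)
  have htgt := fun {p a : ℕ} {ϵ : Bool} (hp : p < k) {w : Var k r} =>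
    lvl_of_mem_target (P := P) (a := a) (ϵ := ϵ) hdisj hunion hp (w := w)
  -- Each X is matched position by position with the prescribed ordering of its target.
  set m : Var k r → Option (Var k r) := fun v =>
    if lvl v < k ∧ (P.1 v).2 = true then
      matchOf (vec (MPart.X A₁ A₂ P (lvl v) (P.1 v).1 (sgn A₁ v)))
        (L (lvl v) (P.1 v).1 (sgn A₁ v)) v else none with hmdef
  have hmX : ∀ p < k, ∀ a ϵ, ∀ v ∈ MPart.X A₁ A₂ P p a ϵ,
      m v = matchOf (vec (MPart.X A₁ A₂ P p a ϵ)) (L p a ϵ) v := by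
    intro p hp a ϵ v hv
    obtain ⟨⟨rfl, rfl⟩, h⟩ := (mem_X_of hdisj hunion hp).1 hv
    simp only [hmdef]
    rw [if_pos ⟨hp, by rw [h]⟩, h]
  have hsome : ∀ v w, m v = some w → lvl v < k ∧
      v ∈ MPart.X A₁ A₂ P (lvl v) (P.1 v).1 (sgn A₁ v) ∧
      w ∈ target A₁ A₂ P (lvl v) (P.1 v).1 (sgn A₁ v) := by
    intro v w h
    simp only [hmdef] at h
    split_ifs at h with hv
    refine ⟨hv.1, (mem_X_of hdisj hunion hv.1).2 ⟨⟨rfl, rfl⟩, Prod.ext rfl hv.2⟩, ?_⟩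
    exact (hL _ hv.1 _ _ (hidx v _ hv.1)).mem_iff.1 (mem_of_matchOf h)
  have hmm : m ∈ matchings k r := by
    refine mem_matchings.2 ⟨fun v w h => ?_, fun v v' w h h' => ?_⟩
    · obtain ⟨h1, -, h3⟩ := hsome v w h
      exact ((htgt h1).1 h3).1
    · obtain ⟨h1, h2, h3⟩ := hsome v w h
      obtain ⟨h1', h2', h3'⟩ := hsome v' w h'
      obtain ⟨a1, a2, a3⟩ := (htgt h1).1 h3
      obtain ⟨b1, b2, b3⟩ := (htgt h1').1 h3'
      have hl : lvl v' = lvl v := by omega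
      have i1 := mem_idx.1 (hidx v true h1)
      have i2 := mem_idx.1 (hidx v' true h1')
      -- Different blocks X have disjoint targets: for 1 ≤ a < 2^p, the number a plus 0 or 2^p
      -- determines both a and the sign. At the top level, E records both.
      have hab : (P.1 v').1 = (P.1 v).1 ∧ sgn A₁ v' = sgn A₁ v := by
        rcases (lvl_le w).lt_or_eq with hw | hw
        · have e1 := a2 hw
          rw [hl] at i2
          clear_value m
          rw [hl] at b2
          have e2 := b2 hw
          rw [tShift_succ] at e1 e2
          clear a2 a3 b2 b3 hmX hsome h h' h2 h2' h3 h3' 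
          generalize sgn A₁ v = s at e1 ⊢
          generalize sgn A₁ v' = s' at e2 ⊢
          cases s <;> cases s' <;> simp at e1 e2 ⊢ <;> omega
        · have e := (a3 hw).symm.trans (b3 hw)
          rw [Option.some.injEq, Prod.mk.injEq] at e
          exact ⟨e.1.symm, e.2.symm⟩
      rw [hl, hab.1, hab.2] at h2'
      rw [hmX _ h1 _ _ v h2] at h
      rw [hmX _ h1 _ _ v' h2'] at h'
      have hi := hidx v (sgn A₁ v) h1
      exact matchOf_injective (hlen _ h1 _ _ hi) (hL _ h1 _ _ hi).1 h h'
  have hsurj : ∀ p < k, ∀ a ϵ, (a, ϵ) ∈ MPart.idx p → ∀ w ∈ target A₁ A₂ P p a ϵ,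
      ∃ u ∈ MPart.X A₁ A₂ P p a ϵ, m u = some w := by
    intro p hp a ϵ ha w hw
    obtain ⟨u, hu, h⟩ := exists_matchOf_eq (hlen p hp a ϵ ha)
      ((hL p hp a ϵ ha).mem_iff.2 hw) (vec_nodup _)
    rw [mem_vec] at hu
    exact ⟨u, hu, (hmX p hp a ϵ u hu).trans h⟩
  -- The labels computed from `m` are the prescribed ones. At a start, any label other than 2^(lvl -
  -- 1) would put the variable in a target, hence give it a predecessor.
  have hlab : ∀ v, lvl v < k → lab A₁ m v = (P.1 v).1 := by
    intro v
    refine chain_induction hmm (fun v h => ?_) (fun u v h ih => ?_) v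
    · intro hv
      rw [lab_of_start h]
      by_contra hne
      have hi := mem_idx.1 (hidx v true hv)
      obtain ⟨n, hn⟩ : ∃ n, lvl v = n + 1 := ⟨lvl v - 1, by have := one_le_lvl v; omega⟩
      rw [hn, pow_succ] at hi
      rw [hn, Nat.add_sub_cancel] at hne
      obtain ⟨a, ϵ, ha, he⟩ : ∃ a ϵ, (1 ≤ a ∧ a ≤ 2 ^ n - 1) ∧
          (P.1 v).1 = a + MPart.tShift (n + 1) ϵ := by
        simp only [tShift_succ]
        rcases lt_or_gt_of_ne hne with h1 | h1
        · exact ⟨(P.1 v).1 - 2 ^ n, false, by omega, by simp; omega⟩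
        · exact ⟨(P.1 v).1, true, by omega, by simp⟩
      obtain ⟨u, -, hu⟩ := hsurj n (by omega) a ϵ (mem_idx.2 ha) v
        ((htgt (by omega)).2 ⟨hn, fun _ => he, fun h => by omega⟩)
      exact h u hu
    · intro hv
      have hl := lvl_of_eq_some hmm h
      obtain ⟨h1, h2, h3⟩ := hsome u v h
      rw [lab_of_eq_some hmm h, ih h1, ((htgt h1).1 h3).2.1 hv, hl]
  refine ⟨m, hmm, ?_, ?_⟩
  · refine Prod.ext (funext fun v => ?_) (funext fun v => ?_)
    · rw [labelling_fst]
      split_ifs with hv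
      · refine Prod.ext (hlab v hv) ?_
        change (m v).isSome = (P.1 v).2
        rw [Bool.eq_iff_iff]
        constructor
        · intro h
          obtain ⟨w, hw⟩ := Option.isSome_iff_exists.1 h
          have := ((mem_X_of hdisj hunion hv).1 (hsome v w hw).2.1).2
          rw [this]
        · intro h
          have hX : v ∈ MPart.X A₁ A₂ P (lvl v) (P.1 v).1 (sgn A₁ v) :=
            (mem_X_of hdisj hunion hv).2 ⟨⟨rfl, rfl⟩, Prod.ext rfl h⟩
          rw [hmX _ hv _ _ v hX, matchOf_isSome (hlen _ hv _ _ (hidx v _ hv)), mem_vec]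
          exact hX
      · have := hP1 v
        rw [if_neg hv, Finset.mem_singleton] at this
        exact this.symm
    · rw [labelling_snd]
      have h2 := hP2 v
      split_ifs with hv
      · rw [if_pos hv, Finset.mem_insertNone] at h2
        rcases he : P.2 v with _ | ⟨a, ϵ⟩
        · rw [Option.map_eq_none_iff, prev_eq_none]
          intro u hu
          obtain ⟨h3, -, h4⟩ := hsome u v hu
          rw [((htgt h3).1 h4).2.2 hv] at he
          exact absurd he (by simp)
        · have hi := h2 (a, ϵ) he
          have h1 := one_le_of_mem_idx hi
          have hk : k - 1 < k := by omega
          obtain ⟨u, hu, h3⟩ := hsurj (k - 1) hk a ϵ hi v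
            ((htgt hk).2 ⟨by omega, fun h => by omega, fun _ => he⟩)
          obtain ⟨⟨h4, h5⟩, h6⟩ := (mem_X_of hdisj hunion hk).1 hu
          rw [(prev_eq_some hmm).2 h3, Option.map_some, hlab u (by omega), h6, h5]
      · rw [if_neg hv, Finset.mem_singleton] at h2
        exact h2.symm
  · intro p hp a ϵ ha
    rw [← map_step_matchOf (hlen p hp a ϵ ha) (vec_nodup _)]
    refine List.map_congr_left fun v hv => ?_
    rw [step, hmX p hp a ϵ v (mem_vec.1 hv)]
    rfl

theorem prod_diracTerm_level (hdisj : ∀ s < k, Disjoint (A₁ s) (A₂ s))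
    (hunion : ∀ s < k, A₁ s ∪ A₂ s = setA k r s) (hm : m ∈ matchings k r) {p : ℕ} (hp : p < k) :
    ∏ v ∈ setA k r p, diracTerm m v =
      ∏ e ∈ MPart.idx p, ∏ v ∈ MPart.X A₁ A₂ (labelling A₁ m) p e.1 e.2, diracTerm m v := by
  rw [← Finset.prod_filter_mul_prod_filter_not (setA k r p) (fun v => (m v).isSome)]
  have h1 : ∏ v ∈ (setA k r p).filter (fun v => ¬ (m v).isSome), diracTerm m v = 1 := by
    refine Finset.prod_eq_one fun v hv => ?_
    have hv := (Finset.mem_filter.1 hv).2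
    rw [Option.not_isSome_iff_eq_none] at hv
    rw [diracTerm, hv]
    rfl
  rw [h1, mul_one, ← Finset.prod_fiberwise_of_maps_to (t := MPart.idx p)
    (g := fun v => (lab A₁ m v, sgn A₁ v))]
  · refine Finset.prod_congr rfl fun e _ => Finset.prod_congr ?_ fun _ _ => rfl
    ext v
    rw [mem_X hdisj hunion hp, Finset.mem_filter, Finset.mem_filter, mem_setA, Prod.ext_iff]
    tauto
  · intro v hv
    have hl := mem_setA.1 (Finset.mem_filter.1 hv).1
    have := lab_pos_lt (A₁ := A₁) hm v
    rw [hl] at this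
    rw [mem_idx]
    omega

/-- Separates the level k - 1, whose targets are the E, from the inner levels, whose targets carry
the permutations σ; level 0 is trivial. -/
theorem prod_shift_split {M : Type*} [CommMonoid M] (f : ℕ → M) (h0 : f 0 = 1) {k : ℕ}
    (hk : 1 ≤ k) :
    ∏ p ∈ Finset.Icc 1 k, f (p - 1) = f (k - 1) * ∏ p ∈ Finset.Icc 2 (k - 1), f (p - 1) := by
  obtain ⟨n, rfl⟩ : ∃ n, k = n + 1 := ⟨k - 1, by omega⟩
  have h1 : ∏ p ∈ Finset.Icc 1 (n + 1), f (p - 1) = ∏ j ∈ Finset.range (n + 1), f j := by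
    refine Finset.prod_nbij' (· - 1) (· + 1) ?_ ?_ ?_ ?_ ?_ <;> intro p hp <;>
      simp only [Finset.mem_Icc, Finset.mem_range] at hp ⊢ <;> omega
  have h2 : ∏ p ∈ Finset.Icc 2 (n + 1 - 1), f (p - 1) = ∏ j ∈ (Finset.range n).erase 0, f j := by
    refine Finset.prod_nbij' (· - 1) (· + 1) ?_ ?_ ?_ ?_ ?_ <;> intro p hp <;>
      simp only [Finset.mem_Icc, Finset.mem_erase, Finset.mem_range] at hp ⊢ <;> omega
  rw [h1, h2, Finset.prod_erase _ h0, Finset.prod_range_succ, Nat.add_sub_cancel, mul_comm]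

/-- The coefficient of the master sum on the Dirac masses of a family of partitions. -/
noncomputable def masterCoef {g : ℝ} (mass : ℝ) (O : ℕ → LocalOperator g) (ε ε' : ℕ → ℝ)
    (A₁ A₂ : ℕ → Finset (Var k r)) (G : SchwartzMap (Lvl k → ℝ × ℝ) ℂ)
    (c d : MPart k r → ℕ → List (Var k r)) (P : MPart k r) (x : Config k r) : ℂ :=
  (∏ s ∈ Finset.Icc 1 (k - 1),
      Complex.exp (-2 * Complex.I * Real.pi * (O (s + 1)).ω * (A₁ s).card)) *
  (MPart.sTot A₁ A₂ P g (c P) (d P) x *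
      (∏ p ∈ Finset.Icc 1 k,
        shiftedFF (O p) (ε p) (ε' p) x
          (MPart.γRowRev A₁ A₂ P p true) (MPart.centralVec A₁ A₂ P p)
          (MPart.γRowRev A₁ A₂ P p false)) *
      smear G (MPart.phaseGlob A₁ A₂ P mass x))

-- The partition, permutation and ordering data are precisely the labelling of a matching with its
-- lists of partners. Surjectivity is `exists_matching`, injectivity is `labelling_injective`.
open MPart in
theorem masterSum_eq_sum_matchings {g : ℝ} (mass : ℝ) (hk : 1 ≤ k) (O : ℕ → LocalOperator g)
    (ε ε' : ℕ → ℝ) (hdisj : ∀ s < k, Disjoint (A₁ s) (A₂ s))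
    (hunion : ∀ s < k, A₁ s ∪ A₂ s = setA k r s) (G : SchwartzMap (Lvl k → ℝ × ℝ) ℂ)
    (c d : MPart k r → ℕ → List (Var k r)) :
    masterSum mass O ε ε' A₁ A₂ G c d = ∑ m ∈ matchings k r, (∏ v, diracTerm m v) *
      fn (masterCoef mass O ε ε' A₁ A₂ G c d (labelling A₁ m)) := by
  unfold masterSum
  set T : MPart k r → Config k r → ℂ := fun P x =>
      sTot A₁ A₂ P g (c P) (d P) x *
      (∏ p ∈ Finset.Icc 1 k,
        shiftedFF (O p) (ε p) (ε' p) x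
          (γRowRev A₁ A₂ P p true) (centralVec A₁ A₂ P p) (γRowRev A₁ A₂ P p false)) *
      smear G (phaseGlob A₁ A₂ P mass x) with hT
  have e1 : ∀ P : MPart k r,
      (∑ σ : (q : ↥(permIdx k)) →
      Equiv.Perm (Fin (XW A₁ A₂ P q.1.1 (q.1.2.1 + tShift q.1.1 q.1.2.2)).card),
      ∑ τ : (e : ↥(idx (k - 1))) → Equiv.Perm (Fin (E P e.1.1 e.1.2).card),
    (∏ e : ↥(idx (k - 1)),
      Delta (vec (X A₁ A₂ P (k - 1) e.1.1 e.1.2)) (vecPerm (E P e.1.1 e.1.2) (τ e))) *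
    (∏ q : ↥(permIdx k),
      Delta (vec (X A₁ A₂ P (q.1.1 - 1) q.1.2.1 q.1.2.2))
        (vecPerm (XW A₁ A₂ P q.1.1 (q.1.2.1 + tShift q.1.1 q.1.2.2)) (σ q))) * fn (T P)) =
      ∑ L ∈ Fintype.piFinset (fun q : ↥(permIdx k) =>
        orderings (XW A₁ A₂ P q.1.1 (q.1.2.1 + tShift q.1.1 q.1.2.2))),
      ∑ L' ∈ Fintype.piFinset (fun e : ↥(idx (k - 1)) => orderings (E P e.1.1 e.1.2)),
    (∏ e : ↥(idx (k - 1)), Delta (vec (X A₁ A₂ P (k - 1) e.1.1 e.1.2)) (L' e)) *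
    (∏ q : ↥(permIdx k), Delta (vec (X A₁ A₂ P (q.1.1 - 1) q.1.2.1 q.1.2.2)) (L q)) *
      fn (T P) := by
    intro P
    rw [← sum_vecPerm_pi (fun q : ↥(permIdx k) =>
        (XW A₁ A₂ P q.1.1 (q.1.2.1 + tShift q.1.1 q.1.2.2))) (fun L => ∑ L' ∈ _, _)]
    refine Finset.sum_congr rfl fun σ _ => ?_
    rw [← sum_vecPerm_pi (fun e : ↥(idx (k - 1)) => E P e.1.1 e.1.2) (fun L' =>
      (∏ e : ↥(idx (k - 1)), Delta (vec (X A₁ A₂ P (k - 1) e.1.1 e.1.2)) (L' e)) * _ * _)]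
  rw [Finset.sum_congr rfl fun P _ => e1 P]
  simp only [Finset.mul_sum, Finset.sum_sigma']
  symm
  refine Finset.sum_bij (fun m _ => ⟨labelling A₁ m,
    (fun q => (vec (X A₁ A₂ (labelling A₁ m) (q.1.1 - 1) q.1.2.1 q.1.2.2)).map (step m)),
    (fun e => (vec (X A₁ A₂ (labelling A₁ m) (k - 1) e.1.1 e.1.2)).map (step m))⟩) ?_ ?_ ?_ ?_
  · intro m hm
    simp only [Finset.mem_sigma, Fintype.mem_piFinset, mem_orderings]
    refine ⟨labelling_mem_all hdisj hunion hm, ?_, ?_⟩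
    · rintro ⟨⟨p, a, ϵ⟩, hq⟩
      have hq' := mem_permIdx.1 hq
      have := map_step_X_isOrdering hdisj hunion hm (p := p - 1) (a := a) (ϵ := ϵ) (by omega)
        (mem_idx.2 hq'.2)
      rwa [target, if_neg (by omega), Nat.sub_add_cancel (by omega)] at this
    · rintro ⟨⟨a, ϵ⟩, he⟩
      have := map_step_X_isOrdering hdisj hunion hm (by omega) he
      rwa [target, if_pos rfl] at this
  · intro m hm m' hm' h
    simp only [Sigma.mk.injEq, heq_eq_eq] at h
    obtain ⟨h1, h2, h3⟩ := h
    refine labelling_injective hdisj hunion hm hm' h1 fun p hp a ϵ ha => ?_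
    rcases eq_or_ne p (k - 1) with rfl | hpk
    · have := congrFun h3 ⟨(a, ϵ), ha⟩
      rwa [← h1] at this
    · have h4 := one_le_of_mem_idx ha
      have := congrFun h2 ⟨⟨p + 1, (a, ϵ)⟩, mem_permIdx.2 ⟨by omega, mem_idx.1 ha⟩⟩
      rwa [← h1] at this
  · rintro ⟨P, L, L'⟩ h
    simp only [Finset.mem_sigma, Fintype.mem_piFinset, mem_orderings] at h
    obtain ⟨hP, hL, hL'⟩ := h
    -- Merges the two kinds of orderings into one family indexed by the level of X, hence the p + 1;
    -- the default `[]` is used only outside the index ranges.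
    set LL : ℕ → ℕ → Bool → List (Var k r) := fun p a ϵ =>
      if p = k - 1 then (if h : (a, ϵ) ∈ idx (k - 1) then L' ⟨_, h⟩ else [])
      else (if h : ⟨p + 1, (a, ϵ)⟩ ∈ permIdx k then L ⟨_, h⟩ else []) with hLL
    have l1 : ∀ a ϵ (h : (a, ϵ) ∈ idx (k - 1)), LL (k - 1) a ϵ = L' ⟨_, h⟩ := fun a ϵ h => by
      simp only [hLL, if_true, dif_pos h]
    have l2 : ∀ p a ϵ (h : ⟨p + 1, (a, ϵ)⟩ ∈ permIdx k), LL p a ϵ = L ⟨_, h⟩ := fun p a ϵ h => by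
      have := mem_permIdx.1 h
      simp only [hLL, if_neg (show p ≠ k - 1 by omega), dif_pos h]
    obtain ⟨m, hm, rfl, hmL⟩ := exists_matching hdisj hunion hP LL (by
      intro p hp a ϵ ha
      unfold target
      split_ifs with hpk
      · subst hpk
        rw [l1 a ϵ ha]
        exact hL' ⟨_, ha⟩
      · have := one_le_of_mem_idx ha
        have hq : (⟨p + 1, (a, ϵ)⟩ : Σ _ : ℕ, ℕ × Bool) ∈ permIdx k :=
          mem_permIdx.2 ⟨by omega, mem_idx.1 ha⟩
        rw [l2 p a ϵ hq]
        exact hL ⟨_, hq⟩)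
    refine ⟨m, hm, ?_⟩
    simp only [Sigma.mk.injEq, heq_eq_eq, true_and]
    refine ⟨funext ?_, funext ?_⟩
    · rintro ⟨⟨p, a, ϵ⟩, hq⟩
      have hq' := mem_permIdx.1 hq
      obtain ⟨p, rfl⟩ : ∃ p', p = p' + 1 := ⟨p - 1, by omega⟩
      rw [← l2 p a ϵ hq]
      exact hmL p (by omega) a ϵ (mem_idx.2 hq'.2)
    · rintro ⟨⟨a, ϵ⟩, he⟩
      rw [← l1 a ϵ he]
      exact hmL (k - 1) (by omega) a ϵ he
  · intro m hm
    have hX : ∀ p < k, ∀ a ϵ, Delta (vec (X A₁ A₂ (labelling A₁ m) p a ϵ))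
        ((vec (X A₁ A₂ (labelling A₁ m) p a ϵ)).map (step m)) =
        ∏ v ∈ X A₁ A₂ (labelling A₁ m) p a ϵ, diracTerm m v := fun p hp a ϵ =>
      Delta_vec_map_step m fun v hv => ((mem_X hdisj hunion hp).1 hv).2.2.2
    have h0 : ∏ v ∈ setA k r 0, diracTerm m v = 1 := by
      refine Finset.prod_eq_one fun v hv => ?_
      have := mem_setA.1 hv
      have := one_le_lvl v
      omega
    -- The blocks X tile the matched variables below level k, so grouping by label and sign gives
    -- all Δ factors.
    have hD : ∏ v, diracTerm m v =
        (∏ e : ↥(idx (k - 1)), Delta (vec (X A₁ A₂ (labelling A₁ m) (k - 1) e.1.1 e.1.2))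
          ((vec (X A₁ A₂ (labelling A₁ m) (k - 1) e.1.1 e.1.2)).map (step m))) *
        (∏ q : ↥(permIdx k), Delta (vec (X A₁ A₂ (labelling A₁ m) (q.1.1 - 1) q.1.2.1 q.1.2.2))
          ((vec (X A₁ A₂ (labelling A₁ m) (q.1.1 - 1) q.1.2.1 q.1.2.2)).map (step m))) := by
      rw [prod_diracTerm hm, prod_shift_split (fun p => ∏ v ∈ setA k r p, diracTerm m v) h0 hk]
      congr 1
      · rw [prod_diracTerm_level hdisj hunion hm (by omega), ← Finset.prod_coe_sort]
        exact Finset.prod_congr rfl fun e _ => (hX (k - 1) (by omega) _ _).symm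
      · have h1 : ∀ q : ↥(permIdx k),
            Delta (vec (X A₁ A₂ (labelling A₁ m) (q.1.1 - 1) q.1.2.1 q.1.2.2))
              ((vec (X A₁ A₂ (labelling A₁ m) (q.1.1 - 1) q.1.2.1 q.1.2.2)).map (step m)) =
            ∏ v ∈ X A₁ A₂ (labelling A₁ m) (q.1.1 - 1) q.1.2.1 q.1.2.2, diracTerm m v := by
          rintro ⟨⟨p, a, ϵ⟩, hq⟩
          have := mem_permIdx.1 hq
          exact hX _ (by simp only; omega) _ _
        rw [Finset.prod_congr rfl fun q _ => h1 q,
          Finset.prod_coe_sort (permIdx k) (fun q =>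
            ∏ v ∈ X A₁ A₂ (labelling A₁ m) (q.1 - 1) q.2.1 q.2.2, diracTerm m v), permIdx,
          Finset.prod_sigma]
        refine Finset.prod_congr rfl fun p hp => ?_
        rw [Finset.mem_Icc] at hp
        exact prod_diracTerm_level hdisj hunion hm (by omega)
    rw [hD, mul_left_comm, fn_mul]
    rfl

end Master

/-! ### The phases -/

section Phase

variable {k : ℕ} {r : ℕ → ℕ} {A₁ A₂ : ℕ → Finset (Var k r)} {m : Var k r → Option (Var k r)}

theorem mink_sub (p y z : ℝ × ℝ) : mink p (y - z) = mink p y - mink p z := by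
  simp only [mink, Prod.fst_sub, Prod.snd_sub]
  ring

theorem mink_zero (p : ℝ × ℝ) : mink p 0 = 0 := by simp [mink]

/-- The Minkowski product of the momentum of one particle with a point. -/
noncomputable def minkAt {ι : Type*} (mass : ℝ) (x : ι → ℝ) (v : ι) (z : ℝ × ℝ) : ℝ :=
  mink (mass * Real.cosh (x v), mass * Real.sinh (x v)) z

theorem mink_momentum {ι : Type*} (mass : ℝ) (x : ι → ℝ) (C : Finset ι) (z : ℝ × ℝ) :
    mink (momentum mass x C) z = ∑ v ∈ C, minkAt mass x v z := by
  simp only [mink, momentum, minkAt, Prod.fst_sum, Prod.snd_sum, Finset.sum_mul,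
    Finset.sum_sub_distrib]

/-- With this default value, the boundary terms -p·x_k fit the general pattern p·(x_{s+1} - x_s) at
s = k. -/
theorem pt_succ_top (y : Lvl k → ℝ × ℝ) : pt y (k + 1) = 0 := by
  simp [pt]

theorem sum_setA {M : Type*} [AddCommMonoid M] (f : Var k r → M) :
    ∑ v, f v = ∑ p ∈ Finset.Icc 1 k, ∑ v ∈ setA k r p, f v := by
  rw [← Finset.sum_fiberwise_of_maps_to (t := Finset.Icc 1 k) (g := lvl)
    fun v _ => Finset.mem_Icc.2 ⟨one_le_lvl v, lvl_le v⟩]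
  rfl

theorem phaseA_eq_sum (hk : 1 ≤ k) (mass : ℝ) (x : Config k r) (y : Lvl k → ℝ × ℝ) :
    phaseA mass x y = ∑ v, minkAt mass x v (pt y (lvl v + 1) - pt y (lvl v)) := by
  obtain ⟨n, rfl⟩ : ∃ n, k = n + 1 := ⟨k - 1, by omega⟩
  have h0 : setA (n + 1) r 0 = ∅ := by
    ext v
    have := one_le_lvl v
    simp only [mem_setA, Finset.notMem_empty, iff_false]
    omega
  have h1 : ∀ p, ∑ v ∈ setA (n + 1) r p, minkAt mass x v (pt y (lvl v + 1) - pt y (lvl v)) =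
      mink (momentum mass x (setA (n + 1) r p)) (pt y (p + 1) - pt y p) := fun p => by
    rw [mink_momentum]
    refine Finset.sum_congr rfl fun v hv => ?_
    rw [mem_setA.1 hv]
  rw [sum_setA, Finset.sum_congr rfl fun p _ => h1 p, Finset.sum_Icc_succ_top (by omega),
    mink_sub _ (pt y (n + 1 + 1)), pt_succ_top, mink_zero, phaseA, h0, mink_momentum,
    Finset.sum_empty, Nat.add_sub_cancel]
  ring

/-- Along a chain the momenta telescope. -/
theorem sum_minkAt_eq (hm : m ∈ matchings k r) (mass : ℝ) {x : Config k r}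
    (hx : ∀ v w, m v = some w → x v = x w) (y : Lvl k → ℝ × ℝ) :
    ∑ v, minkAt mass x v (pt y (lvl v + 1) - pt y (lvl v)) =
      ∑ v with m v = none, minkAt mass x v (pt y (lvl v + 1) - pt y (start m v)) := by
  set H : Var k r → ℝ := fun v => minkAt mass x v (pt y (lvl v + 1) - pt y (start m v)) with hH
  set K : Var k r → ℝ := fun v => minkAt mass x v (pt y (lvl v) - pt y (start m v)) with hK
  have h1 : ∀ v, minkAt mass x v (pt y (lvl v + 1) - pt y (lvl v)) = H v - K v := fun v => by
    simp only [hH, hK, minkAt, mink_sub]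
    ring
  -- `K` at a partner equals `H` at its source, since the two share rapidity and starting level. `K`
  -- vanishes at the start of a chain, so only the values of `H` at chain ends survive.
  have h2 : ∑ v, K v = ∑ v with m v ≠ none, H v := by
    have h3 : ∑ v with m v ≠ none, H v = ∑ w with prev m w ≠ none, K w := by
      refine Finset.sum_bij (fun v _ => step m v) ?_ ?_ ?_ ?_
      · intro v hv
        have := eq_some_step (Option.isSome_iff_ne_none.2 (Finset.mem_filter.1 hv).2)
        rw [Finset.mem_filter, (prev_eq_some hm).2 this]
        simp
      · intro v hv v' hv' h
        have e := eq_some_step (Option.isSome_iff_ne_none.2 (Finset.mem_filter.1 hv).2)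
        have e' := eq_some_step (Option.isSome_iff_ne_none.2 (Finset.mem_filter.1 hv').2)
        rw [h] at e
        exact (mem_matchings.1 hm).2 _ _ _ e e'
      · intro w hw
        obtain ⟨u, hu⟩ := Option.ne_none_iff_exists'.1 (Finset.mem_filter.1 hw).2
        rw [prev_eq_some hm] at hu
        exact ⟨u, by simp [hu], by simp [step, hu]⟩
      · intro v hv
        have e := eq_some_step (Option.isSome_iff_ne_none.2 (Finset.mem_filter.1 hv).2)
        simp only [hH, hK, minkAt]
        rw [start_of_eq_some hm e, lvl_of_eq_some hm e, hx _ _ e]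
    rw [h3, ← Finset.sum_filter_add_sum_filter_not Finset.univ (fun w => prev m w ≠ none),
      add_eq_left]
    refine Finset.sum_eq_zero fun v hv => ?_
    have hv := (Finset.mem_filter.1 hv).2
    rw [not_not, prev_eq_none] at hv
    simp only [hK]
    rw [start_of_start hv, sub_self, minkAt, mink_zero]
  rw [Finset.sum_congr rfl fun v _ => h1 v, Finset.sum_sub_distrib, h2,
    ← Finset.sum_filter_add_sum_filter_not Finset.univ (fun v => m v = none) H]
  simp

/-- The sets γ tile the chain ends below level k, by sign, level and starting level. -/
theorem sum_γ (hdisj : ∀ s < k, Disjoint (A₁ s) (A₂ s))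
    (hunion : ∀ s < k, A₁ s ∪ A₂ s = setA k r s) (hm : m ∈ matchings k r)
    (f : ℕ → ℕ → Var k r → ℝ) :
    ∑ ϵ : Bool, ∑ b ∈ Finset.Icc 1 k, ∑ a ∈ Finset.Ico 1 b,
      ∑ v ∈ MPart.γ A₁ A₂ (labelling A₁ m) b a ϵ, f b a v =
    ∑ v with m v = none ∧ lvl v < k, f (lvl v + 1) (start m v) v := by
  rw [← Finset.sum_fiberwise_of_maps_to
    (t := (Finset.univ : Finset Bool) ×ˢ (Finset.Icc 1 k).sigma (fun b => Finset.Ico 1 b))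
    (g := fun v => (sgn A₁ v, (⟨lvl v + 1, start m v⟩ : Σ _ : ℕ, ℕ))), Finset.sum_product]
  · refine Finset.sum_congr rfl fun ϵ _ => ?_
    rw [Finset.sum_sigma]
    refine Finset.sum_congr rfl fun b hb => Finset.sum_congr rfl fun a ha => ?_
    rw [Finset.mem_Icc] at hb
    rw [Finset.mem_Ico] at ha
    refine Finset.sum_congr ?_ fun v hv => ?_
    · ext v
      rw [mem_γ hdisj hunion hm ha.1 ha.2 hb.2]
      simp only [Finset.mem_filter, Finset.mem_univ, true_and, Prod.mk.injEq, Sigma.mk.injEq,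
        heq_eq_eq]
      constructor
      · rintro ⟨h1, h2, h3, h4⟩
        exact ⟨⟨h3, by omega⟩, h2, by omega, h4⟩
      · rintro ⟨⟨h1, h2⟩, h3, h4, h5⟩
        exact ⟨by omega, h3, h1, h5⟩
    · simp only [Finset.mem_filter, Prod.mk.injEq, Sigma.mk.injEq, heq_eq_eq] at hv
      rw [hv.2.2.1, hv.2.2.2]
  · intro v hv
    have h1 := start_bounds hm v
    have h2 := (Finset.mem_filter.1 hv).2.2
    simp only [Finset.mem_product, Finset.mem_univ, true_and, Finset.mem_sigma, Finset.mem_Icc,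
      Finset.mem_Ico]
    omega

/-- The sets Ξ tile level k, by last-link sign and starting level. -/
theorem sum_Ξ (hm : m ∈ matchings k r) (f : ℕ → Var k r → ℝ) :
    ∑ ϵ : Bool, ∑ a ∈ Finset.Icc 1 k, ∑ v ∈ MPart.Ξ (labelling A₁ m) a ϵ, f a v =
    ∑ v ∈ setA k r k, f (start m v) v := by
  rw [← Finset.sum_fiberwise_of_maps_to (t := (Finset.univ : Finset Bool) ×ˢ Finset.Icc 1 k)
    (g := fun v => (linkSgn A₁ m v, start m v)), Finset.sum_product]
  · refine Finset.sum_congr rfl fun ϵ _ => Finset.sum_congr rfl fun a ha => ?_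
    rw [Finset.mem_Icc] at ha
    refine Finset.sum_congr ?_ fun v hv => ?_
    · ext v
      rw [mem_Ξ hm ha.1 ha.2, Finset.mem_filter, mem_setA, Prod.mk.injEq]
    · simp only [Finset.mem_filter, Prod.mk.injEq] at hv
      rw [hv.2.2]
  · intro v hv
    have h1 := start_bounds hm v
    have h2 := lvl_le v
    simp only [Finset.mem_product, Finset.mem_univ, true_and, Finset.mem_Icc]
    omega

/-- The γ and Ξ sums run over the chain ends below and at level k. The latter have the form of the
former with x_{k+1} = 0. -/
theorem phaseGlob_eq_sum (hdisj : ∀ s < k, Disjoint (A₁ s) (A₂ s))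
    (hunion : ∀ s < k, A₁ s ∪ A₂ s = setA k r s) (hm : m ∈ matchings k r) (mass : ℝ)
    (x : Config k r) (y : Lvl k → ℝ × ℝ) :
    MPart.phaseGlob A₁ A₂ (labelling A₁ m) mass x y =
      ∑ v with m v = none, minkAt mass x v (pt y (lvl v + 1) - pt y (start m v)) := by
  have e1 := sum_γ hdisj hunion hm (fun b a v => minkAt mass x v (pt y b - pt y a))
  have e2 := sum_Ξ (A₁ := A₁) hm (fun a v => minkAt mass x v (pt y a))
  simp only [← mink_momentum] at e1 e2
  have e3 := Finset.sum_filter_add_sum_filter_not (Finset.univ.filter (fun v => m v = none))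
      (fun v => lvl v < k) (fun v => minkAt mass x v (pt y (lvl v + 1) - pt y (start m v)))
  rw [Finset.filter_filter, Finset.filter_filter] at e3
  rw [MPart.phaseGlob, Finset.sum_sub_distrib, e1, e2, ← e3, sub_eq_add_neg,
    ← Finset.sum_neg_distrib]
  congr 1
  refine Finset.sum_congr ?_ fun v hv => ?_
  · ext v
    have := lvl_le v
    simp only [mem_setA, Finset.mem_filter, Finset.mem_univ, true_and, not_lt]
    exact ⟨fun h => ⟨eq_none_of_lvl_eq hm h, h.ge⟩, fun h => le_antisymm this h.2⟩
  · have h : pt y (lvl v + 1) = 0 := by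
      have h1 := (Finset.mem_filter.1 hv).2.2
      have h2 := lvl_le v
      rw [show lvl v = k by omega, pt_succ_top]
    simp only [minkAt]
    rw [h, mink_sub, mink_zero, zero_sub]

theorem phaseA_eq_phaseGlob (hk : 1 ≤ k) (hdisj : ∀ s < k, Disjoint (A₁ s) (A₂ s))
    (hunion : ∀ s < k, A₁ s ∪ A₂ s = setA k r s) (hm : m ∈ matchings k r) (mass : ℝ)
    {x : Config k r} (hx : ∀ v w, m v = some w → x v = x w) :
    phaseA mass x = MPart.phaseGlob A₁ A₂ (labelling A₁ m) mass x := by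
  funext y
  rw [phaseA_eq_sum hk, sum_minkAt_eq hm mass hx, phaseGlob_eq_sum hdisj hunion hm]

end Phase

/-! ### The two families of lists attached to a matching -/

section Lists

variable {ι : Type*} [LinearOrder ι]

/-- The elements of `A` without partner. -/
def unmatched (m : ι → Option ι) (A : Finset ι) : Finset ι := A \ matched m A

theorem mem_unmatched {m : ι → Option ι} {A : Finset ι} {v : ι} :
    v ∈ unmatched m A ↔ v ∈ A ∧ m v = none := by
  rw [unmatched, Finset.mem_sdiff, mem_matched, ← Option.not_isSome_iff_eq_none]
  tauto

/-- The elements of `A₁ ∪ A₂`, sorted by what becomes of them. -/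
noncomputable def levelList (m : ι → Option ι) (A₁ A₂ : Finset ι) : List ι :=
  vec (matched m A₁) ++ vec (unmatched m A₁) ++ vec (unmatched m A₂) ++ vec (matched m A₂)

/-- The elements of `B`, sorted by their origin. -/
noncomputable def originList (m : ι → Option ι) (A₁ A₂ B : Finset ι) : List ι :=
  partners m A₁ ++ vec (freePart m A₁ A₂ B) ++ partners m A₂

theorem mem_partners {m : ι → Option ι} {A : Finset ι} {v : ι} :
    v ∈ partners m A ↔ ∃ u ∈ A, m u = some v := by
  simp only [partners, List.mem_map, mem_vec, mem_matched]
  constructor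
  · rintro ⟨u, ⟨h1, h2⟩, rfl⟩
    exact ⟨u, h1, eq_some_step h2⟩
  · rintro ⟨u, h1, h2⟩
    exact ⟨u, ⟨h1, by simp [h2]⟩, by simp [step, h2]⟩

theorem mem_freePart {m : ι → Option ι} {A₁ A₂ B : Finset ι} {v : ι} :
    v ∈ freePart m A₁ A₂ B ↔ v ∈ B ∧ ∀ u, u ∈ A₁ ∨ u ∈ A₂ → m u ≠ some v := by
  have h : ∀ A : Finset ι, v ∈ (matched m A).image (step m) ↔ v ∈ partners m A := fun A => by
    simp only [partners, List.mem_map, mem_vec, Finset.mem_image]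
  rw [freePart, Finset.mem_sdiff, Finset.mem_union, h, h, mem_partners, mem_partners]
  refine and_congr_right fun _ => ?_
  constructor
  · rintro h1 u (h2 | h2) h3
    · exact h1 (Or.inl ⟨u, h2, h3⟩)
    · exact h1 (Or.inr ⟨u, h2, h3⟩)
  · rintro h1 (⟨u, h2, h3⟩ | ⟨u, h2, h3⟩)
    · exact h1 u (Or.inl h2) h3
    · exact h1 u (Or.inr h2) h3

theorem nodup_partners {m : ι → Option ι} (hm : ∀ v v' w, m v = some w → m v' = some w → v = v')
    (A : Finset ι) : (partners m A).Nodup :=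
  (map_step_isOrdering hm fun _ hv => (mem_matched.1 hv).2).1

theorem mem_levelList {m : ι → Option ι} {A₁ A₂ : Finset ι} {v : ι} :
    v ∈ levelList m A₁ A₂ ↔ v ∈ A₁ ∨ v ∈ A₂ := by
  simp only [levelList, List.mem_append, mem_vec, mem_unmatched, mem_matched]
  rcases m v <;> simp

theorem nodup_levelList {m : ι → Option ι} {A₁ A₂ : Finset ι} (h : Disjoint A₁ A₂) :
    (levelList m A₁ A₂).Nodup := by
  have h' : ∀ v, v ∈ A₁ → v ∉ A₂ := fun v h1 h2 => Finset.disjoint_left.1 h h1 h2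
  simp only [levelList, List.nodup_append, vec_nodup, List.mem_append, mem_vec, mem_unmatched,
    mem_matched, true_and, ← Option.not_isSome_iff_eq_none]
  refine ⟨⟨?_, ?_⟩, ?_⟩ <;> rintro a ha b hb rfl <;> have := h' a <;> tauto

theorem mem_originList {m : ι → Option ι} {A₁ A₂ B : Finset ι}
    (hB : ∀ u v, u ∈ A₁ ∨ u ∈ A₂ → m u = some v → v ∈ B) {v : ι} :
    v ∈ originList m A₁ A₂ B ↔ v ∈ B := by
  simp only [originList, List.mem_append, mem_vec, mem_partners, mem_freePart]
  constructor
  · rintro ((⟨u, h1, h2⟩ | ⟨h, -⟩) | ⟨u, h1, h2⟩)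
    · exact hB u v (Or.inl h1) h2
    · exact h
    · exact hB u v (Or.inr h1) h2
  · intro h
    by_cases h1 : ∃ u, (u ∈ A₁ ∨ u ∈ A₂) ∧ m u = some v
    · obtain ⟨u, h2 | h2, h3⟩ := h1
      · exact Or.inl (Or.inl ⟨u, h2, h3⟩)
      · exact Or.inr ⟨u, h2, h3⟩
    · exact Or.inl (Or.inr ⟨h, fun u h2 h3 => h1 ⟨u, h2, h3⟩⟩)

theorem nodup_originList {m : ι → Option ι}
    (hm : ∀ v v' w, m v = some w → m v' = some w → v = v') {A₁ A₂ B : Finset ι}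
    (h : Disjoint A₁ A₂) : (originList m A₁ A₂ B).Nodup := by
  simp only [originList, List.nodup_append, vec_nodup, nodup_partners hm, List.mem_append, mem_vec,
    mem_partners, mem_freePart, true_and]
  refine ⟨?_, ?_⟩
  · rintro a ⟨u, h1, h2⟩ b ⟨-, h3⟩ rfl
    exact h3 u (Or.inl h1) h2
  · rintro a (⟨u, h1, h2⟩ | ⟨-, h3⟩) b ⟨u', h1', h2'⟩ rfl
    · rw [hm _ _ _ h2 h2'] at h1
      exact Finset.disjoint_left.1 h h1 h1'
    · exact h3 u' (Or.inr h1') h2'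

/-- The first S-product of the kernel compares reversed words, so its ratio appears inverted: sorted
order over index order. The second goes from the index order of B to the order by origin. -/
theorem kernelCoef_eq {g : ℝ} (hg : g ≠ 0) (O : LocalOperator g) (ε ε' : ℝ)
    {A A₁ A₂ B : Finset ι} {m : ι → Option ι}
    (hm : ∀ v v' w, m v = some w → m v' = some w → v = v') (h : Disjoint A₁ A₂)
    (hA : ∀ v, v ∈ A ↔ v ∈ A₁ ∨ v ∈ A₂)
    (hB : ∀ u v, u ∈ A₁ ∨ u ∈ A₂ → m u = some v → v ∈ B) (x : ι → ℝ) :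
    kernelCoef O ε ε' A₁ A₂ B m x = Complex.exp (-2 * Complex.I * Real.pi * A₁.card * O.ω) *
      (orderProd g x (levelList m A₁ A₂) / orderProd g x (vec A) *
        (orderProd g x (vec B) / orderProd g x (originList m A₁ A₂ B)) *
        shiftedFF O ε ε' x (vec (unmatched m A₁)).reverse (vec (freePart m A₁ A₂ B))
          (vec (unmatched m A₂)).reverse) := by
  have hA' : A₁ ∪ A₂ = A := by
    ext v
    rw [hA, Finset.mem_union]
  have h1 : (vec A).Perm (levelList m A₁ A₂) :=
    (List.perm_ext_iff_of_nodup (vec_nodup _) (nodup_levelList h)).2 fun v => by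
      rw [mem_vec, hA, mem_levelList]
  have h2 : (vec B).Perm (originList m A₁ A₂ B) :=
    (List.perm_ext_iff_of_nodup (vec_nodup _) (nodup_originList hm h)).2 fun v => by
      rw [mem_vec, mem_originList hB]
  have h3 : (vec (matched m A₂)).reverse ++ (vec (unmatched m A₂)).reverse
        ++ (vec (unmatched m A₁)).reverse ++ (vec (matched m A₁)).reverse =
      (levelList m A₁ A₂).reverse := by
    simp only [levelList, List.reverse_append, List.append_assoc]
  rw [kernelCoef, hA', ← unmatched, ← unmatched, h3, sProd_reverse hg x (vec_nodup _) h1,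
    ← originList, sProd_eq_div hg x (vec_nodup _) h2]

end Lists

/-! ### Comparing the kernels with chains of lists of chain ends -/

section Families

variable {g : ℝ} {k : ℕ} {r : ℕ → ℕ} {A₁ A₂ : ℕ → Finset (Var k r)}
  {m : Var k r → Option (Var k r)}

/-- The lists of the kernels, with each variable replaced by the end of its chain. -/
noncomputable def kernelLists (A₁ A₂ : ℕ → Finset (Var k r)) (m : Var k r → Option (Var k r)) :
    ChainLists (Var k r) where
  c p := if p < k then (vec (matched m (A₁ p))).map (chainEnd m) else []
  u p := if p < k then vec (unmatched m (A₁ p)) else vec (setA k r k)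
  w p := if p < k then vec (unmatched m (A₂ p)) else []
  d p := if p < k then (vec (matched m (A₂ p))).map (chainEnd m) else []
  z p := (vec (freePart m (A₁ (p - 1)) (A₂ (p - 1)) (setA k r p))).map (chainEnd m)

/-- The lists of the master representation. -/
noncomputable def masterLists (A₁ A₂ : ℕ → Finset (Var k r)) (P : MPart k r)
    (c d : ℕ → List (Var k r)) : ChainLists (Var k r) where
  c p := if p < k then (if p = 0 then [] else c p) else []
  u p := if p < k then MPart.γRow A₁ A₂ P (p + 1) true else vec (setA k r k)
  w p := if p < k then MPart.γRow A₁ A₂ P (p + 1) false else []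
  d p := if p < k then (if p = 0 then [] else d p) else []
  z p := MPart.centralVec A₁ A₂ P p

/-- The elements of the level `p` sorted by what becomes of them, or all of them for `p = k`. -/
noncomputable def sortedLevel (A₁ A₂ : ℕ → Finset (Var k r)) (m : Var k r → Option (Var k r))
    (p : ℕ) : List (Var k r) := if p < k then levelList m (A₁ p) (A₂ p) else vec (setA k r k)

theorem mem_level (hunion : ∀ s < k, A₁ s ∪ A₂ s = setA k r s) {p : ℕ} (hp : p < k)
    {v : Var k r} : v ∈ A₁ p ∨ v ∈ A₂ p ↔ lvl v = p := by
  rw [← mem_setA, ← hunion p hp, Finset.mem_union]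

theorem sortedLevel_perm (hdisj : ∀ s < k, Disjoint (A₁ s) (A₂ s))
    (hunion : ∀ s < k, A₁ s ∪ A₂ s = setA k r s) {p : ℕ} (hp : p ≤ k) :
    (sortedLevel A₁ A₂ m p).Perm (vec (setA k r p)) := by
  unfold sortedLevel
  split_ifs with h
  · exact (List.perm_ext_iff_of_nodup (nodup_levelList (hdisj p h)) (vec_nodup _)).2 fun v => by
      rw [mem_levelList, mem_level hunion h, mem_vec, mem_setA]
  · rw [show p = k by omega]

theorem originList_perm (hdisj : ∀ s < k, Disjoint (A₁ s) (A₂ s))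
    (hunion : ∀ s < k, A₁ s ∪ A₂ s = setA k r s) (hm : m ∈ matchings k r) {p : ℕ} (hp : p < k) :
    (originList m (A₁ p) (A₂ p) (setA k r (p + 1))).Perm (vec (setA k r (p + 1))) :=
  (List.perm_ext_iff_of_nodup (nodup_originList (mem_matchings.1 hm).2 (hdisj p hp))
    (vec_nodup _)).2 fun v => by
      rw [mem_vec, mem_originList]
      intro u v hu h
      rw [mem_setA, lvl_of_eq_some hm h, (mem_level hunion hp).1 hu]

theorem map_chainEnd_eq_self {l : List (Var k r)} (h : ∀ v ∈ l, m v = none) :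
    l.map (chainEnd m) = l := by
  conv_rhs => rw [← List.map_id l]
  exact List.map_congr_left fun v hv => chainEnd_of_none (h v hv)

theorem map_chainEnd_unmatched (A : Finset (Var k r)) :
    (vec (unmatched m A)).map (chainEnd m) = vec (unmatched m A) := by
  exact map_chainEnd_eq_self fun v hv => (mem_unmatched.1 (mem_vec.1 hv)).2

/-- Unmatched variables are their own chain ends. At p = k only `u` is nonempty and holds the whole
level, so the last operator needs no special treatment. -/
theorem kernelLists_top (hm : m ∈ matchings k r) (p : ℕ) :
    (kernelLists A₁ A₂ m).top p = (sortedLevel A₁ A₂ m p).map (chainEnd m) := by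
  unfold sortedLevel
  simp only [ChainLists.top, kernelLists]
  split_ifs with h
  · simp only [levelList, List.map_append, map_chainEnd_unmatched]
  · rw [map_chainEnd_eq_self fun v hv => eq_none_of_lvl_eq hm (mem_setA.1 (mem_vec.1 hv))]
    simp

/-- A variable and its partner have the same chain end. This is why the same lists `c p`, `d p`
serve on level p and on level p + 1. -/
theorem kernelLists_bot (hm : m ∈ matchings k r) {p : ℕ} (hp : p < k) :
    (kernelLists A₁ A₂ m).bot p =
      (originList m (A₁ p) (A₂ p) (setA k r (p + 1))).map (chainEnd m) := by
  have h : ∀ A : Finset (Var k r), (partners m A).map (chainEnd m) =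
      (vec (matched m A)).map (chainEnd m) := fun A => by
    rw [partners, List.map_map]
    refine List.map_congr_left fun v hv => ?_
    exact (chainEnd_of_eq_some hm (eq_some_step (mem_matched.1 (mem_vec.1 hv)).2)).symm
  simp only [ChainLists.bot, kernelLists, if_pos hp, originList, List.map_append, h,
    Nat.add_sub_cancel]

/-- Consecutive kernels reorder level p through the index order, one arriving there and the next
leaving it. The index order cancels, leaving a direct passage from the order by destiny to the order
by origin. -/
theorem prod_kernelCoef (hg : g ≠ 0) (O : ℕ → LocalOperator g) (ε ε' : ℕ → ℝ)
    (hdisj : ∀ s < k, Disjoint (A₁ s) (A₂ s))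
    (hunion : ∀ s < k, A₁ s ∪ A₂ s = setA k r s) (hm : m ∈ matchings k r) {x : Config k r}
    (hx : ∀ v w, m v = some w → x v = x w) :
    ∏ p ∈ Finset.range k, kernelCoef (O (p + 1)) (ε (p + 1)) (ε' (p + 1)) (A₁ p) (A₂ p)
        (setA k r (p + 1)) m x =
      (∏ p ∈ Finset.range k,
        Complex.exp (-2 * Complex.I * Real.pi * (A₁ p).card * (O (p + 1)).ω)) *
      ∏ p ∈ Finset.range k, (kernelLists A₁ A₂ m).term O ε ε' x p := by
  -- The telescoping quantity. It is 1 at p = 0, where the level is empty, and at p = k, where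
  -- nothing is sorted.
  set R : ℕ → ℂ := fun p => orderProd g x (sortedLevel A₁ A₂ m p) / orderProd g x (vec (setA k r p))
    with hR
  have hR0 : ∀ p, R p ≠ 0 := fun p => div_ne_zero (orderProd_ne_zero hg x _)
    (orderProd_ne_zero hg x _)
  have hRk : R k = 1 := by
    simp only [hR, sortedLevel, lt_irrefl, if_false]
    exact div_self (orderProd_ne_zero hg x _)
  have hR00 : R 0 = 1 := by
    have h0 : vec (setA k r 0) = [] := by
      refine List.eq_nil_iff_forall_not_mem.2 fun v hv => ?_
      have := mem_setA.1 (mem_vec.1 hv)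
      have := one_le_lvl v
      omega
    have h1 := sortedLevel_perm (m := m) hdisj hunion (Nat.zero_le k)
    rw [h0] at h1
    simp only [hR]
    rw [h0, h1.eq_nil]
    exact div_self (orderProd_ne_zero hg x _)
  have key : ∀ p ∈ Finset.range k, kernelCoef (O (p + 1)) (ε (p + 1)) (ε' (p + 1)) (A₁ p) (A₂ p)
        (setA k r (p + 1)) m x * R (p + 1) =
      Complex.exp (-2 * Complex.I * Real.pi * (A₁ p).card * (O (p + 1)).ω) *
        (kernelLists A₁ A₂ m).term O ε ε' x p * R p := by
    intro p hp
    rw [Finset.mem_range] at hp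
    have hpo := originList_perm hdisj hunion hm hp
    have hps := sortedLevel_perm (m := m) hdisj hunion (show p + 1 ≤ k by omega)
    have hmem : ∀ v ∈ sortedLevel A₁ A₂ m (p + 1), lvl v = p + 1 := fun v hv =>
      mem_setA.1 (mem_vec.1 (hps.mem_iff.1 hv))
    -- Replacing variables by chain ends does not affect the S-product: it is injective on one level
    -- and preserves the values of `x`.
    rw [kernelCoef_eq hg (O (p + 1)) _ _ (A := setA k r p) (mem_matchings.1 hm).2 (hdisj p hp)
      (fun v => by rw [mem_setA, mem_level hunion hp]) (fun u v hu h => by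
        rw [mem_setA, lvl_of_eq_some hm h, (mem_level hunion hp).1 hu]) x, ChainLists.term,
      kernelLists_top hm, kernelLists_bot hm hp, sProd_map g x (chainEnd m) (hps.trans hpo.symm)
        (fun a ha b hb h => chainEnd_injective hm ((hmem a ha).trans (hmem b hb).symm) h)
        (fun a _ => apply_chainEnd hm hx a),
      sProd_eq_div hg x (hps.nodup_iff.2 (vec_nodup _)) (hps.trans hpo.symm)]
    have hff : shiftedFF (O (p + 1)) (ε (p + 1)) (ε' (p + 1)) x
        ((kernelLists A₁ A₂ m).u p).reverse ((kernelLists A₁ A₂ m).z (p + 1))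
        ((kernelLists A₁ A₂ m).w p).reverse =
        shiftedFF (O (p + 1)) (ε (p + 1)) (ε' (p + 1)) x (vec (unmatched m (A₁ p))).reverse
          (vec (freePart m (A₁ p) (A₂ p) (setA k r (p + 1))))
          (vec (unmatched m (A₂ p))).reverse := by
      simp only [kernelLists, if_pos hp, Nat.add_sub_cancel]
      refine shiftedFF_congr _ _ _ rfl ?_ rfl
      rw [List.map_map]
      exact List.map_congr_left fun v _ => apply_chainEnd hm hx v
    have e : levelList m (A₁ p) (A₂ p) = sortedLevel A₁ A₂ m p := by
      rw [sortedLevel, if_pos hp]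
    rw [hff, e]
    simp only [hR]
    have n1 := orderProd_ne_zero hg x (vec (setA k r (p + 1)))
    have n2 := orderProd_ne_zero hg x (vec (setA k r p))
    have n3 := orderProd_ne_zero hg x (originList m (A₁ p) (A₂ p) (setA k r (p + 1)))
    field_simp
  have h1 := Finset.prod_congr rfl key
  rw [Finset.prod_mul_distrib, Finset.prod_mul_distrib, Finset.prod_mul_distrib] at h1
  have h2 : ∏ p ∈ Finset.range k, R (p + 1) = ∏ p ∈ Finset.range k, R p := by
    have h3 := Finset.prod_range_succ R k
    rw [Finset.prod_range_succ', hR00, hRk, mul_one, mul_one] at h3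
    exact h3
  rw [h2] at h1
  exact mul_right_cancel₀ (Finset.prod_ne_zero_iff.2 fun p _ => hR0 p) h1

end Families

/-! ### The coefficients agree -/

section Coefficients

variable {g : ℝ} {k : ℕ} {r : ℕ → ℕ} {A₁ A₂ : ℕ → Finset (Var k r)}
  {m : Var k r → Option (Var k r)}

theorem prod_Icc_one_eq_prod_range (n : ℕ) (f : ℕ → ℂ) :
    ∏ p ∈ Finset.Icc 1 n, f p = ∏ p ∈ Finset.range n, f (p + 1) := by
  rw [Finset.range_eq_Ico, Finset.prod_Ico_add' f 0 n 1]
  rfl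

theorem exists_chain_start (hm : m ∈ matchings k r) (v : Var k r) :
    ∃ u, lvl u = start m v ∧ (∀ w, m w ≠ some u) ∧ chainEnd m u = chainEnd m v := by
  refine chain_induction hm (fun v h => ?_) (fun u v h ih => ?_) v
  · exact ⟨v, (start_of_start h).symm, h, rfl⟩
  · obtain ⟨w, h1, h2, h3⟩ := ih
    exact ⟨w, by rw [h1, start_of_eq_some hm h], h2, by rw [h3, chainEnd_of_eq_some hm h]⟩

theorem mem_γRow (hdisj : ∀ s < k, Disjoint (A₁ s) (A₂ s))
    (hunion : ∀ s < k, A₁ s ∪ A₂ s = setA k r s) (hm : m ∈ matchings k r) {p : ℕ} (hp : p < k)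
    {ϵ : Bool} {v : Var k r} :
    v ∈ MPart.γRow A₁ A₂ (labelling A₁ m) (p + 1) ϵ ↔
      lvl v = p ∧ sgn A₁ v = ϵ ∧ m v = none := by
  simp only [MPart.γRow, List.mem_flatMap, List.mem_range'_1, mem_vec]
  constructor
  · rintro ⟨a, ha, hv⟩
    rw [mem_γ hdisj hunion hm ha.1 (by omega) (by omega)] at hv
    exact ⟨by omega, hv.2.1, hv.2.2.1⟩
  · rintro ⟨h1, h2, h3⟩
    have h := start_bounds hm v
    exact ⟨start m v, by omega,
      (mem_γ hdisj hunion hm h.1 (by omega) (by omega)).2 ⟨by omega, h2, h3, rfl⟩⟩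

theorem nodup_γRow (hdisj : ∀ s < k, Disjoint (A₁ s) (A₂ s))
    (hunion : ∀ s < k, A₁ s ∪ A₂ s = setA k r s) (hm : m ∈ matchings k r) {p : ℕ} (hp : p < k)
    (ϵ : Bool) : (MPart.γRow A₁ A₂ (labelling A₁ m) (p + 1) ϵ).Nodup := by
  rw [MPart.γRow, List.nodup_flatMap]
  refine ⟨fun a _ => vec_nodup _, ?_⟩
  refine List.Pairwise.imp_of_mem (fun {a b} ha hb hab => ?_)
    (List.nodup_range' (s := 1) (n := p + 1 - 1) (step := 1))
  rw [List.mem_range'_1] at ha hb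
  intro v hv hv'
  rw [mem_vec, mem_γ hdisj hunion hm (by omega) (by omega) (by omega)] at hv hv'
  exact hab (hv.2.2.2.symm.trans hv'.2.2.2)

/-- The vector lists the ends of all chains born at level p: the Ξ for those reaching level k, the γ
for the others. -/
theorem mem_centralVec (hdisj : ∀ s < k, Disjoint (A₁ s) (A₂ s))
    (hunion : ∀ s < k, A₁ s ∪ A₂ s = setA k r s) (hm : m ∈ matchings k r) {p : ℕ} (hp1 : 1 ≤ p)
    (hp : p ≤ k) {v : Var k r} :
    v ∈ MPart.centralVec A₁ A₂ (labelling A₁ m) p ↔ m v = none ∧ start m v = p := by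
  simp only [MPart.centralVec, List.mem_append, List.mem_flatMap, List.mem_reverse,
    List.mem_range'_1, mem_vec, mem_Ξ hm hp1 hp]
  constructor
  · rintro ((⟨h1, -, h2⟩ | ⟨h1, -, h2⟩) | ⟨b, hb, h | h⟩)
    · exact ⟨eq_none_of_lvl_eq hm h1, h2⟩
    · exact ⟨eq_none_of_lvl_eq hm h1, h2⟩
    · exact ((mem_γ hdisj hunion hm hp1 (by omega) (by omega)).1 h).2.2
    · exact ((mem_γ hdisj hunion hm hp1 (by omega) (by omega)).1 h).2.2
  · rintro ⟨h1, h2⟩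
    rcases (lvl_le v).lt_or_eq with hv | hv
    · have hs := start_bounds hm v
      refine Or.inr ⟨lvl v + 1, by omega, ?_⟩
      rw [mem_γ hdisj hunion hm hp1 (by omega) (by omega),
        mem_γ hdisj hunion hm hp1 (by omega) (by omega)]
      rcases h : sgn A₁ v <;> simp [h1, h2]
    · left
      rcases h : linkSgn A₁ m v <;> simp [hv, h2]

theorem nodup_centralVec (hdisj : ∀ s < k, Disjoint (A₁ s) (A₂ s))
    (hunion : ∀ s < k, A₁ s ∪ A₂ s = setA k r s) (hm : m ∈ matchings k r) {p : ℕ} (hp1 : 1 ≤ p)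
    (hp : p ≤ k) : (MPart.centralVec A₁ A₂ (labelling A₁ m) p).Nodup := by
  have hb : ∀ b ∈ (List.range' (p + 1) (k - p)).reverse, p < b ∧ b ≤ k := fun b hb => by
    rw [List.mem_reverse, List.mem_range'_1] at hb
    omega
  have hmem : ∀ b ∈ (List.range' (p + 1) (k - p)).reverse, ∀ v,
      v ∈ vec (MPart.γ A₁ A₂ (labelling A₁ m) b p true) ++
        vec (MPart.γ A₁ A₂ (labelling A₁ m) b p false) → lvl v = b - 1 := fun b h v hv => by
    rw [List.mem_append, mem_vec, mem_vec, mem_γ hdisj hunion hm hp1 (hb b h).1 (hb b h).2,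
      mem_γ hdisj hunion hm hp1 (hb b h).1 (hb b h).2] at hv
    tauto
  rw [MPart.centralVec, List.nodup_append, List.nodup_append, List.nodup_flatMap]
  refine ⟨⟨vec_nodup _, vec_nodup _, ?_⟩, ⟨fun b h => ?_, ?_⟩, ?_⟩
  · rintro a ha b hb rfl
    rw [mem_vec, mem_Ξ hm hp1 hp] at ha hb
    exact absurd (ha.2.1.symm.trans hb.2.1) (by simp)
  · rw [List.nodup_append]
    refine ⟨vec_nodup _, vec_nodup _, ?_⟩
    rintro v hv w hw rfl
    rw [mem_vec, mem_γ hdisj hunion hm hp1 (hb b h).1 (hb b h).2] at hv hw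
    exact absurd (hv.2.1.symm.trans hw.2.1) (by simp)
  · refine List.Pairwise.imp_of_mem (fun {a b} ha hb' hab => ?_)
      (List.nodup_reverse.2 (List.nodup_range' (s := p + 1) (n := k - p) (step := 1)))
    intro v hv hv'
    have h1 := hmem a ha v hv
    have h2 := hmem b hb' v hv'
    have h3 := hb a ha
    have h4 := hb b hb'
    omega
  · rintro v hv w hw rfl
    rw [List.mem_flatMap] at hw
    obtain ⟨b, h1, h2⟩ := hw
    have h3 := hmem b h1 v h2
    have h4 := hb b h1
    rw [List.mem_append, mem_vec, mem_vec, mem_Ξ hm hp1 hp, mem_Ξ hm hp1 hp] at hv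
    omega

theorem mem_iff_sgn (hdisj : ∀ s < k, Disjoint (A₁ s) (A₂ s))
    (hunion : ∀ s < k, A₁ s ∪ A₂ s = setA k r s) {p : ℕ} (hp : p < k) {v : Var k r} :
    (v ∈ A₁ p ↔ lvl v = p ∧ sgn A₁ v = true) ∧ (v ∈ A₂ p ↔ lvl v = p ∧ sgn A₁ v = false) :=
  ⟨mem_ite_iff hdisj hunion hp (ϵ := true), mem_ite_iff hdisj hunion hp (ϵ := false)⟩

theorem map_chainEnd_perm (hm : m ∈ matchings k r) {p : ℕ} {C D : Finset (Var k r)}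
    {l : List (Var k r)} (hl : IsOrdering l D) (hC : ∀ v ∈ C, lvl v = p)
    (hD : ∀ v, v ∈ D ↔ ∃ u ∈ C, chainEnd m u = v) : ((vec C).map (chainEnd m)).Perm l := by
  refine (List.perm_ext_iff_of_nodup (List.Nodup.map_on (fun a ha b hb h => ?_) (vec_nodup C))
    hl.1).2 fun v => ?_
  · exact chainEnd_injective hm ((hC a (mem_vec.1 ha)).trans (hC b (mem_vec.1 hb)).symm) h
  · rw [hl.mem_iff, hD, List.mem_map]
    simp only [mem_vec]

/-- The combinatorial comparison: the vectors of the right-hand side are those of the kernels,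
carried to chain ends and reordered. Chains leaving level p give `c` and `d`, chains stopping there
give `u` and `w`, and chains born there give `z`. -/
theorem kernelLists_perm (hk : 1 ≤ k) (hdisj : ∀ s < k, Disjoint (A₁ s) (A₂ s))
    (hunion : ∀ s < k, A₁ s ∪ A₂ s = setA k r s) (hm : m ∈ matchings k r)
    {c d : ℕ → List (Var k r)}
    (hc : ∀ p ∈ Finset.Icc 1 (k - 1), IsOrdering (c p) (MPart.C1 A₁ A₂ (labelling A₁ m) p))
    (hd : ∀ p ∈ Finset.Icc 1 (k - 1), IsOrdering (d p) (MPart.D1 A₁ A₂ (labelling A₁ m) p)) :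
    (kernelLists A₁ A₂ m).Perm (masterLists A₁ A₂ (labelling A₁ m) c d) k := by
  have hs := fun {p : ℕ} (hp : p < k) {v : Var k r} => mem_iff_sgn hdisj hunion hp (v := v)
  have hmat : ∀ A : Finset (Var k r), (∀ v ∈ A, lvl v = 0) → (vec (matched m A)) = [] := by
    intro A hA
    refine List.eq_nil_iff_forall_not_mem.2 fun v hv => ?_
    have := hA v (mem_matched.1 (mem_vec.1 hv)).1
    have := one_le_lvl v
    omega
  refine ⟨fun p hp => ?_, fun p hp => ?_, fun p hp => ?_, fun p hp => ?_, fun p hp1 hp => ?_⟩ <;>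
    simp only [kernelLists, masterLists]
  · split_ifs with h1 h2
    · rw [hmat _ fun v hv => h2 ▸ ((hs h1).1.1 hv).1, List.map_nil]
    · refine map_chainEnd_perm hm (hc p (Finset.mem_Icc.2 (by omega)))
        (fun v hv => ((hs h1).1.1 (mem_matched.1 hv).1).1) fun v => ?_
      rw [mem_C1 hdisj hunion hm hk (by omega)]
      simp only [mem_matched, (hs h1).1, and_assoc]
    · exact List.Perm.refl _
  · split_ifs with h1
    · refine (List.perm_ext_iff_of_nodup (vec_nodup _) (nodup_γRow hdisj hunion hm h1 _)).2
        fun v => ?_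
      rw [mem_vec, mem_unmatched, (hs h1).1, mem_γRow hdisj hunion hm h1, and_assoc]
    · exact List.Perm.refl _
  · split_ifs with h1
    · refine (List.perm_ext_iff_of_nodup (vec_nodup _) (nodup_γRow hdisj hunion hm h1 _)).2
        fun v => ?_
      rw [mem_vec, mem_unmatched, (hs h1).2, mem_γRow hdisj hunion hm h1, and_assoc]
    · exact List.Perm.refl _
  · split_ifs with h1 h2
    · rw [hmat _ fun v hv => h2 ▸ ((hs h1).2.1 hv).1, List.map_nil]
    · refine map_chainEnd_perm hm (hd p (Finset.mem_Icc.2 (by omega)))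
        (fun v hv => ((hs h1).2.1 (mem_matched.1 hv).1).1) fun v => ?_
      rw [mem_D1 hdisj hunion hm hk (by omega)]
      simp only [mem_matched, (hs h1).2, and_assoc]
    · exact List.Perm.refl _
  · have hfree : ∀ v, v ∈ freePart m (A₁ (p - 1)) (A₂ (p - 1)) (setA k r p) ↔
        lvl v = p ∧ ∀ u, m u ≠ some v := fun v => by
      rw [mem_freePart, mem_setA]
      refine and_congr_right fun hv => forall_congr' fun u => ⟨fun h1 h2 => ?_, fun h1 _ => h1⟩
      have := lvl_of_eq_some hm h2
      exact h1 ((mem_level hunion (by omega)).2 (by omega)) h2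
    refine map_chainEnd_perm (p := p) (D := (MPart.centralVec A₁ A₂ (labelling A₁ m) p).toFinset)
      hm ⟨nodup_centralVec hdisj hunion hm hp1 hp, rfl⟩ (fun v hv => ((hfree v).1 hv).1)
      fun v => ?_
    rw [List.mem_toFinset, mem_centralVec hdisj hunion hm hp1 hp]
    simp only [hfree]
    constructor
    · rintro ⟨h1, h2⟩
      obtain ⟨u, h3, h4, h5⟩ := exists_chain_start hm v
      exact ⟨u, ⟨h3.trans h2, h4⟩, h5.trans (chainEnd_of_none h1)⟩
    · rintro ⟨u, ⟨h1, h2⟩, rfl⟩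
      exact ⟨eq_none_chainEnd hm u, by rw [start_chainEnd hm, start_of_start h2, h1]⟩

theorem γRowRev_eq (P : MPart k r) (b : ℕ) (ϵ : Bool) :
    MPart.γRowRev A₁ A₂ P b ϵ = (MPart.γRow A₁ A₂ P b ϵ).reverse := by
  rw [MPart.γRowRev, MPart.γRow, List.reverse_flatMap]
  rfl

theorem centralVec_top (P : MPart k r) :
    MPart.centralVec A₁ A₂ P k = vec (MPart.Ξ P k true) := by
  have : MPart.Ξ P k false = ∅ := by simp [MPart.Ξ]
  rw [MPart.centralVec, this, Nat.sub_self]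
  simp [vec]

/-- The isolated first factor of `sTot` is the term of the last operator: there `u k` is the whole
top level and, as Ξ_-^(k) is empty, the central vector reduces to Ξ_+^(k). -/
theorem sTot_mul_prod_shiftedFF (hk : 1 ≤ k) (O : ℕ → LocalOperator g) (ε ε' : ℕ → ℝ)
    (P : MPart k r) (c d : ℕ → List (Var k r)) (x : Config k r) :
    MPart.sTot A₁ A₂ P g c d x * (∏ p ∈ Finset.Icc 1 k,
        shiftedFF (O p) (ε p) (ε' p) x (MPart.γRowRev A₁ A₂ P p true)
          (MPart.centralVec A₁ A₂ P p) (MPart.γRowRev A₁ A₂ P p false)) =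
      ∏ p ∈ Finset.range k, (masterLists A₁ A₂ P c d).term O ε ε' x p := by
  obtain ⟨n, rfl⟩ : ∃ n, k = n + 1 := ⟨k - 1, by omega⟩
  simp only [ChainLists.term]
  rw [Finset.prod_mul_distrib, MPart.sTot, prod_Icc_one_eq_prod_range,
    prod_Icc_one_eq_prod_range, Nat.add_sub_cancel]
  refine congrArg₂ (· * ·) ?_ ?_
  · rw [Finset.prod_range_succ, mul_comm]
    refine congrArg₂ (· * ·) ?_ ?_
    · refine Finset.prod_congr rfl fun p hp => ?_
      rw [Finset.mem_range] at hp
      simp only [ChainLists.top, ChainLists.bot, masterLists]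
      rw [if_pos (show p + 1 < n + 1 by omega), if_pos (show p + 1 < n + 1 by omega),
        if_pos (show p + 1 < n + 1 by omega), if_pos (show p + 1 < n + 1 by omega),
        if_pos (show p < n + 1 by omega), if_pos (show p < n + 1 by omega), Nat.add_sub_cancel]
    · simp only [ChainLists.top, ChainLists.bot, masterLists, lt_irrefl, if_false,
        if_pos (Nat.lt_succ_self n), centralVec_top, List.nil_append, List.append_nil]
  · refine Finset.prod_congr rfl fun p hp => ?_
    rw [Finset.mem_range] at hp
    simp only [masterLists, if_pos hp, γRowRev_eq]

/-- Brings together the telescoped kernels, the independence of the orderings and the identity of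
the phases. All of it takes place where `x` is constant along chains. -/
theorem prod_kernelCoef_mul_smear (hg : g ≠ 0) (hk : 1 ≤ k) (mass : ℝ) (O : ℕ → LocalOperator g)
    (ε ε' : ℕ → ℝ) (hdisj : ∀ s < k, Disjoint (A₁ s) (A₂ s))
    (hunion : ∀ s < k, A₁ s ∪ A₂ s = setA k r s) (G : SchwartzMap (Lvl k → ℝ × ℝ) ℂ)
    {c d : MPart k r → ℕ → List (Var k r)}
    (hc : ∀ P ∈ MPart.all A₁ A₂, ∀ p ∈ Finset.Icc 1 (k - 1),
      IsOrdering (c P p) (MPart.C1 A₁ A₂ P p))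
    (hd : ∀ P ∈ MPart.all A₁ A₂, ∀ p ∈ Finset.Icc 1 (k - 1),
      IsOrdering (d P p) (MPart.D1 A₁ A₂ P p))
    (hm : m ∈ matchings k r) {x : Config k r} (hx : ∀ v w, m v = some w → x v = x w) :
    (∏ p ∈ Finset.Icc 1 k, kernelCoef (O p) (ε p) (ε' p) (A₁ (p - 1)) (A₂ (p - 1))
        (setA k r p) m x) * smear G (phaseA mass x) =
      masterCoef mass O ε ε' A₁ A₂ G c d (labelling A₁ m) x := by
  have hP := labelling_mem_all hdisj hunion hm
  have hperm := kernelLists_perm hk hdisj hunion hm (hc _ hP) (hd _ hP)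
  have htop : ∀ p < k, ((kernelLists A₁ A₂ m).top (p + 1)).Nodup := fun p hp => by
    have hs := sortedLevel_perm (m := m) hdisj hunion (show p + 1 ≤ k by omega)
    have hmem : ∀ v ∈ sortedLevel A₁ A₂ m (p + 1), lvl v = p + 1 := fun v hv =>
      mem_setA.1 (mem_vec.1 (hs.mem_iff.1 hv))
    rw [kernelLists_top hm]
    exact List.Nodup.map_on (fun a ha b hb h => chainEnd_injective hm
      ((hmem a ha).trans (hmem b hb).symm) h) (hs.nodup_iff.2 (vec_nodup _))
  have htb : ∀ p < k, ((kernelLists A₁ A₂ m).top (p + 1)).Perm ((kernelLists A₁ A₂ m).bot p) :=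
    fun p hp => by
      rw [kernelLists_top hm, kernelLists_bot hm hp]
      exact ((sortedLevel_perm hdisj hunion (by omega)).trans
        (originList_perm hdisj hunion hm hp).symm).map _
  have hnil : ∀ {l l' : List (Var k r)}, l.Perm l' → (∀ v ∈ l, lvl v = 0) → l = l' := by
    intro l l' h h0
    have : l = [] := List.eq_nil_iff_forall_not_mem.2 fun v hv => by
      have := h0 v hv
      have := one_le_lvl v
      omega
    subst this
    exact h.symm.eq_nil.symm
  have h0mem := fun {v : Var k r} => mem_level hunion (show 0 < k by omega) (v := v)
  have hemp : ∀ A : Finset (Var k r), (∀ v ∈ A, lvl v = 0) → A = ∅ := fun A hA => by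
    refine Finset.eq_empty_of_forall_notMem fun v hv => ?_
    have := hA v hv
    have := one_le_lvl v
    omega
  have hA₁ : A₁ 0 = ∅ := hemp _ fun v hv => h0mem.1 (Or.inl hv)
  have hA₂ : A₂ 0 = ∅ := hemp _ fun v hv => h0mem.1 (Or.inr hv)
  have hk0 : 0 < k := hk
  have heq := ChainLists.prod_term_eq hg O ε ε' x hperm htop htb
    ⟨by simp [kernelLists, masterLists, hk0, hA₁, matched, vec],
      by simp [kernelLists, masterLists, hk0, hA₁, matched, unmatched, vec, MPart.γRow],
      by simp [kernelLists, masterLists, hk0, hA₂, matched, unmatched, vec, MPart.γRow],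
      by simp [kernelLists, masterLists, hk0, hA₂, matched, vec]⟩
    ⟨by simp [kernelLists, masterLists], by simp [kernelLists, masterLists],
      by simp [kernelLists, masterLists], by simp [kernelLists, masterLists]⟩
  rw [prod_Icc_one_eq_prod_range]
  simp only [Nat.add_sub_cancel]
  rw [prod_kernelCoef hg O ε ε' hdisj hunion hm hx, heq, masterCoef,
    sTot_mul_prod_shiftedFF hk, phaseA_eq_phaseGlob hk hdisj hunion hm mass hx, mul_assoc]
  congr 1
  obtain ⟨n, rfl⟩ : ∃ n, k = n + 1 := ⟨k - 1, by omega⟩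
  -- The locality factor of the first operator is 1, because A^(0) is empty; hence the product over
  -- s ≤ k - 1 with ω of index s + 1.
  rw [Finset.prod_range_succ', prod_Icc_one_eq_prod_range, Nat.add_sub_cancel, hA₁]
  simp only [Finset.card_empty, Nat.cast_zero, mul_zero, zero_mul, Complex.exp_zero, mul_one]
  refine Finset.prod_congr rfl fun p _ => ?_
  congr 1
  ring

end Coefficients

/-! ### Equality of generalised functions -/

section Equality

variable {ι : Type*} [LinearOrder ι]

/-- The exponent of the Dirac mass of `v` and its partner. -/
noncomputable def diracExponent (m : ι → Option ι) (v : ι) : (ι × ι) →₀ ℕ :=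
  (m v).elim 0 fun w => Finsupp.single (v, w) 1

theorem exists_prod_diracTerm_eq_monomial (m : ι → Option ι) (s : Finset ι) :
    ∃ a, ∏ v ∈ s, diracTerm m v = MvPolynomial.monomial (∑ v ∈ s, diracExponent m v) a := by
  induction s using Finset.induction_on with
  | empty => exact ⟨1, by simp⟩
  | insert v s hv ih =>
    obtain ⟨a, ha⟩ := ih
    obtain ⟨b, hb⟩ : ∃ b, diracTerm m v = MvPolynomial.monomial (diracExponent m v) b := by
      unfold diracTerm diracExponent
      rcases m v with _ | w
      · exact ⟨1, rfl⟩
      · exact ⟨_, by rw [Option.elim_some, Option.elim_some, fn, MvPolynomial.C_mul_X_eq_monomial]⟩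
    rw [Finset.prod_insert hv, Finset.sum_insert hv, ha, hb, MvPolynomial.monomial_mul]
    exact ⟨_, rfl⟩

/-- The Dirac masses of a matching form a single monomial whose exponent contains every matched
pair. On its carrier, `x` is thus constant along the links, and equality there suffices. -/
theorem coeff_prod_diracTerm_mul_fn [Fintype ι] (m : ι → Option ι) {f f' : (ι → ℝ) → ℂ}
    (h : ∀ x, (∀ v w, m v = some w → x v = x w) → f x = f' x) (δ : (ι × ι) →₀ ℕ) {x : ι → ℝ}
    (hx : x ∈ carrier δ) :
    MvPolynomial.coeff δ ((∏ v, diracTerm m v) * fn f) x =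
      MvPolynomial.coeff δ ((∏ v, diracTerm m v) * fn f') x := by
  classical
  obtain ⟨a, ha⟩ := exists_prod_diracTerm_eq_monomial m Finset.univ
  rw [ha, fn, fn, mul_comm _ (MvPolynomial.C f), mul_comm _ (MvPolynomial.C f'),
    MvPolynomial.coeff_C_mul, MvPolynomial.coeff_C_mul, MvPolynomial.coeff_monomial]
  split_ifs with hδ
  · rw [Pi.mul_apply, Pi.mul_apply, h x fun v w hvw => ?_]
    refine hx (v, w) ?_
    rw [← hδ, Finsupp.mem_support_iff, Finsupp.finsetSum_apply]
    refine (Finset.sum_pos' (fun _ _ => Nat.zero_le _) ⟨v, Finset.mem_univ v, ?_⟩).ne'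
    simp [diracExponent, hvw]
  · rw [mul_zero, mul_zero]

/-- The measure is a push-forward by a map whose image lies in the carrier. -/
theorem ae_mem_carrier {ι : Type*} [Finite ι] (δ : (ι × ι) →₀ ℕ) :
    ∀ᵐ x ∂diracMeasure δ, x ∈ carrier δ := by
  have hmeas : MeasurableSet (carrier δ) := by
    have : carrier δ = ⋂ e ∈ δ.support, {x : ι → ℝ | x e.1 = x e.2} := by
      ext x
      simp only [carrier, Set.mem_ofPred_eq, Set.mem_iInter]
    rw [this]
    exact Finset.measurableSet_biInter _ fun e _ =>
      measurableSet_eq_fun (measurable_pi_apply _) (measurable_pi_apply _)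
  unfold diracMeasure
  refine (MeasureTheory.ae_map_iff (Measurable.aemeasurable ?_) hmeas).2
    (Filter.Eventually.of_forall fun t e he => ?_)
  · exact measurable_pi_lambda _ fun v => measurable_pi_apply _
  · exact congrArg t (Quot.sound he)

theorem pairing_congr {ι : Type*} [Finite ι] {D D' : GenDensity ι}
    (h : ∀ δ, ∀ x ∈ carrier δ, MvPolynomial.coeff δ D x = MvPolynomial.coeff δ D' x)
    (φ : (ι → ℝ) → ℂ) : pairing D φ = pairing D' φ := by
  classical
  -- Coefficients agreeing only on carriers may have different supports as polynomials, so both sums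
  -- are extended to the union.
  have hext : ∀ (E : GenDensity ι) (s : Finset ((ι × ι) →₀ ℕ)), E.support ⊆ s →
      pairing E φ = ∑ δ ∈ s, ∫ x, MvPolynomial.coeff δ E x * φ x ∂(diracMeasure δ) := by
    intro E s hs
    refine Finset.sum_subset hs fun δ _ hδ => ?_
    rw [MvPolynomial.notMem_support_iff.1 hδ]
    simp
  rw [hext D _ Finset.subset_union_left, hext D' _ (Finset.subset_union_right (s₁ := D.support))]
  refine Finset.sum_congr rfl fun δ _ => MeasureTheory.integral_congr_ae ?_
  filter_upwards [ae_mem_carrier δ] with x hx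
  rw [h δ x hx]

end Equality

/-! ### Assembly of the equality of coefficients -/

section Main

variable {g : ℝ} {k : ℕ} {r : ℕ → ℕ} {A₁ A₂ : ℕ → Finset (Var k r)}

/-- Both sides are now indexed by matchings with the same Dirac masses, so the comparison is made
term by term on the carrier. -/
theorem coeff_gTot_eq (hg : g ≠ 0) (hk : 1 ≤ k) (mass : ℝ) (O : ℕ → LocalOperator g)
    (ε ε' : ℕ → ℝ) (hdisj : ∀ s < k, Disjoint (A₁ s) (A₂ s))
    (hunion : ∀ s < k, A₁ s ∪ A₂ s = setA k r s) (G : SchwartzMap (Lvl k → ℝ × ℝ) ℂ)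
    {c d : MPart k r → ℕ → List (Var k r)}
    (hc : ∀ P ∈ MPart.all A₁ A₂, ∀ p ∈ Finset.Icc 1 (k - 1),
      IsOrdering (c P p) (MPart.C1 A₁ A₂ P p))
    (hd : ∀ P ∈ MPart.all A₁ A₂, ∀ p ∈ Finset.Icc 1 (k - 1),
      IsOrdering (d P p) (MPart.D1 A₁ A₂ P p))
    (δ : (Var k r × Var k r) →₀ ℕ) {x : Config k r} (hx : x ∈ carrier δ) :
    MvPolynomial.coeff δ (gTot mass O ε ε' A₁ A₂ G) x =
      MvPolynomial.coeff δ (masterSum mass O ε ε' A₁ A₂ G c d) x := by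
  rw [gTot, gDensity_eq_sum_matchings O ε ε' hdisj hunion,
    masterSum_eq_sum_matchings mass hk O ε ε' hdisj hunion G c d, Finset.sum_mul,
    MvPolynomial.coeff_sum, MvPolynomial.coeff_sum, Finset.sum_apply, Finset.sum_apply]
  refine Finset.sum_congr rfl fun m hm => ?_
  rw [mul_assoc, fn_mul]
  exact coeff_prod_diracTerm_mul_fn m (fun y hy =>
    prod_kernelCoef_mul_smear hg hk mass O ε ε' hdisj hunion G hc hd hm hy) δ hx

end Main

end SinhGordon

theorem mainTheorem7 (g : ℝ) (hg : g ≠ 0) (mass : ℝ) (k : ℕ) (hk : 1 ≤ k) (r : ℕ → ℕ)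
    (O : ℕ → SinhGordon.LocalOperator g)
    (ε ε' : ℕ → ℝ) (hε : ∀ p ∈ Finset.Icc 1 k, 0 < ε p) (hε' : ∀ p ∈ Finset.Icc 1 k, 0 < ε' p)
    (A₁ A₂ : ℕ → Finset (SinhGordon.Var k r))
    (hdisj : ∀ s < k, Disjoint (A₁ s) (A₂ s))
    (hunion : ∀ s < k, A₁ s ∪ A₂ s = SinhGordon.setA k r s)
    (G : SchwartzMap (SinhGordon.Lvl k → ℝ × ℝ) ℂ)
    (c d : SinhGordon.MPart k r → ℕ → List (SinhGordon.Var k r))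
    (hc : ∀ P ∈ SinhGordon.MPart.all A₁ A₂, ∀ p ∈ Finset.Icc 1 (k - 1),
      SinhGordon.IsOrdering (c P p) (SinhGordon.MPart.C1 A₁ A₂ P p))
    (hd : ∀ P ∈ SinhGordon.MPart.all A₁ A₂, ∀ p ∈ Finset.Icc 1 (k - 1),
      SinhGordon.IsOrdering (d P p) (SinhGordon.MPart.D1 A₁ A₂ P p)) :
    (∀ δ : (SinhGordon.Var k r × SinhGordon.Var k r) →₀ ℕ, ∀ x ∈ SinhGordon.carrier δ,
      MvPolynomial.coeff δ (SinhGordon.gTot mass O ε ε' A₁ A₂ G) x =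
        MvPolynomial.coeff δ (SinhGordon.masterSum mass O ε ε' A₁ A₂ G c d) x) ∧
    (∀ φ : SinhGordon.Config k r → ℂ, Continuous φ → HasCompactSupport φ →
      SinhGordon.pairing (SinhGordon.gTot mass O ε ε' A₁ A₂ G) φ =
        SinhGordon.pairing (SinhGordon.masterSum mass O ε ε' A₁ A₂ G c d) φ) := by
  have h : ∀ δ : (SinhGordon.Var k r × SinhGordon.Var k r) →₀ ℕ, ∀ x ∈ SinhGordon.carrier δ,
      MvPolynomial.coeff δ (SinhGordon.gTot mass O ε ε' A₁ A₂ G) x =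
        MvPolynomial.coeff δ (SinhGordon.masterSum mass O ε ε' A₁ A₂ G c d) x :=
    fun δ _ hx => SinhGordon.coeff_gTot_eq hg hk mass O ε ε' hdisj hunion G hc hd δ hx
  exact ⟨h, fun φ _ _ => SinhGordon.pairing_congr h φ⟩
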